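/- Let $E/\mathbb{Q}_p$ be a finite extension with ring of integers $\mathcal{O}_E$, uniformizer $\pi$ and residue field $\mathbb{F}_q=\mathcal{O}_E/\pi$. Let $H=H_E$ be a Lubin–Tate formal $\mathcal{O}_E$-module for $\pi$, that is, a one-dimensional commutative formal group law over $\mathcal{O}_E$ with a ring homomorphism $a\mapsto [a]$ from $\mathcal{O}_E$ to its endomorphisms such that $[a](T)=aT+\cdots$ for all $a$ and $[\pi](T)\equiv T^q \pmod \pi$. For $n\ge 1$ let $E_n$ be obtained from $E$ by adjoining, in an algebraic closure, the $\pi^n$-torsion points $H[\pi^n]$ in the open unit disc, let $E_\infty=\bigcup_n E_n$, let $\hat E_\infty$ be its completion, and let $\mathcal{O}_{\hat E_\infty^\flat}=\varprojlim_{x\mapsto x^p}\mathcal{O}_{\hat E_\infty}/p$, with the inverse limit topology, be the ring of integers of the tilt of $\hat E_\infty$; it is an $\mathbb{F}_q$-algebra through Teichmüller representatives. Then: (1) There is an isomorphism of topological groups $\mathcal{O}_E^\times\cong \mathrm{Gal}(E_\infty/E)$, $u\mapsto\sigma_u$, with $\sigma_u(x)=[u](x)$ for every $x\in H[\pi^n]$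 and every $n$. (2) Let $H_{E,0}=\mathrm{Spf}\,\mathbb{F}_q[[T]]$ be the special fibre of $H$, and let $\tilde H_{E,0}=\varprojlim_{[\pi]} H_{E,0}$ be the special fibre of its universal cover, with its action of $E^\times$: for $a\in E^\times$ and any $m\ge 0$ with $\pi^m a\in\mathcal{O}_E$, $a\cdot(x_n)_n=([\pi^m a](x_{n+m}))_n$. Then $\tilde H_{E,0}\cong\mathrm{Spf}\,\mathbb{F}_q[[T^{1/q^\infty}]]$, where $\mathbb{F}_q[[T^{1/q^\infty}]]$ is the $T$-adic completion of $\bigcup_n\mathbb{F}_q[T^{1/q^n}]$ and $T^{1/q^n}$ is the coordinate of the $n$-th copy of $H_{E,0}$ in the limit ($n\ge 0$). (3) There is an isomorphism of topological $\mathbb{F}_q$-algebras $\mathbb{F}_q[[T^{1/q^\infty}]]\cong\mathcal{O}_{\hat E_\infty^\flat}$ such that the resulting isomorphism of formal schemes over $\mathbb{F}_q$ $$\tilde H_{E,0}\cong \mathrm{Spf}\,\mathcal{O}_{\hat E_\infty^\flat}$$ is $E^\times$-equivariant, where $a=\pi^m u\in E^\times$ ($m\in\mathbb{Z}$, $u\in\mathcal{O}_E^\times$)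 acts on $\mathcal{O}_{\hat E_\infty^\flat}$ by $\mathrm{Frob}_q^m\circ\sigma_u$; here $\mathrm{Frob}_q$ is the $q$-th power map and $\sigma_u$ acts by functoriality. -/

import Mathlib

open CategoryTheory Topology

noncomputable section

namespace LubinTate

universe u

/-! ### Rings of integers and residue fields -/

/-- The ring of integers (closed unit ball) of a nonarchimedean normed field. -/
abbrev OO (K : Type u) [NormedField K] [IsUltrametricDist K] : Subring K :=
  (NormedField.valuation (K := K)).integer

section Integers

variable {K : Type u} [NormedField K] [IsUltrametricDist K]

theorem mem_OO_iff {x : K} : x ∈ OO K ↔ ‖x‖ ≤ 1 := by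
  simp [Valuation.mem_integer_iff, ← NNReal.coe_le_coe]

theorem isUnit_OO_iff {x : OO K} : IsUnit x ↔ ‖(x : K)‖ = 1 := by
  simpa [← NNReal.coe_inj] using!
    (Valuation.integer.integers (NormedField.valuation (K := K))).isUnit_iff_valuation_eq_one

theorem norm_lt_one {x : OO K} (hx : ¬ IsUnit x) : ‖(x : K)‖ < 1 :=
  lt_of_le_of_ne (mem_OO_iff.1 x.2) fun h => hx (isUnit_OO_iff.2 h)

theorem dvd_OO {x y : OO K} (h : ‖(y : K)‖ ≤ ‖(x : K)‖) : x ∣ y := by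
  refine (Valuation.integer.integers (NormedField.valuation (K := K))).dvd_of_le ?_
  simpa [← NNReal.coe_le_coe] using! h

end Integers

section LocalField

variable (E : Type u) [NontriviallyNormedField E] [IsUltrametricDist E]

/-- The residue field of the ring of integers. -/
abbrev Res : Type u := IsLocalRing.ResidueField (OO E)

/-- The cardinality `q` of the residue field. -/
def resCard : ℕ := Nat.card (Res E)

theorem dvr_and_finite [ProperSpace E] :
    IsDiscreteValuationRing (OO E) ∧ Finite (Res E) := by
  let _ := NormedField.toValued (K := E)
  let _ : (Valued.v (R := E) (Γ₀ := NNReal)).RankOne :=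
    inferInstanceAs (NormedField.valuation (K := E)).RankOne
  have : CompactSpace (Valued.integer E) := by
    have h : (Valued.integer E : Set E) = Metric.closedBall 0 1 := by
      ext x
      rw [mem_closedBall_zero_iff]
      exact mem_OO_iff
    exact isCompact_iff_compactSpace.1 (h ▸ isCompact_closedBall (0 : E) 1)
  exact (Valued.integer.compactSpace_iff_completeSpace_and_isDiscreteValuationRing_and_finite_residueField.1 this).2

instance [ProperSpace E] : IsDiscreteValuationRing (OO E) := (dvr_and_finite E).1

instance [ProperSpace E] : Finite (Res E) := (dvr_and_finite E).2

theorem resCard_ne_zero [ProperSpace E] : resCard E ≠ 0 := Nat.card_pos.ne'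

end LocalField

section ResidueChar

variable (p : ℕ) [Fact p.Prime] (K : Type u) [NormedField K] [IsUltrametricDist K]
  [NormedAlgebra ℚ_[p] K]

theorem norm_p : ‖((p : OO K) : K)‖ = (p : ℝ)⁻¹ := by
  have : ((p : OO K) : K) = algebraMap ℚ_[p] K p := by simp
  rw [this, norm_algebraMap', Padic.norm_p]

theorem not_isUnit_p : ¬ IsUnit (p : OO K) := by
  rw [isUnit_OO_iff, norm_p]
  have := (Fact.out : p.Prime).one_lt
  exact (inv_lt_one_of_one_lt₀ (by exact_mod_cast this)).ne

instance : Fact (¬ IsUnit (p : OO K)) := ⟨not_isUnit_p p K⟩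

theorem charP_res (E : Type u) [NontriviallyNormedField E] [IsUltrametricDist E]
    [NormedAlgebra ℚ_[p] E] : CharP (Res E) p := by
  refine (CharP.charP_iff_prime_eq_zero (Fact.out : p.Prime)).2 ?_
  rw [← map_natCast (IsLocalRing.residue (OO E)), IsLocalRing.residue_eq_zero_iff]
  exact not_isUnit_p p E

/-- The residue degree: the cardinality of the residue field is `p ^ resDeg`. -/
def resDeg (E : Type u) [NontriviallyNormedField E] [IsUltrametricDist E] : ℕ :=
  Nat.log p (resCard E)

theorem resCard_eq (E : Type u) [NontriviallyNormedField E] [IsUltrametricDist E]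
    [ProperSpace E] [NormedAlgebra ℚ_[p] E] : resCard E = p ^ resDeg p E := by
  have := charP_res p E
  have := Fintype.ofFinite (Res E)
  obtain ⟨n, -, hn⟩ := FiniteField.card (Res E) p
  rw [resDeg, resCard, Nat.card_eq_fintype_card, hn, Nat.log_pow (Fact.out : p.Prime).one_lt]

end ResidueChar

/-! ### Formal modules -/

/-- A (one-dimensional, commutative) formal `O`-module over `O`: a commutative formal group law
`F` with a ring homomorphism `a ↦ [a]` from `O` to its endomorphisms such that `[a](T) = a T + ⋯`. -/
structure FormalModule (O : Type u) [CommRing O] where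
  /-- the formal group law `F(X, Y)` -/
  law : FormalGroup O
  comm : law.IsComm
  /-- the power series `[a](T)` -/
  act : O → PowerSeries O
  constantCoeff_act (a : O) : (act a).constantCoeff = 0
  coeff_one_act (a : O) : (act a).coeff 1 = a
  act_subst_law (a : O) :
    (act a).subst law.toPowerSeries =
      law.toPowerSeries.subst ![(act a).subst (MvPowerSeries.X 0 : MvPowerSeries (Fin 2) O),
        (act a).subst (MvPowerSeries.X 1 : MvPowerSeries (Fin 2) O)]
  act_one : act 1 = PowerSeries.X
  act_add (a b : O) : act (a + b) = law.toPowerSeries.subst ![act a, act b]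
  act_mul (a b : O) : act (a * b) = (act a).subst (act b)

/-! ### Formal spectra as functors of points -/

section Spf

variable (k : Type u) [CommRing k]

/-- Continuous `k`-algebra homomorphisms from a topological `k`-algebra `A` to a discrete one. -/
abbrev SpfPoints (A : Type u) [CommRing A] [Algebra k A] [TopologicalSpace A]
    (R : Type u) [CommRing R] [Algebra k R] : Type u :=
  {φ : A →ₐ[k] R // Continuous[_, ⊥] φ}

/-- The formal spectrum of a topological `k`-algebra `A`, as a functor on `k`-algebras: its
`R`-points are the continuous `k`-algebra homomorphisms from `A` to the discrete ring `R`. -/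
def Spf (A : Type u) [CommRing A] [Algebra k A] [TopologicalSpace A] :
    CommAlgCat.{u} k ⥤ Type u where
  obj R := SpfPoints k A R
  map {R S} f := TypeCat.ofHom fun φ : SpfPoints k A R =>
    (⟨f.hom.comp φ.1, by
      let _ : TopologicalSpace R := ⊥
      let _ : TopologicalSpace S := ⊥
      have : DiscreteTopology R := ⟨rfl⟩
      exact (continuous_of_discreteTopology (f := f.hom)).comp φ.2⟩ : SpfPoints k A S)

variable {k}
variable {A B : Type u} [CommRing A] [Algebra k A] [TopologicalSpace A]
  [CommRing B] [Algebra k B] [TopologicalSpace B]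

/-- The continuous homomorphism `A → R` underlying an `R`-point of `Spf A`. -/
def Spf.hom {R : CommAlgCat.{u} k} (x : (Spf k A).obj R) : A →ₐ[k] R :=
  Subtype.val (p := fun φ : A →ₐ[k] R => Continuous[_, ⊥] φ) x

theorem Spf.hom_injective {R : CommAlgCat.{u} k} {x y : (Spf k A).obj R}
    (h : Spf.hom x = Spf.hom y) : x = y := Subtype.ext h

/-- The morphism of formal spectra given by a continuous homomorphism of `k`-algebras. -/
def Spf.map (f : A →ₐ[k] B) (hf : Continuous f) : Spf k B ⟶ Spf k A where
  app R := TypeCat.ofHom fun φ : SpfPoints k B R => (⟨φ.1.comp f, by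
    let _ : TopologicalSpace R := ⊥
    exact φ.2.comp hf⟩ : SpfPoints k A R)
  naturality R S g := rfl

/-- The isomorphism of formal spectra given by an isomorphism of topological `k`-algebras. -/
def Spf.mapIso (e : A ≃A[k] B) : Spf k A ≅ Spf k B where
  hom := Spf.map (e.symm : B →A[k] A).toAlgHom e.symm.continuous
  inv := Spf.map (e : A →A[k] B).toAlgHom e.continuous
  hom_inv_id := by
    ext R φ
    apply Spf.hom_injective
    apply AlgHom.ext
    intro x
    exact congrArg (Spf.hom φ) (e.symm_apply_apply x)
  inv_hom_id := by
    ext R φ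
    apply Spf.hom_injective
    apply AlgHom.ext
    intro x
    exact congrArg (Spf.hom φ) (e.apply_symm_apply x)

end Spf

open scoped PowerSeries.WithPiTopology in
/-- The `T`-adic topology on `k⟦T⟧`, i.e. the product topology for the discrete topology on `k`. -/
instance powerSeriesTopology (k : Type u) [CommRing k] : TopologicalSpace (PowerSeries k) :=
  letI : TopologicalSpace k := ⊥
  inferInstance

/-! ### The special fibre of a formal module and its universal cover -/

namespace FormalModule

theorem hasSubst_act {O : Type u} [CommRing O] (H : FormalModule O) (a : O) :
    PowerSeries.HasSubst (H.act a) :=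
  PowerSeries.HasSubst.of_constantCoeff_zero' (H.constantCoeff_act a)

section

variable {O : Type u} [CommRing O] [IsLocalRing O] (H : FormalModule O)

local notation "κ" => IsLocalRing.ResidueField O

/-- The reduction of `[a](T)` to the residue field. -/
def red (a : O) : PowerSeries κ := (H.act a).map (IsLocalRing.residue O)

theorem constantCoeff_red (a : O) : (H.red a).constantCoeff = 0 := by
  rw [red, ← PowerSeries.coeff_zero_eq_constantCoeff_apply, PowerSeries.coeff_map,
    PowerSeries.coeff_zero_eq_constantCoeff_apply, H.constantCoeff_act, map_zero]

theorem hasSubst_red (a : O) : PowerSeries.HasSubst (H.red a) :=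
  PowerSeries.HasSubst.of_constantCoeff_zero' (H.constantCoeff_red a)

theorem red_mul (a b : O) : H.red (a * b) = (H.red a).subst (H.red b) := by
  rw [red, H.act_mul]
  exact PowerSeries.map_subst (H.hasSubst_act b) (H.act a)

theorem continuous_subst_red (a : O) :
    Continuous (PowerSeries.substAlgHom (R := κ) (H.hasSubst_red a)) := by
  let _ : UniformSpace κ := ⊥
  have : DiscreteUniformity κ := ⟨rfl⟩
  rw [PowerSeries.coe_substAlgHom]
  exact MvPowerSeries.continuous_subst (R := κ) (H.hasSubst_red a).const

/-- The special fibre `H₀ = Spf κ⟦T⟧` of the formal module. -/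
abbrev special (O : Type u) [CommRing O] [IsLocalRing O] :
    CommAlgCat.{u} (IsLocalRing.ResidueField O) ⥤ Type u :=
  Spf (IsLocalRing.ResidueField O) (PowerSeries (IsLocalRing.ResidueField O))

/-- The endomorphism `[a]` of the special fibre, `T ↦ [a](T)` on coordinate rings. -/
def endo (a : O) : special O ⟶ special O :=
  Spf.map (PowerSeries.substAlgHom (H.hasSubst_red a)) (H.continuous_subst_red a)

theorem endo_mul (a b : O) : H.endo (a * b) = H.endo b ≫ H.endo a := by
  ext R φ
  apply Spf.hom_injective
  apply AlgHom.ext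
  intro x
  refine congrArg (Spf.hom φ) ?_
  change PowerSeries.substAlgHom (H.hasSubst_red (a * b)) x =
    PowerSeries.substAlgHom (H.hasSubst_red b) (PowerSeries.substAlgHom (H.hasSubst_red a) x)
  simp only [PowerSeries.coe_substAlgHom]
  rw [PowerSeries.subst_comp_subst_apply (H.hasSubst_red a) (H.hasSubst_red b), red_mul]

theorem endo_comm (a b : O) (R : CommAlgCat.{u} κ) (x : (special O).obj R) :
    (H.endo a).app R ((H.endo b).app R x) = (H.endo b).app R ((H.endo a).app R x) := by
  have h : H.endo b ≫ H.endo a = H.endo a ≫ H.endo b := by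
    rw [← endo_mul, ← endo_mul, mul_comm]
  exact congrArg (fun f : special O ⟶ special O => f.app R x) h

/-- Points of the special fibre of the universal cover: sequences `(x₀, x₁, …)` of points of the
special fibre with `[π](xₙ₊₁) = xₙ`. -/
abbrev CoverPoints (π : O) (R : CommAlgCat.{u} κ) : Type u :=
  {x : ℕ → (special O).obj R // ∀ n, (H.endo π).app R (x (n + 1)) = x n}

theorem endo_map (a : O) {R S : CommAlgCat.{u} κ} (f : R ⟶ S) (x : (special O).obj R) :
    (H.endo a).app S ((special O).map f x) = (special O).map f ((H.endo a).app R x) :=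
  Spf.hom_injective rfl

/-- The special fibre of the universal cover, i.e. the limit of
`⋯ → H₀ → H₀ → H₀` with all transition maps `[π]`. -/
def cover (π : O) : CommAlgCat.{u} κ ⥤ Type u where
  obj R := H.CoverPoints π R
  map {R S} f := TypeCat.ofHom fun x : H.CoverPoints π R =>
    (⟨fun n => (special O).map f (x.1 n), fun n => by
      rw [H.endo_map, x.2 n]⟩ : H.CoverPoints π S)
  map_id R := by
    ext x n
    exact Spf.hom_injective rfl
  map_comp f g := by
    ext x n
    exact Spf.hom_injective rfl

/-- The `n`-th coordinate of a point of the universal cover. -/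
def coord {π : O} {R : CommAlgCat.{u} κ} (x : (H.cover π).obj R) (n : ℕ) : (special O).obj R :=
  Subtype.val (p := fun x : ℕ → (special O).obj R => ∀ n, (H.endo π).app R (x (n + 1)) = x n) x n

theorem coord_succ {π : O} {R : CommAlgCat.{u} κ} (x : (H.cover π).obj R) (n : ℕ) :
    (H.endo π).app R (H.coord x (n + 1)) = H.coord x n :=
  Subtype.property (p := fun x : ℕ → (special O).obj R =>
    ∀ n, (H.endo π).app R (x (n + 1)) = x n) x n

/-- The endomorphism `(xₙ)ₙ ↦ ([b](xₙ₊ₘ))ₙ` of the universal cover, i.e. the action of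
`π⁻ᵐ b`. -/
def coverShift (π b : O) (m : ℕ) : H.cover π ⟶ H.cover π where
  app R := TypeCat.ofHom fun x : (H.cover π).obj R =>
    (⟨fun n => (H.endo b).app R (H.coord x (n + m)), fun n => by
      rw [H.endo_comm, Nat.add_right_comm, H.coord_succ]⟩ : H.CoverPoints π R)
  naturality R S f := by
    ext x
    refine Subtype.ext (funext fun n => ?_)
    exact Spf.hom_injective rfl

end

section Action

variable {E : Type u} [NontriviallyNormedField E] [IsUltrametricDist E]
  (H : FormalModule (OO E)) {π : OO E}

theorem exists_pow_mul_mem (hπ : Irreducible π) (a : E) : ∃ m : ℕ, (π : E) ^ m * a ∈ OO E := by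
  have h1 : ‖(π : E)‖ < 1 := norm_lt_one hπ.not_isUnit
  obtain ⟨m, hm⟩ := exists_pow_lt_of_lt_one (y := ‖(π : E)‖)
    (x := (‖a‖ + 1)⁻¹) (by positivity) h1
  refine ⟨m, mem_OO_iff.2 ?_⟩
  rw [norm_mul, norm_pow]
  have h0 : 0 < ‖a‖ + 1 := by positivity
  calc ‖(π : E)‖ ^ m * ‖a‖ ≤ (‖a‖ + 1)⁻¹ * (‖a‖ + 1) :=
        mul_le_mul hm.le (by linarith) (norm_nonneg _) (by positivity)
    _ = 1 := inv_mul_cancel₀ h0.ne'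

open Classical in
/-- The action of `a ∈ E` on the universal cover: if `πᵐ a ∈ O_E`, it is
`(xₙ)ₙ ↦ ([πᵐ a](xₙ₊ₘ))ₙ` (for the least such `m`). -/
def coverAct (hπ : Irreducible π) (a : E) : H.cover π ⟶ H.cover π :=
  H.coverShift π
    ⟨(π : E) ^ Nat.find (exists_pow_mul_mem hπ a) * a, Nat.find_spec (exists_pow_mul_mem hπ a)⟩
    (Nat.find (exists_pow_mul_mem hπ a))

end Action

end FormalModule

/-! ### The algebraic closure and its absolute value -/

section Tower

variable {E : Type u} [NontriviallyNormedField E] [IsUltrametricDist E] [ProperSpace E]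

/-- The algebraic closure of `E`, with the unique extension of the absolute value of `E`. -/
instance normedFieldAlgClosure : NormedField (AlgebraicClosure E) :=
  spectralNorm.normedField E (AlgebraicClosure E)

theorem norm_algClosure (x : AlgebraicClosure E) :
    ‖x‖ = spectralNorm E (AlgebraicClosure E) x := rfl

instance : IsUltrametricDist (AlgebraicClosure E) :=
  IsUltrametricDist.isUltrametricDist_of_isNonarchimedean_norm
    (isNonarchimedean_spectralNorm (K := E) (L := AlgebraicClosure E))

/-! ### Torsion points and the Lubin–Tate tower -/

namespace FormalModule

variable (H : FormalModule (OO E))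

/-- `[a](x) = y`, for points `x`, `y` of the open unit disc over the algebraic closure: the series
`[a](T)`, evaluated at `x`, converges to `y`. -/
def EvalsTo (a : OO E) (x y : AlgebraicClosure E) : Prop :=
  HasSum (fun i : ℕ => algebraMap E (AlgebraicClosure E) ((H.act a).coeff i : OO E) * x ^ i) y

/-- The `a`-torsion points `H[a]` of the formal module, in the open unit disc over the algebraic
closure. -/
def torsion (a : OO E) : Set (AlgebraicClosure E) :=
  {x | ‖x‖ < 1 ∧ H.EvalsTo a x 0}

/-- The field `Eₙ` obtained by adjoining the `πⁿ`-torsion points. -/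
def torsionField (π : OO E) (n : ℕ) : IntermediateField E (AlgebraicClosure E) :=
  IntermediateField.adjoin E (H.torsion (π ^ n))

/-- The field `E_∞`, the union of the fields `Eₙ`. -/
def tower (π : OO E) : IntermediateField E (AlgebraicClosure E) :=
  ⨆ n, H.torsionField π n

end FormalModule

/-! ### Completions of algebraic extensions, and their tilts -/

variable (F : IntermediateField E (AlgebraicClosure E))

/-- The completion of an algebraic extension `F` of `E`. -/
abbrev Hat : Type u := UniformSpace.Completion F

instance : IsUltrametricDist F :=
  IsUltrametricDist.isUltrametricDist_of_forall_norm_add_le_max_norm fun x y =>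
    IsUltrametricDist.norm_add_le_max (x : AlgebraicClosure E) y

instance : IsUltrametricDist (Hat F) :=
  IsUltrametricDist.isUltrametricDist_of_forall_norm_add_le_max_norm fun x y => by
    refine UniformSpace.Completion.induction_on₂ x y ?_ fun a b => ?_
    · exact isClosed_le (by fun_prop) (by fun_prop)
    · rw [← UniformSpace.Completion.coe_add]
      simpa only [UniformSpace.Completion.norm_coe] using IsUltrametricDist.norm_add_le_max a b

/-- The embedding of `E` into the completion of `F`. -/
def toHat : E →+* Hat F := UniformSpace.Completion.coeRingHom.comp (algebraMap E F)

theorem norm_toHat (x : E) : ‖toHat F x‖ = ‖x‖ := by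
  change ‖((algebraMap E F x : F) : Hat F)‖ = ‖x‖
  rw [UniformSpace.Completion.norm_coe]
  exact spectralNorm_extends (K := E) (L := AlgebraicClosure E) x

/-- The embedding of the ring of integers of `E` into that of the completion of `F`. -/
def toOOHat : OO E →+* OO (Hat F) :=
  ((toHat F).comp (OO E).subtype).codRestrict (OO (Hat F)) fun x =>
    mem_OO_iff.2 ((norm_toHat F x).trans_le (mem_OO_iff.1 x.2))

theorem norm_gal (σ : F ≃ₐ[E] F) (x : F) : ‖σ x‖ = ‖x‖ := by
  have h (y : F) : ‖y‖ = spectralNorm E F y :=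
    (spectralNorm.eq_of_tower (K := E) (L := AlgebraicClosure E) y).symm
  rw [h, h, spectralNorm, spectralNorm, minpoly.algEquiv_eq]

theorem isometry_gal (σ : F ≃ₐ[E] F) : Isometry (σ : F →+* F) :=
  AddMonoidHomClass.isometry_of_norm (σ : F →+* F) (norm_gal F σ)

/-- The extension to the completion of an automorphism of `F` over `E`. -/
def galHat (σ : F ≃ₐ[E] F) : Hat F →+* Hat F :=
  UniformSpace.Completion.mapRingHom (σ : F →+* F) (isometry_gal F σ).continuous

theorem norm_galHat (σ : F ≃ₐ[E] F) (x : Hat F) : ‖galHat F σ x‖ = ‖x‖ := by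
  have hc : Continuous (galHat F σ) := UniformSpace.Completion.continuous_map
  refine UniformSpace.Completion.induction_on x (isClosed_eq (by fun_prop) (by fun_prop))
    fun a => ?_
  rw [galHat, UniformSpace.Completion.mapRingHom_coe, UniformSpace.Completion.norm_coe,
    UniformSpace.Completion.norm_coe]
  exact norm_gal F σ a

/-- The action of an automorphism of `F` over `E` on the ring of integers of the completion. -/
def galOO (σ : F ≃ₐ[E] F) : OO (Hat F) →+* OO (Hat F) :=
  ((galHat F σ).comp (OO (Hat F)).subtype).codRestrict (OO (Hat F)) fun x =>
    mem_OO_iff.2 ((norm_galHat F σ x).trans_le (mem_OO_iff.1 x.2))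

variable (p : ℕ) [Fact p.Prime] [NormedAlgebra ℚ_[p] E]

instance : Fact (¬ IsUnit (p : OO (Hat F))) := ⟨by
  have h := norm_lt_one (not_isUnit_p p E)
  rw [isUnit_OO_iff]
  have h' : ((p : OO (Hat F)) : Hat F) = toHat F ((p : OO E) : E) := by simp
  rw [h', norm_toHat]
  exact h.ne⟩

/-- The ring of integers `lim_{x ↦ x^p} O/p` of the tilt of the completion of `F`, where `O` is
the ring of integers of the completion. -/
abbrev OTilt : Type u := PreTilt (OO (Hat F)) p

/-- The inverse limit topology on `lim_{x ↦ x^p} O/p`, with `O/p` discrete. -/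
instance preTiltTopology (O : Type u) [CommRing O] [Fact (¬ IsUnit (p : O))] :
    TopologicalSpace (PreTilt O p) :=
  ⨅ n : ℕ, TopologicalSpace.induced (PreTilt.coeff (O := O) (p := p) n) ⊥

/-- The action of an automorphism of `F` over `E` on the ring of integers of the tilt. -/
def galTilt (σ : F ≃ₐ[E] F) : OTilt F p →+* OTilt F p :=
  Perfection.map p (Ideal.quotientMap (Ideal.span {(p : OO (Hat F))}) (galOO F σ) (by
    rw [Ideal.span_le, Set.singleton_subset_iff]
    simp [Ideal.mem_span_singleton_self (p : OO (Hat F))]))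

/-- The `q`-th power Frobenius automorphism of the ring of integers of the tilt. -/
def frobTilt : RingAut (OTilt F p) := iterateFrobeniusEquiv (OTilt F p) p (resDeg p E)

theorem frobTilt_apply (x : OTilt F p) : frobTilt F p x = x ^ resCard E := by
  rw [resCard_eq p E]
  rfl

/-! The `𝔽_q`-algebra structure on the ring of integers of the tilt: `c ∈ 𝔽_q` is sent to the
system of its Teichmüller representatives. -/

theorem exists_pow_mem :
    ∃ N : ℕ, ∀ x : OO E, x ∈ IsLocalRing.maximalIdeal (OO E) →
      (p : OO E) ∣ x ^ p ^ (resDeg p E * N) := by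
  obtain ⟨ϖ, hϖ⟩ := IsDiscreteValuationRing.exists_irreducible (OO E)
  have h1 : ‖(ϖ : E)‖ < 1 := norm_lt_one hϖ.not_isUnit
  have hp : 1 < p := (Fact.out : p.Prime).one_lt
  obtain ⟨N, hN⟩ := exists_pow_lt_of_lt_one (y := ‖(ϖ : E)‖) (x := (p : ℝ)⁻¹) (by positivity) h1
  refine ⟨N, fun x hx => dvd_OO ?_⟩
  rw [hϖ.maximalIdeal_eq, Ideal.mem_span_singleton] at hx
  obtain ⟨y, rfl⟩ := hx
  have hr : 1 ≤ resDeg p E := by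
    by_contra h
    have h' : resDeg p E = 0 := by omega
    have hc := resCard_eq p E
    rw [h', pow_zero] at hc
    have : 1 < resCard E := Finite.one_lt_card
    omega
  have hle : N ≤ p ^ (resDeg p E * N) :=
    (Nat.le_mul_of_pos_left N hr).trans (Nat.lt_pow_self hp).le
  rw [norm_p]
  push_cast
  rw [norm_pow, norm_mul]
  calc (‖(ϖ : E)‖ * ‖(y : E)‖) ^ p ^ (resDeg p E * N)
      ≤ ‖(ϖ : E)‖ ^ p ^ (resDeg p E * N) := by
        refine pow_le_pow_left₀ (by positivity) ?_ _
        exact mul_le_of_le_one_right (norm_nonneg _) (mem_OO_iff.1 y.2)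
    _ ≤ ‖(ϖ : E)‖ ^ N := pow_le_pow_of_le_one (norm_nonneg _) h1.le hle
    _ ≤ (p : ℝ)⁻¹ := hN.le

/-- An exponent such that `x ^ (q ^ N)` is divisible by `p` for all `x` in the maximal ideal. -/
def teichExp (E : Type u) [NontriviallyNormedField E] [IsUltrametricDist E] [ProperSpace E]
    [NormedAlgebra ℚ_[p] E] : ℕ := (exists_pow_mem (E := E) p).choose

/-- The Teichmüller map modulo `p`, sending the residue class of `x` to `x ^ (q ^ N)` modulo `p` for
`N` large. -/
def teichMod : Res E →+* ModP (OO (Hat F)) p :=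
  Ideal.Quotient.lift (IsLocalRing.maximalIdeal (OO E))
    ((iterateFrobenius (ModP (OO (Hat F)) p) p (resDeg p E * teichExp p E)).comp
      ((Ideal.Quotient.mk _).comp (toOOHat F))) fun x hx => by
    have h := (exists_pow_mem (E := E) p).choose_spec x hx
    have h' := map_dvd (toOOHat F) h
    rw [map_natCast, map_pow] at h'
    rw [RingHom.comp_apply, RingHom.comp_apply, iterateFrobenius_def, ← map_pow,
      Ideal.Quotient.eq_zero_iff_mem, Ideal.mem_span_singleton]
    exact h'

instance : Algebra (Res E) (OTilt F p) :=
  letI := charP_res p E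
  RingHom.toAlgebra (Perfection.lift p (Res E) (ModP (OO (Hat F)) p) (teichMod F p))

end Tower

/-! ### The ring `k⟦T^{1/q^∞}⟧` -/

section PerfectPowerSeries

variable (k : Type u) [CommRing k] (q : ℕ)

/-- The exponents `m / q ^ n`. -/
def Exponents : AddSubmonoid ℚ≥0 where
  carrier := {x | ∃ n m : ℕ, x * q ^ n = m}
  zero_mem' := ⟨0, 0, by simp⟩
  add_mem' := by
    rintro x y ⟨n, m, h⟩ ⟨n', m', h'⟩
    refine ⟨n + n', m * q ^ n' + m' * q ^ n, ?_⟩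
    push_cast
    rw [← h, ← h']
    ring

/-- The exponent `1 / q ^ n`. -/
def Exponents.root (hq : q ≠ 0) (n : ℕ) : Exponents q :=
  ⟨((q : ℚ≥0) ^ n)⁻¹, n, 1, by
    have : (q : ℚ≥0) ≠ 0 := by exact_mod_cast hq
    simp [this]⟩

/-- The ring `k[T^{1/q^∞}]`, spanned over `k` by the monomials `T^{m/q^n}`. -/
abbrev PerfectPoly : Type u := AddMonoidAlgebra k (Exponents q)

/-- The ideal of `k[T^{1/q^∞}]` generated by `T`. -/
def idealT : Ideal (PerfectPoly k q) :=
  Ideal.span {AddMonoidAlgebra.single ⟨1, 0, 1, by simp⟩ 1}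

/-- The ring `k⟦T^{1/q^∞}⟧`, the `T`-adic completion of `k[T^{1/q^∞}]`. -/
abbrev PerfectSeries : Type u := AdicCompletion (idealT k q) (PerfectPoly k q)

/-- The `T`-adic topology on `k⟦T^{1/q^∞}⟧`, i.e. the inverse limit topology. -/
instance : TopologicalSpace (PerfectSeries k q) :=
  ⨅ n : ℕ, TopologicalSpace.induced (AdicCompletion.evalₐ (idealT k q) n) ⊥

/-- The element `T^{1/q^n}` of `k⟦T^{1/q^∞}⟧`. -/
def rootT (hq : q ≠ 0) (n : ℕ) : PerfectSeries k q :=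
  AdicCompletion.of (idealT k q) (PerfectPoly k q)
    (AddMonoidAlgebra.single (Exponents.root q hq n) 1)

end PerfectPowerSeries

end LubinTate

end

open LubinTate CategoryTheory

universe u

/-!
The proof rests on a generator of the Tate module of the Lubin–Tate module: points `z₀ = 0, z₁, …`
of the open unit disc with `[π](zₙ₊₁) = zₙ` and `zₙ` of exact order `πⁿ`
(`FormalModule.exists_tateGenerator`). By Weierstrass preparation, the points of exact order
`πⁿ⁺¹` are the roots of an Eisenstein polynomial of degree `qⁿ⁺¹ - qⁿ`
(`FormalModule.exists_eisenstein`), and counting zeros shows that every `πⁿ`-torsion point is a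
multiple `[a](zₙ)` (`FormalModule.IsPrimitive.exists_pt_eq`). The points of the disc are never made
into a group: all that is needed of the formal group law is that `[a] - [b]` is a unit multiple of
`[a - b]`.

*The Galois group.* An automorphism of `E_∞` sends each `zₙ` to a multiple of it, and these
multiples converge to the action of a single unit. Conversely, `zₙ` and `[v](zₙ)` are roots of the
same Eisenstein polynomial, hence conjugate, and compactness of the Galois group provides an
automorphism acting as `[v]` at all levels at once (`FormalModule.exists_reciprocity`).

*The universal cover.* On the special fibre `[π]` is `T ↦ T^q`, so that a point of the universal
cover with values in `R` is a system of successive `q`-th roots of a nilpotent element of `R`; this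
is also what a continuous homomorphism from `𝔽_q⟦T^{1/q^∞}⟧` to `R` amounts to
(`FormalModule.exists_cover_iso`).

*The tilt.* Since `[π](T) ≡ T^q`, the reductions of the `zₙ` modulo `π` form such a system in the
ring of integers `O` of `Ê_∞` modulo `π`, and `T^{1/q^n} ↦ zₙ` defines a homomorphism
`ψ : 𝔽_q[T^{1/q^∞}] → O / π`. It is surjective, because the ring of integers of the totally ramified
extension `E(zₙ)` is `O_E[zₙ]`, and its kernel is controlled by the absolute value of `zₙ`: it is
contained in the ideal generated by `T^{1/q}` and contains `T`. The ring `O / p` is a nilpotent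
thickening of `O / π`, so that the tilt is the perfection of `O / π`, that is, its elements are the
systems of successive `q`-th roots in `O / π`. As `𝔽_q[T^{1/q^∞}]` is perfect, `ψ` lifts to the
tilt, and the kernels of the maps of the tilt to `O / π` cut out ideals cofinal with the powers of
`T`; hence the tilt is the `T`-adic completion (`exists_adicCompletion_equiv_perfection`,
`FormalModule.IsTateGenerator.exists_tilt_equiv`).

*Equivariance.* Two continuous homomorphisms from the tilt to a discrete ring agree as soon as they
do so on `𝔽_q` and on the `T^{1/q^n}`. The automorphism belonging to `v` sends `zₙ` to `[v](zₙ)`,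
hence `T^{1/q^n}` to the reduction of `[v]` evaluated at `T^{1/q^n}`, modulo any given level
(`FormalModule.IsTateGenerator.exists_tiltLevel_galTilt`), whereas `π` acts on the cover by raising
coordinates to the `q`-th power
(`FormalModule.IsTateGenerator.hom_eq_hom_frobTilt_galTilt`).
-/

open CategoryTheory Topology

noncomputable section

namespace LubinTate

/-! ### Values of power series in the open unit disc -/

section Evaluation

variable {O : Type*} [CommRing O] {K : Type*} [NormedField K] {j : O →+* K} {x : K}

theorem norm_term_le (hj : ∀ a, ‖j a‖ ≤ 1) (f : PowerSeries O) (x : K) (i : ℕ) :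
    ‖j (f.coeff i) * x ^ i‖ ≤ ‖x‖ ^ i := by
  rw [norm_mul, norm_pow]
  exact mul_le_of_le_one_left (by positivity) (hj _)

theorem summable_norm_terms (hj : ∀ a, ‖j a‖ ≤ 1) (hx : ‖x‖ < 1) (f : PowerSeries O) :
    Summable fun i => ‖j (f.coeff i) * x ^ i‖ :=
  .of_nonneg_of_le (fun _ => norm_nonneg _) (norm_term_le hj f x)
    (summable_geometric_of_lt_one (norm_nonneg _) hx)

/-- Evaluation of power series at a point of the open unit disc of a complete field. -/
def evalHom [CompleteSpace K] (hj : ∀ a, ‖j a‖ ≤ 1) (hx : ‖x‖ < 1) : PowerSeries O →+* K where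
  toFun f := ∑' i, j (f.coeff i) * x ^ i
  map_one' := by
    rw [tsum_eq_single 0]
    · simp
    · intro i hi
      simp [PowerSeries.coeff_one, hi]
  map_zero' := by simp
  map_add' f g := by
    rw [← (summable_norm_terms hj hx f).of_norm.tsum_add (summable_norm_terms hj hx g).of_norm]
    simp [add_mul]
  map_mul' f g := by
    rw [tsum_mul_tsum_eq_tsum_sum_antidiagonal_of_summable_norm (summable_norm_terms hj hx f)
      (summable_norm_terms hj hx g)]
    refine tsum_congr fun n => ?_
    rw [PowerSeries.coeff_mul, map_sum, Finset.sum_mul]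
    refine Finset.sum_congr rfl fun ij hij => ?_
    rw [← Finset.HasAntidiagonal.mem_antidiagonal.1 hij, map_mul, pow_add]
    ring

end Evaluation

section EvalPt

variable {E : Type u} [NontriviallyNormedField E] [IsUltrametricDist E] [ProperSpace E]

instance : NormedAlgebra E (AlgebraicClosure E) := spectralNorm.normedAlgebra E (AlgebraicClosure E)

theorem norm_algebraMap_closure (a : E) : ‖algebraMap E (AlgebraicClosure E) a‖ = ‖a‖ :=
  spectralNorm_extends a

open IntermediateField

instance (x : AlgebraicClosure E) : CompleteSpace E⟮x⟯ := by
  let _ : NormedSpace E E⟮x⟯ :=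
    { norm_smul_le := fun a y => (norm_smul_le a (y : AlgebraicClosure E) :) }
  have : FiniteDimensional E E⟮x⟯ :=
    adjoin.finiteDimensional (Algebra.IsIntegral.isIntegral x)
  exact FiniteDimensional.complete E E⟮x⟯

/-- The value at `x` of a power series with integral coefficients, for `x` in the open unit disc
over the algebraic closure. -/
def evalPt (f : PowerSeries (OO E)) (x : AlgebraicClosure E) : AlgebraicClosure E :=
  ∑' i, algebraMap E (AlgebraicClosure E) (f.coeff i : OO E) * x ^ i

variable {x y : AlgebraicClosure E}

/-- The algebraic closure is not complete, but the series converge in the finite extension `E(x)`,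
which is. -/
theorem exists_evalHom (hx : ‖x‖ < 1) : ∃ e : PowerSeries (OO E) →+* AlgebraicClosure E,
    ∀ f, e f ∈ E⟮x⟯ ∧
      HasSum (fun i => algebraMap E (AlgebraicClosure E) (f.coeff i : OO E) * x ^ i) (e f) := by
  let j : OO E →+* E⟮x⟯ := (algebraMap E E⟮x⟯).comp (OO E).subtype
  have hj (a : OO E) : ‖j a‖ ≤ 1 :=
    (norm_algebraMap_closure (a : E)).trans_le (mem_OO_iff.1 a.2)
  let x' : E⟮x⟯ := ⟨x, mem_adjoin_simple_self E x⟩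
  have hx' : ‖x'‖ < 1 := hx
  refine ⟨E⟮x⟯.val.toRingHom.comp (evalHom hj hx'), fun f => ⟨(evalHom hj hx' f).2, ?_⟩⟩
  exact ((summable_norm_terms hj hx' f).of_norm.hasSum.map E⟮x⟯.val continuous_subtype_val :)

theorem hasSum_evalPt (hx : ‖x‖ < 1) (f : PowerSeries (OO E)) :
    HasSum (fun i => algebraMap E (AlgebraicClosure E) (f.coeff i : OO E) * x ^ i)
      (evalPt f x) := by
  obtain ⟨e, he⟩ := exists_evalHom hx
  rw [evalPt, (he f).2.tsum_eq]
  exact (he f).2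

/-- Evaluation at a point of the open unit disc, as a ring homomorphism. -/
def evalPtHom (hx : ‖x‖ < 1) : PowerSeries (OO E) →+* AlgebraicClosure E :=
  (exists_evalHom hx).choose.copy (evalPt · x)
    (funext fun f => ((exists_evalHom hx).choose_spec f).2.tsum_eq)

theorem evalPtHom_apply (hx : ‖x‖ < 1) (f : PowerSeries (OO E)) :
    evalPtHom hx f = evalPt f x := rfl

theorem evalPt_mem_adjoin (hx : ‖x‖ < 1) (f : PowerSeries (OO E)) : evalPt f x ∈ E⟮x⟯ := by
  rw [evalPt, ((exists_evalHom hx).choose_spec f).2.tsum_eq]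
  exact ((exists_evalHom hx).choose_spec f).1

theorem evalPt_mem {F : IntermediateField E (AlgebraicClosure E)} (hx : ‖x‖ < 1) (hF : x ∈ F)
    (f : PowerSeries (OO E)) : evalPt f x ∈ F :=
  adjoin_simple_le_iff.2 hF (evalPt_mem_adjoin hx f)

theorem evalPt_mul (hx : ‖x‖ < 1) (f g : PowerSeries (OO E)) :
    evalPt (f * g) x = evalPt f x * evalPt g x := map_mul (evalPtHom hx) f g

theorem evalPt_add (hx : ‖x‖ < 1) (f g : PowerSeries (OO E)) :
    evalPt (f + g) x = evalPt f x + evalPt g x := map_add (evalPtHom hx) f g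

theorem evalPt_sub (hx : ‖x‖ < 1) (f g : PowerSeries (OO E)) :
    evalPt (f - g) x = evalPt f x - evalPt g x := map_sub (evalPtHom hx) f g

theorem evalPt_pow (hx : ‖x‖ < 1) (f : PowerSeries (OO E)) (n : ℕ) :
    evalPt (f ^ n) x = evalPt f x ^ n := map_pow (evalPtHom hx) f n

/-- The embedding of the integers of `E` into the algebraic closure. -/
def intMap : OO E →+* AlgebraicClosure E := (algebraMap E (AlgebraicClosure E)).comp (OO E).subtype

omit [ProperSpace E] in
theorem intMap_apply (a : OO E) : intMap a = algebraMap E (AlgebraicClosure E) a := rfl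

theorem norm_intMap (a : OO E) : ‖intMap a‖ = ‖(a : E)‖ := norm_algebraMap_closure _

theorem norm_intMap_le (a : OO E) : ‖intMap a‖ ≤ 1 :=
  (norm_intMap a).trans_le (mem_OO_iff.1 a.2)

theorem evalPt_coe (P : Polynomial (OO E)) (x : AlgebraicClosure E) :
    evalPt (P : PowerSeries (OO E)) x = P.eval₂ intMap x := by
  rw [Polynomial.eval₂_eq_sum_range, evalPt, tsum_eq_sum (s := Finset.range (P.natDegree + 1))]
  · refine Finset.sum_congr rfl fun i _ => ?_
    rw [Polynomial.coeff_coe, intMap_apply]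
  · intro i hi
    rw [Polynomial.coeff_coe, Polynomial.coeff_eq_zero_of_natDegree_lt]
    · simp
    · simpa using hi

theorem evalPt_X (x : AlgebraicClosure E) : evalPt PowerSeries.X x = x := by
  rw [← Polynomial.coe_X, evalPt_coe, Polynomial.eval₂_X]

theorem evalPt_C (a : OO E) (x : AlgebraicClosure E) : evalPt (PowerSeries.C a) x = intMap a := by
  rw [← Polynomial.coe_C, evalPt_coe, Polynomial.eval₂_C]

theorem evalPt_zero_right (f : PowerSeries (OO E)) : evalPt f 0 = intMap f.constantCoeff := by
  rw [evalPt, tsum_eq_single 0]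
  · simp [intMap_apply]
  · intro i hi
    simp [hi]

theorem norm_evalPt_le (hx : ‖x‖ < 1) (f : PowerSeries (OO E)) : ‖evalPt f x‖ ≤ 1 :=
  IsUltrametricDist.norm_tsum_le_of_forall_le_of_nonneg zero_le_one fun i => by
    rw [norm_mul, norm_pow, ← intMap_apply]
    exact mul_le_one₀ (norm_intMap_le _) (by positivity) (pow_le_one₀ (norm_nonneg _) hx.le)

theorem evalPt_eq_add_trunc (hx : ‖x‖ < 1) (f : PowerSeries (OO E)) (D : ℕ) :
    ∃ w : AlgebraicClosure E, ‖w‖ ≤ 1 ∧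
      evalPt f x = x ^ D * w + (f.trunc D).eval₂ intMap x := by
  refine ⟨evalPt (PowerSeries.mk fun i => f.coeff (i + D)) x, norm_evalPt_le hx _, ?_⟩
  rw [← evalPt_coe]
  conv_lhs => rw [PowerSeries.eq_X_pow_mul_shift_add_trunc D f]
  rw [evalPt_add hx, evalPt_mul hx, evalPt_pow hx, evalPt_X]

theorem norm_evalPt_sub_trunc_le (hx : ‖x‖ < 1) (f : PowerSeries (OO E)) (D : ℕ) :
    ‖evalPt f x - (f.trunc D).eval₂ intMap x‖ ≤ ‖x‖ ^ D := by
  obtain ⟨w, hw, h⟩ := evalPt_eq_add_trunc hx f D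
  rw [h, add_sub_cancel_right, norm_mul, norm_pow]
  exact mul_le_of_le_one_right (by positivity) hw

theorem norm_evalPt_le_norm (hx : ‖x‖ < 1) {f : PowerSeries (OO E)} (hf : f.constantCoeff = 0) :
    ‖evalPt f x‖ ≤ ‖x‖ := by
  obtain ⟨g, rfl⟩ := PowerSeries.X_dvd_iff.2 hf
  rw [evalPt_mul hx, evalPt_X, norm_mul]
  exact mul_le_of_le_one_right (norm_nonneg _) (norm_evalPt_le hx g)

/-- The values of the truncations of `f` at `x` determine the value of `f`. -/
theorem eq_evalPt_of_forall (hx : ‖x‖ < 1) {f : PowerSeries (OO E)}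
    (h : ∀ D, ‖y - (f.trunc D).eval₂ intMap x‖ ≤ ‖x‖ ^ D) : y = evalPt f x := by
  rw [← sub_eq_zero, ← norm_le_zero_iff]
  refine ge_of_tendsto' (tendsto_pow_atTop_nhds_zero_of_lt_one (norm_nonneg x) hx) fun D => ?_
  have h1 := norm_evalPt_sub_trunc_le hx f D
  rw [norm_sub_rev] at h1
  simpa using (IsUltrametricDist.norm_add_le_max _ _).trans (max_le (h D) h1)

theorem evalPt_subst (hx : ‖x‖ < 1) (f : PowerSeries (OO E)) {g : PowerSeries (OO E)}
    (hg : g.constantCoeff = 0) : evalPt (f.subst g) x = evalPt f (evalPt g x) := by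
  have hg' : PowerSeries.HasSubst g := .of_constantCoeff_zero' hg
  refine eq_evalPt_of_forall ((norm_evalPt_le_norm hx hg).trans_lt hx) fun D => ?_
  have h : f.subst g = g ^ D * (PowerSeries.mk fun i => f.coeff (i + D)).subst g +
      ((f.trunc D).eval₂ PowerSeries.C g) := by
    conv_lhs => rw [PowerSeries.eq_X_pow_mul_shift_add_trunc D f]
    rw [PowerSeries.subst_add hg', PowerSeries.subst_mul hg', PowerSeries.subst_pow hg',
      PowerSeries.subst_X hg', PowerSeries.subst_coe hg']
    rfl
  rw [h, evalPt_add hx, evalPt_mul hx, evalPt_pow hx, ← evalPtHom_apply hx (Polynomial.eval₂ _ _ _),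
    Polynomial.hom_eval₂, evalPtHom_apply]
  have h2 : (evalPtHom hx).comp PowerSeries.C = intMap := RingHom.ext fun a => evalPt_C a x
  rw [h2, add_sub_cancel_right, norm_mul, norm_pow]
  exact mul_le_of_le_one_right (by positivity) (norm_evalPt_le hx _)

theorem norm_algHom (σ : AlgebraicClosure E →ₐ[E] AlgebraicClosure E) (x : AlgebraicClosure E) :
    ‖σ x‖ = ‖x‖ := by
  change spectralValue _ = spectralValue _
  rw [minpoly.algHom_eq σ σ.injective]

theorem map_evalPt (σ : AlgebraicClosure E →ₐ[E] AlgebraicClosure E) (hx : ‖x‖ < 1)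
    (f : PowerSeries (OO E)) : σ (evalPt f x) = evalPt f (σ x) := by
  have hx' : ‖σ x‖ < 1 := (norm_algHom σ x).trans_lt hx
  refine eq_evalPt_of_forall hx' fun D => ?_
  have h : (f.trunc D).eval₂ intMap (σ x) = σ ((f.trunc D).eval₂ intMap x) := by
    rw [← AlgHom.coe_toRingHom, Polynomial.hom_eval₂]
    congr 1
    ext a
    simp [intMap_apply]
  rw [h, ← map_sub, norm_algHom, norm_algHom]
  exact norm_evalPt_sub_trunc_le hx f D

end EvalPt

section Complete

variable {E : Type u} [NontriviallyNormedField E] [IsUltrametricDist E] [ProperSpace E]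

instance : CompactSpace (OO E) := by
  have h : (OO E : Set E) = Metric.closedBall 0 1 := by
    ext x
    rw [mem_closedBall_zero_iff]
    exact mem_OO_iff
  exact isCompact_iff_compactSpace.1 (h ▸ isCompact_closedBall (0 : E) 1)

theorem mem_maximalIdeal_pow_iff {π : OO E} (hπ : Irreducible π) (n : ℕ) (a : OO E) :
    a ∈ IsLocalRing.maximalIdeal (OO E) ^ n ↔ ‖(a : E)‖ ≤ ‖(π : E)‖ ^ n := by
  rw [hπ.maximalIdeal_eq, Ideal.span_singleton_pow, Ideal.mem_span_singleton]
  refine ⟨?_, fun h => dvd_OO (by simpa using h)⟩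
  rintro ⟨b, rfl⟩
  push_cast
  rw [norm_mul, norm_pow]
  exact mul_le_of_le_one_right (by positivity) (mem_OO_iff.1 b.2)

instance : IsAdicComplete (IsLocalRing.maximalIdeal (OO E)) (OO E) where
  prec' f hf := by
    obtain ⟨π, hπ⟩ := IsDiscreteValuationRing.exists_irreducible (OO E)
    let S (n : ℕ) : Set (OO E) := {a | ‖(a : E) - f n‖ ≤ ‖(π : E)‖ ^ n}
    have hmem (n : ℕ) (a : OO E) :
        a ∈ S n ↔ a - f n ∈ IsLocalRing.maximalIdeal (OO E) ^ n := by
      rw [mem_maximalIdeal_pow_iff hπ]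
      rfl
    have hS (n : ℕ) : S (n + 1) ⊆ S n := fun a ha => by
      rw [hmem] at ha ⊢
      have h1 : f (n + 1) - f n ∈ IsLocalRing.maximalIdeal (OO E) ^ n := by
        simpa [SModEq.sub_mem] using (hf n.le_succ).symm
      simpa using add_mem (Ideal.pow_le_pow_right n.le_succ ha) h1
    have h (n : ℕ) : IsClosed (S n) := isClosed_le (by fun_prop) (by fun_prop)
    obtain ⟨L, hL⟩ := (h 0).isCompact.nonempty_iInter_of_sequence_nonempty_isCompact_isClosed S hS
      (fun n => ⟨f n, (hmem n _).2 (by simp)⟩) h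
    refine ⟨L, fun n => ?_⟩
    have := (hmem n L).1 (Set.mem_iInter.1 hL n)
    simpa [SModEq.sub_mem] using neg_mem this

end Complete

section LubinTateSeries

/-! ### Differences of endomorphisms of a formal module -/

section Law

variable {O : Type u} [CommRing O]

/-- `F(X, Y) ≡ Y` modulo `X`, because `F(0, Y) = Y`. -/
theorem X_zero_dvd_law_sub (F : FormalGroup O) :
    (MvPowerSeries.X 0 : MvPowerSeries (Fin 2) O) ∣ F.toPowerSeries - MvPowerSeries.X 1 := by
  rw [MvPowerSeries.X_dvd_iff]
  intro m hm
  have hm' : m = Finsupp.single 1 (m 1) := by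
    ext i
    fin_cases i <;> simp [hm]
  have h := congrArg (PowerSeries.coeff (m 1)) F.zeroX_eq_X
  rw [PowerSeries.coeff, FormalGroup.zeroX, MvPowerSeries.coeff_subst,
    finsum_eq_single _ m] at h
  · rw [Finsupp.prod_fintype _ _ (by simp), Fin.prod_univ_two] at h
    have h2 : (MvPowerSeries.coeff (Finsupp.single () (m 1)))
        ((PowerSeries.X : PowerSeries O) ^ (m 1)) = 1 := by
      exact PowerSeries.coeff_X_pow_self (m 1)
    simp only [hm, Matrix.cons_val_zero, pow_zero, one_mul, Matrix.cons_val_one] at h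
    erw [h2] at h
    rw [map_sub, sub_eq_zero, hm', MvPowerSeries.X]
    rw [hm'] at h
    simp only [smul_eq_mul, mul_one] at h
    rw [h]
    erw [PowerSeries.coeff_X, MvPowerSeries.coeff_monomial]
    simp [(Finsupp.single_injective (M := ℕ) (1 : Fin 2)).eq_iff]
  · intro d hd
    rw [Finsupp.prod_fintype _ _ (by simp), Fin.prod_univ_two]
    by_cases h0 : d 0 = 0
    · have h1 : m 1 ≠ d 1 := fun h1 => hd (by
        ext i
        fin_cases i
        · simp [h0, hm]
        · exact h1.symm)
      have h2 : (MvPowerSeries.coeff (Finsupp.single () (m 1)))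
          ((PowerSeries.X : PowerSeries O) ^ (d 1)) = 0 := by
        exact (PowerSeries.coeff_X_pow (m 1) (d 1)).trans (if_neg h1)
      simp only [h0, Matrix.cons_val_zero, pow_zero, one_mul, Matrix.cons_val_one]
      erw [h2, smul_zero]
    · simp [h0]
  · exact MvPowerSeries.HasSubst.zero_X

theorem dvd_law_subst_sub (F : FormalGroup O) {f g : PowerSeries O}
    (hf : f.constantCoeff = 0) (hg : g.constantCoeff = 0) :
    f ∣ F.toPowerSeries.subst ![f, g] - g := by
  have h : MvPowerSeries.HasSubst ![f, g] :=
    MvPowerSeries.hasSubst_of_constantCoeff_nilpotent fun s => by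
      fin_cases s
      · exact hf ▸ IsNilpotent.zero
      · exact hg ▸ IsNilpotent.zero
  obtain ⟨G, hG⟩ := X_zero_dvd_law_sub F
  refine ⟨G.subst ![f, g], ?_⟩
  have := congrArg (MvPowerSeries.subst ![f, g]) hG
  rw [MvPowerSeries.subst_sub h, MvPowerSeries.subst_mul h, MvPowerSeries.subst_X h,
    MvPowerSeries.subst_X h] at this
  simpa using this

/-- `[a] - [b]` is a unit multiple of `[a - b]`. Hence `[a]` and `[b]` agree at the zeros of
`[a - b]` and nowhere else in the open unit disc; this replaces the group structure on the points of
the disc. -/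
theorem FormalModule.exists_act_sub_eq [IsDomain O] (H : FormalModule O) {a b : O} (hab : a ≠ b) :
    ∃ W : PowerSeries O, W.constantCoeff = 1 ∧ H.act a - H.act b = H.act (a - b) * W := by
  obtain ⟨W, hW⟩ := dvd_law_subst_sub H.law (H.constantCoeff_act (a - b)) (H.constantCoeff_act b)
  rw [← H.act_add, sub_add_cancel] at hW
  refine ⟨W, ?_, hW⟩
  have h := congrArg (PowerSeries.coeff 1) hW
  rw [PowerSeries.coeff_one_mul, map_sub, H.coeff_one_act, H.coeff_one_act, H.coeff_one_act,
    H.constantCoeff_act] at h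
  have h' : a - b ≠ 0 := sub_ne_zero.2 hab
  refine mul_left_cancel₀ h' ?_
  rw [mul_one]
  linear_combination -h

end Law

variable {E : Type u} [NontriviallyNormedField E] [IsUltrametricDist E] [ProperSpace E]

/-! ### Absolute values and reduction -/

theorem one_lt_resCard : 1 < resCard E := Finite.one_lt_card

omit [ProperSpace E] in
theorem norm_pi_pos {π : OO E} (hπ : Irreducible π) : 0 < ‖(π : E)‖ :=
  norm_pos_iff.2 fun h => hπ.ne_zero (Subtype.ext h)

omit [ProperSpace E] in
theorem norm_pi_lt {π : OO E} (hπ : Irreducible π) : ‖(π : E)‖ < 1 := norm_lt_one hπ.not_isUnit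

theorem norm_le_pi_of_mem {π : OO E} (hπ : Irreducible π) {a : OO E}
    (ha : a ∈ IsLocalRing.maximalIdeal (OO E)) : ‖(a : E)‖ ≤ ‖(π : E)‖ := by
  simpa using (mem_maximalIdeal_pow_iff hπ 1 a).1 (by simpa using ha)

theorem norm_evalPt_le_pi {π : OO E} (hπ : Irreducible π) {x : AlgebraicClosure E} (hx : ‖x‖ < 1)
    {f : PowerSeries (OO E)} (hf : f.map (IsLocalRing.residue (OO E)) = 0) :
    ‖evalPt f x‖ ≤ ‖(π : E)‖ := by
  refine IsUltrametricDist.norm_tsum_le_of_forall_le_of_nonneg (norm_nonneg _) fun i => ?_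
  have h : f.coeff i ∈ IsLocalRing.maximalIdeal (OO E) := by
    rw [← IsLocalRing.residue_eq_zero_iff, ← PowerSeries.coeff_map, hf, map_zero]
  rw [norm_mul, norm_pow, norm_algebraMap_closure]
  exact (mul_le_of_le_one_right (norm_nonneg _) (pow_le_one₀ (norm_nonneg _) hx.le)).trans
    (norm_le_pi_of_mem hπ h)

/-! ### Zeros of power series in the open unit disc -/

/-- Weierstrass preparation for a series whose reduction is `T ^ d`. -/
theorem exists_weierstrass {f : PowerSeries (OO E)} {d : ℕ}
    (hf : f.map (IsLocalRing.residue (OO E)) = PowerSeries.X ^ d) :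
    ∃ (P : Polynomial (OO E)) (h : PowerSeries (OO E)), P.Monic ∧ P.natDegree = d ∧
      (∀ i < d, P.coeff i ∈ IsLocalRing.maximalIdeal (OO E)) ∧ IsUnit h ∧ f = P * h := by
  have h0 : f.map (IsLocalRing.residue (OO E)) ≠ 0 := by
    rw [hf]
    exact pow_ne_zero _ PowerSeries.X_ne_zero
  obtain ⟨P, h, hP⟩ := PowerSeries.exists_isWeierstrassFactorization h0
  have hd : P.natDegree = d := by
    rw [hP.natDegree_eq_toNat_order_map, hf, PowerSeries.order_X_pow]
    rfl
  exact ⟨P, h, hP.isDistinguishedAt.monic, hd,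
    fun i hi => hP.isDistinguishedAt.mem (hd ▸ hi), hP.isUnit, hP.eq_mul⟩

theorem evalPt_ne_zero_of_isUnit {x : AlgebraicClosure E} (hx : ‖x‖ < 1) {h : PowerSeries (OO E)}
    (hh : IsUnit h) : evalPt h x ≠ 0 := (hh.map (evalPtHom hx)).ne_zero

theorem evalPt_eq_zero_iff {x : AlgebraicClosure E} (hx : ‖x‖ < 1) {f h : PowerSeries (OO E)}
    {P : Polynomial (OO E)} (hh : IsUnit h) (hf : f = P * h) :
    evalPt f x = 0 ↔ P.eval₂ intMap x = 0 := by
  rw [hf, evalPt_mul hx, evalPt_coe, mul_eq_zero, or_iff_left (evalPt_ne_zero_of_isUnit hx hh)]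

omit [ProperSpace E] in
theorem pow_natDegree_eq_of_root {x : AlgebraicClosure E} {P : Polynomial (OO E)} (hP : P.Monic)
    (hx : P.eval₂ intMap x = 0) :
    x ^ P.natDegree = -∑ i ∈ Finset.range P.natDegree, intMap (P.coeff i) * x ^ i := by
  rw [Polynomial.eval₂_eq_sum_range, Finset.sum_range_succ, hP.coeff_natDegree, map_one,
    one_mul] at hx
  linear_combination hx

theorem norm_lt_one_of_root {x : AlgebraicClosure E} {P : Polynomial (OO E)} (hP : P.Monic)
    (hP' : ∀ i < P.natDegree, P.coeff i ∈ IsLocalRing.maximalIdeal (OO E))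
    (hx : P.eval₂ intMap x = 0) : ‖x‖ < 1 := by
  by_contra! h
  have h1 := pow_natDegree_eq_of_root hP hx
  obtain ⟨π, hπ⟩ := IsDiscreteValuationRing.exists_irreducible (OO E)
  have h2 : ‖x ^ P.natDegree‖ ≤ ‖(π : E)‖ * ‖x‖ ^ P.natDegree := by
    rw [h1, norm_neg]
    refine IsUltrametricDist.norm_sum_le_of_forall_le_of_nonneg (by positivity) fun i hi => ?_
    rw [norm_mul, norm_pow, norm_intMap]
    have hi' := Finset.mem_range.1 hi
    exact mul_le_mul (norm_le_pi_of_mem hπ (hP' i hi')) (pow_le_pow_right₀ h hi'.le)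
      (by positivity) (by positivity)
  rw [norm_pow] at h2
  have h3 : 0 < ‖x‖ ^ P.natDegree := by positivity
  nlinarith [norm_pi_lt hπ]

/-- The roots of an Eisenstein polynomial of degree `d` have absolute value `‖π‖ ^ (1 / d)`. -/
theorem norm_pow_eq_of_eisenstein {π : OO E} (hπ : Irreducible π) {x : AlgebraicClosure E}
    {P : Polynomial (OO E)} (hP : P.Monic) (hd : 0 < P.natDegree)
    (hP' : ∀ i < P.natDegree, P.coeff i ∈ IsLocalRing.maximalIdeal (OO E))
    (h0 : ‖(P.coeff 0 : E)‖ = ‖(π : E)‖)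
    (hx : P.eval₂ intMap x = 0) : ‖x‖ ^ P.natDegree = ‖(π : E)‖ := by
  have hx1 := norm_lt_one_of_root hP hP' hx
  have h1 := pow_natDegree_eq_of_root hP hx
  obtain ⟨d, hd'⟩ := Nat.exists_eq_succ_of_ne_zero hd.ne'
  rw [← norm_pow, h1, norm_neg]
  rw [hd'] at hP' ⊢
  rw [Finset.sum_range_succ', pow_zero, mul_one]
  have h2 : ‖∑ i ∈ Finset.range d, intMap (P.coeff (i + 1)) * x ^ (i + 1)‖ <
      ‖intMap (P.coeff 0)‖ := by
    rw [norm_intMap, h0]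
    have : ‖∑ i ∈ Finset.range d, intMap (P.coeff (i + 1)) * x ^ (i + 1)‖ ≤ ‖(π : E)‖ * ‖x‖ := by
      refine IsUltrametricDist.norm_sum_le_of_forall_le_of_nonneg (by positivity) fun i hi => ?_
      rw [norm_mul, norm_pow, norm_intMap]
      have hi' := Finset.mem_range.1 hi
      refine mul_le_mul (norm_le_pi_of_mem hπ (hP' (i + 1) (by omega))) ?_
        (by positivity) (by positivity)
      exact pow_le_of_le_one (norm_nonneg _) hx1.le (by omega)
    exact this.trans_lt (mul_lt_of_lt_one_right (norm_pi_pos hπ) hx1)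
  rw [IsUltrametricDist.norm_add_eq_max_of_norm_ne_norm h2.ne, max_eq_right h2.le, norm_intMap, h0]

/-! ### Totally ramified elements -/

theorem exists_norm_eq_zpow {π : OO E} (hπ : Irreducible π) {c : E} (hc : c ≠ 0) :
    ∃ k : ℤ, ‖c‖ = ‖(π : E)‖ ^ k := by
  have key (a : E) (ha : a ≠ 0) (ha1 : ‖a‖ ≤ 1) : ∃ k : ℕ, ‖a‖ = ‖(π : E)‖ ^ k := by
    let a' : OO E := ⟨a, mem_OO_iff.2 ha1⟩
    have ha' : a' ≠ 0 := fun h => ha (congrArg Subtype.val h)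
    obtain ⟨n, u, hu⟩ := IsDiscreteValuationRing.associated_pow_irreducible ha' hπ
    refine ⟨n, ?_⟩
    rw [← norm_pow, ← Subring.coe_pow, ← hu, Subring.coe_mul, norm_mul,
      isUnit_OO_iff.1 u.isUnit, mul_one]
  rcases le_total ‖c‖ 1 with h | h
  · obtain ⟨k, hk⟩ := key c hc h
    exact ⟨k, by simpa using hk⟩
  · obtain ⟨k, hk⟩ := key c⁻¹ (inv_ne_zero hc) (by rw [norm_inv]; exact inv_le_one_of_one_le₀ h)
    refine ⟨-k, ?_⟩
    rw [zpow_neg, zpow_natCast, ← hk, norm_inv, inv_inv]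

open Classical in
/-- If `‖x‖ ^ d = ‖π‖`, then the terms of an `E`-linear combination of `1, x, …, x ^ (d - 1)` have
pairwise distinct absolute values, so that each of them is bounded by the sum. -/
theorem norm_term_le_norm_sum {π : OO E} (hπ : Irreducible π) {x : AlgebraicClosure E} {d : ℕ}
    (hx : ‖x‖ ^ d = ‖(π : E)‖) (c : ℕ → E) {i : ℕ} (hi : i < d) :
    ‖algebraMap E (AlgebraicClosure E) (c i) * x ^ i‖ ≤
      ‖∑ i ∈ Finset.range d, algebraMap E (AlgebraicClosure E) (c i) * x ^ i‖ := by
  set f : ℕ → AlgebraicClosure E := fun i => algebraMap E (AlgebraicClosure E) (c i) * x ^ i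
  have hx0 : 0 < ‖x‖ := by
    refine norm_pos_iff.2 ?_
    rintro rfl
    rw [norm_zero, zero_pow (by omega)] at hx
    exact (norm_pi_pos hπ).ne hx
  have hx1 : ‖x‖ < 1 := by
    by_contra! h
    exact ((norm_pi_lt hπ).trans_le (hx ▸ one_le_pow₀ h)).ne rfl
  have hpair : Set.Pairwise ({i ∈ Finset.range d | c i ≠ 0} : Finset ℕ)
      (fun i j => ‖f i‖ ≠ ‖f j‖) := by
    intro i hi j hj hij h
    rw [Finset.mem_coe, Finset.mem_filter, Finset.mem_range] at hi hj
    obtain ⟨k, hk⟩ := exists_norm_eq_zpow hπ hi.2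
    obtain ⟨l, hl⟩ := exists_norm_eq_zpow hπ hj.2
    simp only [f, norm_mul, norm_pow, norm_algebraMap_closure, hk, hl, ← hx] at h
    simp only [← zpow_natCast, ← zpow_mul, ← zpow_add₀ hx0.ne'] at h
    have h' := zpow_right_injective₀ hx0 hx1.ne h
    -- `l - k` measures the difference of the exponents, so that `i ≡ j` modulo `d`
    apply hij
    have h2 : ((i : ℤ) - j) % d = 0 := by
      have : (i : ℤ) - j = d * (l - k) := by linear_combination h'
      rw [this, Int.mul_emod_right]
    have h5 : (i : ℤ) % d = j % d := Int.emod_eq_emod_iff_emod_sub_eq_zero.2 h2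
    rw [Int.emod_eq_of_lt (by omega) (by omega), Int.emod_eq_of_lt (by omega) (by omega)] at h5
    exact_mod_cast h5
  have hsum : ∑ i ∈ Finset.range d, f i = ∑ i ∈ Finset.range d with c i ≠ 0, f i := by
    refine (Finset.sum_filter_of_ne fun i _ h => ?_).symm
    rintro hc
    simp [f, hc] at h
  change ‖f i‖ ≤ ‖∑ i ∈ Finset.range d, f i‖
  by_cases hci : c i = 0
  · simp [f, hci]
  · have hmem : i ∈ ({i ∈ Finset.range d | c i ≠ 0} : Finset ℕ) := by simp [hi, hci]
    rw [hsum, IsUltrametricDist.norm_sum_eq_sup'_of_pairwise_ne ⟨i, hmem⟩ hpair]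
    exact Finset.le_sup' (fun i => ‖f i‖) hmem

/-- An element of absolute value `‖π‖ ^ (1 / d)` has degree at least `d`: a polynomial of smaller
degree cannot vanish at it, as its terms have distinct absolute values. -/
theorem le_natDegree_minpoly {π : OO E} (hπ : Irreducible π) {x : AlgebraicClosure E} {d : ℕ}
    (hx : ‖x‖ ^ d = ‖(π : E)‖) : d ≤ (minpoly E x).natDegree := by
  by_contra! h
  have h1 := minpoly.aeval E x
  rw [Polynomial.aeval_eq_sum_range' h] at h1
  simp only [Algebra.smul_def] at h1
  have h2 := norm_term_le_norm_sum hπ hx (minpoly E x).coeff h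
  rw [h1, norm_zero, norm_le_zero_iff, (minpoly.monic (Algebra.IsIntegral.isIntegral x) :
    (minpoly E x).Monic).coeff_natDegree, map_one, one_mul] at h2
  have h0 : (minpoly E x).natDegree ≠ 0 :=
    (minpoly.natDegree_pos (Algebra.IsIntegral.isIntegral x)).ne'
  have h3 : ‖x‖ ^ d = 0 := by
    rw [(pow_eq_zero_iff h0).1 h2, norm_zero, zero_pow (by omega)]
  exact (norm_pi_pos hπ).ne' (hx ▸ h3)

theorem minpoly_eq_of_norm_pow_eq {π : OO E} (hπ : Irreducible π) {x : AlgebraicClosure E}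
    {P : Polynomial (OO E)} (hP : P.Monic) (hx : P.eval₂ intMap x = 0)
    (hx' : ‖x‖ ^ P.natDegree = ‖(π : E)‖) : minpoly E x = P.map (OO E).subtype := by
  refine (Polynomial.eq_of_monic_of_dvd_of_natDegree_le
    (minpoly.monic (Algebra.IsIntegral.isIntegral x)) (hP.map _) (minpoly.dvd E x ?_) ?_).symm
  · rw [Polynomial.aeval_def, Polynomial.eval₂_map]
    exact hx
  · rw [hP.natDegree_map]
    exact le_natDegree_minpoly hπ hx'

end LubinTateSeries

/-! ### Torsion points -/

section TorsionPoints

variable {E : Type u} [NontriviallyNormedField E] [IsUltrametricDist E] [ProperSpace E]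

namespace FormalModule

variable (H : FormalModule (OO E)) {x y : AlgebraicClosure E}

/-- The point `[a](x)`, for `x` in the open unit disc over the algebraic closure. -/
def pt (a : OO E) (x : AlgebraicClosure E) : AlgebraicClosure E := evalPt (H.act a) x

theorem evalsTo_iff (hx : ‖x‖ < 1) {a : OO E} : H.EvalsTo a x y ↔ H.pt a x = y :=
  ⟨fun h => (hasSum_evalPt hx _).unique h, fun h => h ▸ hasSum_evalPt hx _⟩

theorem mem_torsion_iff {a : OO E} : x ∈ H.torsion a ↔ ‖x‖ < 1 ∧ H.pt a x = 0 :=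
  and_congr_right fun hx => H.evalsTo_iff hx

theorem norm_pt_le (hx : ‖x‖ < 1) (a : OO E) : ‖H.pt a x‖ ≤ ‖x‖ :=
  norm_evalPt_le_norm hx (H.constantCoeff_act a)

theorem norm_pt_lt (hx : ‖x‖ < 1) (a : OO E) : ‖H.pt a x‖ < 1 := (H.norm_pt_le hx a).trans_lt hx

theorem pt_one (x : AlgebraicClosure E) : H.pt 1 x = x := by
  rw [pt, H.act_one, evalPt_X]

theorem pt_zero_right (a : OO E) : H.pt a 0 = 0 := by
  rw [pt, evalPt_zero_right, H.constantCoeff_act, map_zero]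

theorem pt_mul (hx : ‖x‖ < 1) (a b : OO E) : H.pt (a * b) x = H.pt a (H.pt b x) := by
  rw [pt, H.act_mul, evalPt_subst hx _ (H.constantCoeff_act b)]
  rfl

theorem pt_comm (hx : ‖x‖ < 1) (a b : OO E) : H.pt a (H.pt b x) = H.pt b (H.pt a x) := by
  rw [← H.pt_mul hx, ← H.pt_mul hx, mul_comm]

theorem pt_unit_eq_zero_iff (hx : ‖x‖ < 1) (v : (OO E)ˣ) : H.pt v x = 0 ↔ x = 0 := by
  refine ⟨fun h => ?_, fun h => by rw [h, H.pt_zero_right]⟩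
  rw [← H.pt_one x, ← v.inv_mul, H.pt_mul hx, h, H.pt_zero_right]

theorem pt_sub_eq_zero_iff (hx : ‖x‖ < 1) {a b : OO E} (hab : a ≠ b) :
    H.pt (a - b) x = 0 ↔ H.pt a x = H.pt b x := by
  obtain ⟨W, hW, h⟩ := H.exists_act_sub_eq hab
  have h2 := congrArg (evalPt · x) h
  simp only [evalPt_sub hx, evalPt_mul hx] at h2
  have h3 : evalPt W x ≠ 0 := evalPt_ne_zero_of_isUnit hx
    (PowerSeries.isUnit_iff_constantCoeff.2 (hW ▸ isUnit_one))
  rw [← sub_eq_zero (a := H.pt a x), pt, pt, pt, h2, mul_eq_zero, or_iff_left h3]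

theorem red_pow {π : OO E} (hH : H.red π = PowerSeries.X ^ resCard E) (n : ℕ) :
    H.red (π ^ n) = PowerSeries.X ^ resCard E ^ n := by
  induction n with
  | zero => simp [red, H.act_one]
  | succ n ih =>
    rw [pow_succ, red_mul, ih, hH, PowerSeries.subst_pow (hH ▸ H.hasSubst_red π),
      PowerSeries.subst_X (hH ▸ H.hasSubst_red π), ← pow_mul, pow_succ, mul_comm]

theorem norm_pt_pi_sub_le {π : OO E} (hπ : Irreducible π)
    (hH : H.red π = PowerSeries.X ^ resCard E) (hx : ‖x‖ < 1) :
    ‖H.pt π x - x ^ resCard E‖ ≤ ‖(π : E)‖ := by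
  have h := norm_evalPt_le_pi hπ hx (f := H.act π - PowerSeries.X ^ resCard E) (by
    rw [map_sub, map_pow, PowerSeries.map_X, ← hH, red, sub_self])
  rwa [evalPt_sub hx, evalPt_pow hx, evalPt_X] at h

/-- The degree `q ^ (n + 1) - q ^ n` of `E_{n + 1}` over `E`. -/
def deg (E : Type u) [NontriviallyNormedField E] [IsUltrametricDist E] (n : ℕ) : ℕ :=
  resCard E ^ (n + 1) - resCard E ^ n

theorem deg_pos (n : ℕ) : 0 < deg E n :=
  Nat.sub_pos_of_lt (Nat.pow_lt_pow_right one_lt_resCard n.lt_succ_self)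

/-- The points of exact order `π ^ (n + 1)`. -/
structure IsPrimitive (π : OO E) (n : ℕ) (x : AlgebraicClosure E) : Prop where
  lt_one : ‖x‖ < 1
  pt_succ : H.pt (π ^ (n + 1)) x = 0
  pt_ne : H.pt (π ^ n) x ≠ 0

/-- `[π ^ (n + 1)] / [π ^ n]` is the product of an Eisenstein polynomial and a unit. Its zeros are
the points of exact order `π ^ (n + 1)`. -/
theorem exists_eisenstein {π : OO E} (hπ : Irreducible π)
    (hH : H.red π = PowerSeries.X ^ resCard E) (n : ℕ) :
    ∃ P : Polynomial (OO E), P.Monic ∧ P.natDegree = deg E n ∧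
      (∀ i < P.natDegree, P.coeff i ∈ IsLocalRing.maximalIdeal (OO E)) ∧
      ‖(P.coeff 0 : E)‖ = ‖(π : E)‖ ∧
      ∀ x : AlgebraicClosure E, ‖x‖ < 1 →
        (P.eval₂ intMap x = 0 ↔ H.IsPrimitive π n x) := by
  -- with `[π](T) = T g(T)`, the quotient is `g([π ^ n](T))`
  obtain ⟨g, hg⟩ := PowerSeries.X_dvd_iff.2 (H.constantCoeff_act π)
  have hg0 : g.constantCoeff = π := by
    have h := H.coeff_one_act π
    rwa [hg, PowerSeries.coeff_one_mul, PowerSeries.coeff_one_X, PowerSeries.constantCoeff_X,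
      one_mul, mul_zero, add_zero] at h
  have hs := H.hasSubst_act (π ^ n)
  set φ : PowerSeries (OO E) := g.subst (H.act (π ^ n)) with hφ
  have hmul : H.act (π ^ (n + 1)) = H.act (π ^ n) * φ := by
    rw [pow_succ', H.act_mul, hg, PowerSeries.subst_mul hs, PowerSeries.subst_X hs]
  have hφ0 : φ.constantCoeff = π := by
    have h := PowerSeries.constantCoeff_subst_eq_zero (H.constantCoeff_act (π ^ n))
      (g - PowerSeries.C π) (by simp [hg0])
    rw [PowerSeries.subst_sub hs, ← Polynomial.coe_C, PowerSeries.subst_coe hs] at h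
    rw [← sub_eq_zero]
    simpa using! h
  have hred : φ.map (IsLocalRing.residue (OO E)) = PowerSeries.X ^ deg E n := by
    have h := congrArg (PowerSeries.map (IsLocalRing.residue (OO E))) hmul
    rw [map_mul] at h
    change H.red _ = H.red _ * _ at h
    have hle : resCard E ^ n ≤ resCard E ^ (n + 1) :=
      Nat.pow_le_pow_right one_lt_resCard.le n.le_succ
    rw [H.red_pow hH, H.red_pow hH, ← Nat.add_sub_of_le hle, pow_add] at h
    exact (mul_left_cancel₀ (pow_ne_zero _ PowerSeries.X_ne_zero) h).symm
  obtain ⟨P, h, hP, hd, hP', hh, hPh⟩ := exists_weierstrass hred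
  refine ⟨P, hP, hd, hd ▸ hP', ?_, fun x hx => ?_⟩
  · have h1 := congrArg PowerSeries.constantCoeff hPh
    rw [hφ0, map_mul] at h1
    have h2 : ‖((h.constantCoeff : OO E) : E)‖ = 1 :=
      isUnit_OO_iff.1 (PowerSeries.isUnit_iff_constantCoeff.1 hh)
    rw [h1, Subring.coe_mul, norm_mul, h2, mul_one]
    simp
  · rw [← evalPt_eq_zero_iff hx hh hPh]
    have hm : H.pt (π ^ (n + 1)) x = H.pt (π ^ n) x * evalPt φ x := by
      rw [pt, hmul, evalPt_mul hx, pt]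
    refine ⟨fun h => ⟨hx, by rw [hm, h, mul_zero], fun h0 => ?_⟩, fun h => ?_⟩
    · rw [hφ, evalPt_subst hx _ (H.constantCoeff_act _)] at h
      change evalPt g (H.pt (π ^ n) x) = 0 at h
      rw [h0, evalPt_zero_right, hg0, ← norm_eq_zero, norm_intMap] at h
      exact (norm_pi_pos hπ).ne' h
    · exact (mul_eq_zero.1 (hm ▸ h.pt_succ)).resolve_left h.pt_ne

section

variable {H}
variable {π : OO E} {n : ℕ}

theorem IsPrimitive.norm_pow_deg (hπ : Irreducible π)
    (hH : H.red π = PowerSeries.X ^ resCard E) (hx : H.IsPrimitive π n x) :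
    ‖x‖ ^ deg E n = ‖(π : E)‖ := by
  obtain ⟨P, hP, hd, hP', h0, h⟩ := H.exists_eisenstein hπ hH n
  rw [← hd]
  exact norm_pow_eq_of_eisenstein hπ hP (hd ▸ deg_pos n) hP' h0 ((h x hx.lt_one).2 hx)

theorem IsPrimitive.minpoly_eq (hπ : Irreducible π)
    (hH : H.red π = PowerSeries.X ^ resCard E) (hx : H.IsPrimitive π n x)
    (hy : H.IsPrimitive π n y) : minpoly E x = minpoly E y := by
  obtain ⟨P, hP, hd, hP', h0, h⟩ := H.exists_eisenstein hπ hH n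
  rw [minpoly_eq_of_norm_pow_eq hπ hP ((h x hx.lt_one).2 hx) (hd ▸ hx.norm_pow_deg hπ hH),
    minpoly_eq_of_norm_pow_eq hπ hP ((h y hy.lt_one).2 hy) (hd ▸ hy.norm_pow_deg hπ hH)]

theorem exists_isPrimitive (hπ : Irreducible π)
    (hH : H.red π = PowerSeries.X ^ resCard E) (n : ℕ) : ∃ x, H.IsPrimitive π n x := by
  obtain ⟨P, hP, hd, hP', h0, h⟩ := H.exists_eisenstein hπ hH n
  obtain ⟨x, hx⟩ := IsAlgClosed.exists_eval₂_eq_zero_of_injective (intMap (E := E))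
    (fun a b hab => Subtype.ext ((algebraMap E (AlgebraicClosure E)).injective hab)) P (by
      rw [Polynomial.degree_eq_natDegree hP.ne_zero, hd]
      exact_mod_cast (deg_pos n).ne')
  exact ⟨x, (h x (norm_lt_one_of_root hP hP' hx)).1 hx⟩

theorem IsPrimitive.pt_unit (hx : H.IsPrimitive π n x) (v : (OO E)ˣ) :
    H.IsPrimitive π n (H.pt v x) where
  lt_one := H.norm_pt_lt hx.lt_one _
  pt_succ := by rw [H.pt_comm hx.lt_one, hx.pt_succ, H.pt_zero_right]
  pt_ne h := by
    rw [H.pt_comm hx.lt_one, H.pt_unit_eq_zero_iff (H.norm_pt_lt hx.lt_one _)] at h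
    exact hx.pt_ne h

theorem IsPrimitive.pt_pi (hx : H.IsPrimitive π (n + 1) x) : H.IsPrimitive π n (H.pt π x) where
  lt_one := H.norm_pt_lt hx.lt_one _
  pt_succ := by rw [← H.pt_mul hx.lt_one, ← pow_succ, hx.pt_succ]
  pt_ne h := by
    rw [← H.pt_mul hx.lt_one, ← pow_succ] at h
    exact hx.pt_ne h

theorem IsPrimitive.pt_eq_zero_iff (hπ : Irreducible π) (hx : H.IsPrimitive π n x) {a : OO E} :
    H.pt a x = 0 ↔ π ^ (n + 1) ∣ a := by
  refine ⟨fun h => ?_, ?_⟩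
  · rcases eq_or_ne a 0 with rfl | ha
    · exact dvd_zero _
    obtain ⟨k, v, hv⟩ := IsDiscreteValuationRing.associated_pow_irreducible ha hπ
    have hv' : a = ↑v⁻¹ * π ^ k := by rw [← hv]; simp [mul_comm]
    rw [hv', H.pt_mul hx.lt_one, H.pt_unit_eq_zero_iff (H.norm_pt_lt hx.lt_one _)] at h
    rw [hv']
    refine Dvd.dvd.mul_left (pow_dvd_pow _ ?_) _
    by_contra! hk
    obtain ⟨j, hj⟩ := Nat.exists_eq_add_of_le (Nat.lt_succ_iff.1 hk)
    apply hx.pt_ne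
    rw [hj, add_comm, pow_add, H.pt_mul hx.lt_one, h, H.pt_zero_right]
  · rintro ⟨b, rfl⟩
    rw [mul_comm, H.pt_mul hx.lt_one, hx.pt_succ, H.pt_zero_right]

theorem IsPrimitive.pt_eq_pt_iff (hπ : Irreducible π) (hx : H.IsPrimitive π n x) {a b : OO E} :
    H.pt a x = H.pt b x ↔ π ^ (n + 1) ∣ a - b := by
  rcases eq_or_ne a b with rfl | hab
  · simp
  · rw [← H.pt_sub_eq_zero_iff hx.lt_one hab, hx.pt_eq_zero_iff hπ]

/-- By Weierstrass preparation, `[π ^ n]` has at most `q ^ n` zeros in the open unit disc. -/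
theorem finite_torsion (hH : H.red π = PowerSeries.X ^ resCard E) (n : ℕ) :
    (H.torsion (π ^ n)).Finite ∧ (H.torsion (π ^ n)).ncard ≤ resCard E ^ n := by
  classical
  obtain ⟨P, h, hP, hd, hP', hh, hPh⟩ := exists_weierstrass (H.red_pow hH n)
  have hsub : H.torsion (π ^ n) ⊆ (P.map intMap).roots.toFinset := by
    intro x hx
    obtain ⟨hx, h0⟩ := H.mem_torsion_iff.1 hx
    rw [Finset.mem_coe, Multiset.mem_toFinset, Polynomial.mem_roots (hP.map _).ne_zero,
      Polynomial.IsRoot, Polynomial.eval_map]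
    exact (evalPt_eq_zero_iff hx hh hPh).1 h0
  refine ⟨(Finset.finite_toSet _).subset hsub, ?_⟩
  refine (Set.ncard_le_ncard hsub (Finset.finite_toSet _)).trans ?_
  rw [Set.ncard_coe_finset]
  refine (Multiset.toFinset_card_le _).trans ((Polynomial.card_roots' _).trans ?_)
  rw [hP.natDegree_map, hd]

/-- The points of order dividing `π ^ (n + 1)` are the multiples of any point of exact order
`π ^ (n + 1)`: there are `q ^ (n + 1)` such multiples, and at most as many points. -/
theorem IsPrimitive.exists_pt_eq (hπ : Irreducible π)
    (hH : H.red π = PowerSeries.X ^ resCard E) (hx : H.IsPrimitive π n x)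
    (hy : y ∈ H.torsion (π ^ (n + 1))) : ∃ a, H.pt a x = y := by
  obtain ⟨hfin, hcard⟩ := finite_torsion (H := H) hH (n + 1)
  let I := IsLocalRing.maximalIdeal (OO E) ^ (n + 1)
  have hI : I = Ideal.span {π ^ (n + 1)} := by
    simp only [I, hπ.maximalIdeal_eq, Ideal.span_singleton_pow]
  let f (c : OO E ⧸ I) : H.torsion (π ^ (n + 1)) := ⟨H.pt c.out x,
    H.mem_torsion_iff.2 ⟨H.norm_pt_lt hx.lt_one _,
      by rw [H.pt_comm hx.lt_one, hx.pt_succ, H.pt_zero_right]⟩⟩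
  have hf : Function.Injective f := by
    intro c d hcd
    have h := (hx.pt_eq_pt_iff hπ).1 (congrArg Subtype.val hcd)
    rw [← Ideal.mem_span_singleton, ← hI, ← Ideal.Quotient.eq] at h
    simpa using h
  have hc : Nat.card (OO E ⧸ I) = resCard E ^ (n + 1) := by
    have := cardQuot_pow_of_prime (P := IsLocalRing.maximalIdeal (OO E)) (i := n + 1)
      (IsDiscreteValuationRing.not_a_field _)
    rwa [Submodule.cardQuot_apply, Submodule.cardQuot_apply] at this
  have : Finite (H.torsion (π ^ (n + 1))) := hfin
  obtain ⟨c, hc⟩ := (hf.bijective_of_nat_card_le (by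
    rw [hc, Nat.card_coe_set_eq]
    exact hcard)).2 ⟨y, hy⟩
  exact ⟨_, congrArg Subtype.val hc⟩

theorem IsPrimitive.mem_torsion (hx : H.IsPrimitive π n x) : x ∈ H.torsion (π ^ (n + 1)) :=
  H.mem_torsion_iff.2 ⟨hx.lt_one, hx.pt_succ⟩

theorem IsPrimitive.exists_unit_pt_eq (hπ : Irreducible π)
    (hH : H.red π = PowerSeries.X ^ resCard E) (hx : H.IsPrimitive π n x)
    (hy : H.IsPrimitive π n y) : ∃ v : (OO E)ˣ, H.pt v x = y := by
  obtain ⟨a, ha⟩ := hx.exists_pt_eq hπ hH hy.mem_torsion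
  by_cases hu : IsUnit a
  · exact ⟨hu.unit, ha⟩
  · exfalso
    have h : π ∣ a := by
      rw [← Ideal.mem_span_singleton, ← hπ.maximalIdeal_eq]
      exact hu
    obtain ⟨b, rfl⟩ := h
    apply hy.pt_ne
    rw [← ha, ← H.pt_mul hx.lt_one, ← mul_assoc, ← pow_succ, mul_comm, H.pt_mul hx.lt_one,
      hx.pt_succ, H.pt_zero_right]

/-- A generator of the Tate module: a sequence of points `zₙ` of exact order `πⁿ` with
`[π](zₙ₊₁) = zₙ`. -/
structure IsTateGenerator (H : FormalModule (OO E)) (π : OO E) (z : ℕ → AlgebraicClosure E) :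
    Prop where
  zero : z 0 = 0
  isPrimitive (n : ℕ) : H.IsPrimitive π n (z (n + 1))
  pt_succ (n : ℕ) : H.pt π (z (n + 1)) = z n

theorem exists_tateGenerator (hπ : Irreducible π) (hH : H.red π = PowerSeries.X ^ resCard E) :
    ∃ z, H.IsTateGenerator π z := by
  -- a preimage of `x` under `[π]` is obtained from any point of the next order, since
  -- the units act transitively on the points of the order of `x`
  have step (n : ℕ) (x : {x // H.IsPrimitive π n x}) :
      ∃ y : {y // H.IsPrimitive π (n + 1) y}, H.pt π y = x := by
    obtain ⟨y, hy⟩ := exists_isPrimitive (H := H) hπ hH (n + 1)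
    obtain ⟨v, hv⟩ := hy.pt_pi.exists_unit_pt_eq hπ hH x.2
    exact ⟨⟨_, hy.pt_unit v⟩, by rw [H.pt_comm hy.lt_one, hv]⟩
  choose next hnext using step
  obtain ⟨x0, hx0⟩ := exists_isPrimitive (H := H) hπ hH 0
  let w (n : ℕ) : {x // H.IsPrimitive π n x} := Nat.rec ⟨x0, hx0⟩ next n
  refine ⟨fun n => n.casesOn (motive := fun _ => AlgebraicClosure E) 0 fun n => (w n).1,
    rfl, fun n => (w n).2, fun n => ?_⟩
  cases n with
  | zero => simpa using (w 0).2.pt_succ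
  | succ n => exact hnext n (w n)

end

end FormalModule

end TorsionPoints

/-! ### The Galois group of the Lubin–Tate tower -/

section Galois

variable {E : Type u} [NontriviallyNormedField E] [IsUltrametricDist E] [ProperSpace E]

namespace FormalModule

variable {H : FormalModule (OO E)} {π : OO E} {x y : AlgebraicClosure E}

open IntermediateField

theorem mem_tower_of_mem_torsion {n : ℕ} (hx : x ∈ H.torsion (π ^ n)) : x ∈ H.tower π :=
  le_iSup (H.torsionField π) n (subset_adjoin E _ hx)

theorem map_pt (σ : AlgebraicClosure E →ₐ[E] AlgebraicClosure E) (hx : ‖x‖ < 1) (a : OO E) :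
    σ (H.pt a x) = H.pt a (σ x) := map_evalPt σ hx _

theorem map_mem_torsion (σ : AlgebraicClosure E →ₐ[E] AlgebraicClosure E) {a : OO E}
    (hx : x ∈ H.torsion a) : σ x ∈ H.torsion a := by
  rw [mem_torsion_iff] at hx ⊢
  rw [norm_algHom, ← map_pt σ hx.1, hx.2, map_zero]
  exact ⟨hx.1, rfl⟩

instance normal_tower : Normal E (H.tower π) := by
  rw [normal_iff_forall_map_le]
  intro σ
  rw [tower, IntermediateField.map_iSup]
  refine iSup_mono fun n => ?_
  rw [torsionField, adjoin_map]
  refine adjoin.mono _ _ _ ?_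
  rintro _ ⟨x, hx, rfl⟩
  exact map_mem_torsion σ hx

theorem isGalois_tower [CharZero E] : IsGalois E (H.tower π) where
  to_normal := normal_tower

variable {z : ℕ → AlgebraicClosure E} (hz : H.IsTateGenerator π z)

include hz

namespace IsTateGenerator

theorem norm_lt (n : ℕ) : ‖z n‖ < 1 := by
  cases n with
  | zero => rw [hz.zero, norm_zero]; exact one_pos
  | succ n => exact (hz.isPrimitive n).lt_one

theorem mem_torsion (n : ℕ) : z n ∈ H.torsion (π ^ n) := by
  cases n with
  | zero =>
    rw [mem_torsion_iff, hz.zero, H.pt_zero_right, norm_zero]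
    exact ⟨one_pos, rfl⟩
  | succ n => exact (hz.isPrimitive n).mem_torsion

theorem pt_pow (n m : ℕ) : H.pt (π ^ m) (z (n + m)) = z n := by
  induction m with
  | zero => rw [pow_zero, H.pt_one, add_zero]
  | succ m ih => rw [pow_succ, H.pt_mul (hz.norm_lt _), ← add_assoc, hz.pt_succ, ih]

theorem adjoin_mono : Monotone fun n => E⟮z n⟯ :=
  monotone_nat_of_le_succ fun n => adjoin_simple_le_iff.2 (by
    rw [← hz.pt_succ n]
    exact evalPt_mem_adjoin (hz.norm_lt _) _)

theorem exists_pt_eq (hπ : Irreducible π) (hH : H.red π = PowerSeries.X ^ resCard E) {n : ℕ}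
    (hx : x ∈ H.torsion (π ^ n)) : ∃ a, H.pt a (z n) = x := by
  cases n with
  | zero =>
    refine ⟨1, ?_⟩
    have := (H.mem_torsion_iff.1 hx).2
    rw [pow_zero, H.pt_one] at this
    rw [this, hz.zero, H.pt_zero_right]
  | succ n => exact (hz.isPrimitive n).exists_pt_eq hπ hH hx

theorem torsionField_eq (hπ : Irreducible π) (hH : H.red π = PowerSeries.X ^ resCard E) (n : ℕ) :
    H.torsionField π n = E⟮z n⟯ := by
  refine le_antisymm (adjoin_le_iff.2 fun x hx => ?_)
    (adjoin_simple_le_iff.2 (subset_adjoin E _ (hz.mem_torsion n)))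
  obtain ⟨a, rfl⟩ := hz.exists_pt_eq hπ hH hx
  exact evalPt_mem_adjoin (hz.norm_lt _) _

theorem mem_tower_iff (hπ : Irreducible π) (hH : H.red π = PowerSeries.X ^ resCard E) :
    x ∈ H.tower π ↔ ∃ n, x ∈ E⟮z (n + 1)⟯ := by
  have h : (H.tower π : Set (AlgebraicClosure E)) = ⋃ n, (E⟮z n⟯ : Set (AlgebraicClosure E)) := by
    rw [tower, funext (hz.torsionField_eq hπ hH)]
    exact coe_iSup_of_directed hz.adjoin_mono.directed_le
  rw [← SetLike.mem_coe, h, Set.mem_iUnion]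
  exact ⟨fun ⟨n, hn⟩ => ⟨n, hz.adjoin_mono n.le_succ hn⟩, fun ⟨n, hn⟩ => ⟨_, hn⟩⟩

theorem mem_tower (n : ℕ) : z n ∈ H.tower π := mem_tower_of_mem_torsion (hz.mem_torsion n)

end IsTateGenerator

omit hz

theorem eq_of_mem_adjoin_simple {K L : Type*} [Field K] [Field L] [Algebra K L]
    [Algebra.IsIntegral K L] {σ τ : L →ₐ[K] L} {x y : L} (h : σ x = τ x) (hy : y ∈ K⟮x⟯) :
    σ y = τ y := by
  rw [← mem_toSubalgebra,
    adjoin_simple_toSubalgebra_of_isAlgebraic (Algebra.IsAlgebraic.isAlgebraic x)] at hy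
  exact (Algebra.adjoin_le (S := AlgHom.equalizer σ τ) (Set.singleton_subset_iff.2 h)) hy

/-- An extension of an automorphism of `E_∞` to the algebraic closure. -/
def galLift (σ : H.tower π ≃ₐ[E] H.tower π) : AlgebraicClosure E →ₐ[E] AlgebraicClosure E :=
  (σ.liftNormal (AlgebraicClosure E)).toAlgHom

theorem galLift_apply (σ : H.tower π ≃ₐ[E] H.tower π) (x : H.tower π) :
    galLift σ x = (σ x : AlgebraicClosure E) := σ.liftNormal_commutes _ x

/-- `v` and `σ` correspond to each other if `σ` acts on the Tate module as `[v]`. -/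
def Corresponds (z : ℕ → AlgebraicClosure E) (v : (OO E)ˣ) (σ : H.tower π ≃ₐ[E] H.tower π) : Prop :=
  ∀ n, galLift σ (z n) = H.pt v (z n)

variable {v w : (OO E)ˣ} {σ τ : H.tower π ≃ₐ[E] H.tower π}

include hz

theorem Corresponds.mul (h : Corresponds z v σ) (h' : Corresponds z w τ) :
    Corresponds z (v * w) (σ * τ) := fun n => by
  have h1 : galLift (σ * τ) (z n) = galLift σ (galLift τ (z n)) := by
    have e (ρ : H.tower π ≃ₐ[E] H.tower π) := galLift_apply ρ ⟨z n, hz.mem_tower n⟩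
    rw [show galLift τ (z n) = _ from e τ, show galLift (σ * τ) (z n) = _ from e _, galLift_apply]
    rfl
  rw [h1, h' n, map_pt _ (hz.norm_lt n), h n, Units.val_mul, mul_comm, H.pt_mul (hz.norm_lt n)]

omit hz in
theorem eq_of_forall_pow_dvd (hπ : Irreducible π) {a b : OO E} (h : ∀ n, π ^ (n + 1) ∣ a - b) :
    a = b := by
  rw [← sub_eq_zero]
  refine IsHausdorff.haus (I := IsLocalRing.maximalIdeal (OO E)) inferInstance (a - b) fun n => ?_
  rw [SModEq.zero, smul_eq_mul, Ideal.mul_top, hπ.maximalIdeal_eq, Ideal.span_singleton_pow,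
    Ideal.mem_span_singleton]
  exact (pow_dvd_pow _ n.le_succ).trans (h n)

theorem Corresponds.unit_eq (hπ : Irreducible π) (h : Corresponds z v σ) (h' : Corresponds z w σ) :
    v = w :=
  Units.ext (eq_of_forall_pow_dvd hπ fun n =>
    ((hz.isPrimitive n).pt_eq_pt_iff hπ).1 ((h _).symm.trans (h' _)))

theorem Corresponds.gal_eq (hπ : Irreducible π) (hH : H.red π = PowerSeries.X ^ resCard E)
    (h : Corresponds z v σ) (h' : Corresponds z v τ) : σ = τ := by
  ext x
  rw [← galLift_apply, ← galLift_apply]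
  obtain ⟨n, hn⟩ := (hz.mem_tower_iff hπ hH).1 x.2
  exact eq_of_mem_adjoin_simple ((h _).trans (h' _).symm) hn

/-- Elements `aₙ` with `σ(zₙ) = [aₙ](zₙ)` converge to a unit by which `σ` acts on all `zₙ`. -/
theorem exists_corresponds_unit (hπ : Irreducible π)
    (hH : H.red π = PowerSeries.X ^ resCard E) (σ : H.tower π ≃ₐ[E] H.tower π) :
    ∃ v, Corresponds z v σ := by
  have h0 (n : ℕ) : ∃ a, H.pt a (z n) = galLift σ (z n) :=
    hz.exists_pt_eq hπ hH (map_mem_torsion _ (hz.mem_torsion n))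
  choose a ha using h0
  have key {m n : ℕ} (hmn : m ≤ n) : H.pt (a n) (z m) = galLift σ (z m) := by
    obtain ⟨k, rfl⟩ := Nat.exists_eq_add_of_le hmn
    rw [← hz.pt_pow m k, H.pt_comm (hz.norm_lt _), ha, map_pt _ (hz.norm_lt _)]
  have hdvd {m n : ℕ} (hmn : m ≤ n) : π ^ m ∣ a m - a n := by
    cases m with
    | zero => simp
    | succ m =>
      rw [← (hz.isPrimitive m).pt_eq_pt_iff hπ, ha, key hmn]
  have hI (n : ℕ) (b : OO E) :
      b ∈ (IsLocalRing.maximalIdeal (OO E) ^ n • ⊤ : Ideal (OO E)) ↔ π ^ n ∣ b := by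
    rw [smul_eq_mul, Ideal.mul_top, hπ.maximalIdeal_eq, Ideal.span_singleton_pow,
      Ideal.mem_span_singleton]
  obtain ⟨b, hb⟩ := IsPrecomplete.prec (I := IsLocalRing.maximalIdeal (OO E)) inferInstance
    (f := a) fun {m n} hmn => SModEq.sub_mem.2 ((hI _ _).2 (hdvd hmn))
  have hb' (n : ℕ) : H.pt b (z n) = galLift σ (z n) := by
    rw [← ha n]
    cases n with
    | zero => rw [hz.zero, H.pt_zero_right, H.pt_zero_right]
    | succ n =>
      rw [eq_comm, (hz.isPrimitive n).pt_eq_pt_iff hπ, ← hI, ← SModEq.sub_mem]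
      exact hb _
  have hu : IsUnit b := by
    by_contra hu
    have h : π ∣ b := by
      rw [← Ideal.mem_span_singleton, ← hπ.maximalIdeal_eq]
      exact hu
    rw [← pow_one π, ← zero_add 1, ← (hz.isPrimitive 0).pt_eq_zero_iff hπ, hb',
      map_eq_zero] at h
    apply (hz.isPrimitive 0).pt_ne
    rw [pow_zero, H.pt_one, h]
  exact ⟨hu.unit, fun n => (hb' n).symm⟩

omit hz in
theorem isClopen_setOf_apply_eq {K L : Type*} [Field K] [Field L] [Algebra K L]
    [Algebra.IsIntegral K L] (x y : L) : IsClopen {σ : L ≃ₐ[K] L | σ x = y} := by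
  rcases Set.eq_empty_or_nonempty {σ : L ≃ₐ[K] L | σ x = y} with h | ⟨τ, hτ⟩
  · rw [h]
    exact isClopen_empty
  · have : FiniteDimensional K K⟮x⟯ := adjoin.finiteDimensional (Algebra.IsIntegral.isIntegral x)
    have h : {σ : L ≃ₐ[K] L | σ x = y} = (τ⁻¹ * ·) ⁻¹' (K⟮x⟯.fixingSubgroup : Set (L ≃ₐ[K] L)) := by
      ext σ
      rw [Set.mem_preimage, SetLike.mem_coe]
      have hx : σ x = y ↔ (τ⁻¹ * σ) x = x := by
        rw [AlgEquiv.mul_apply, ← hτ]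
        constructor
        · intro h
          rw [h]
          exact τ.symm_apply_apply x
        · intro h
          conv_rhs => rw [← h]
          exact (τ.apply_symm_apply _).symm
      refine hx.trans ⟨fun h => ?_, fun h => ?_⟩
      · rw [IntermediateField.mem_fixingSubgroup_iff]
        exact fun t ht => eq_of_mem_adjoin_simple
          (σ := ((τ⁻¹ * σ : L ≃ₐ[K] L) : L →ₐ[K] L)) (τ := AlgHom.id K L) h ht
      · exact (IntermediateField.mem_fixingSubgroup_iff _ _).1 h x (mem_adjoin_simple_self K x)
    rw [h]
    exact ⟨K⟮x⟯.fixingSubgroup_isClosed.preimage (continuous_const_mul _),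
      K⟮x⟯.fixingSubgroup_isOpen.preimage (continuous_const_mul _)⟩

/-- As `zₙ₊₁` and `[v](zₙ₊₁)` are conjugate, the closed sets of automorphisms sending the one to the
other are not empty; by compactness of the Galois group, they have a common element. -/
theorem exists_corresponds_gal [CharZero E] (hπ : Irreducible π)
    (hH : H.red π = PowerSeries.X ^ resCard E) (v : (OO E)ˣ) :
    ∃ σ : H.tower π ≃ₐ[E] H.tower π, Corresponds z v σ := by
  have := isGalois_tower (H := H) (π := π)
  let T (n : ℕ) : Set (H.tower π ≃ₐ[E] H.tower π) :=
    {σ | galLift σ (z (n + 1)) = H.pt v (z (n + 1))}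
  have hclosed (n : ℕ) : IsClosed (T n) := by
    have hmem : H.pt v (z (n + 1)) ∈ H.tower π := evalPt_mem (hz.norm_lt _) (hz.mem_tower _) _
    convert! (isClopen_setOf_apply_eq (K := E) (⟨z (n + 1), hz.mem_tower _⟩ : H.tower π)
      ⟨_, hmem⟩).isClosed using 1
    ext σ
    have := galLift_apply σ ⟨z (n + 1), hz.mem_tower _⟩
    refine Iff.trans ?_ Subtype.ext_iff.symm
    rw [← this]
    rfl
  have hne (n : ℕ) : (T n).Nonempty := by
    have hp := hz.isPrimitive n
    obtain ⟨τ, hτ⟩ := minpoly.exists_algEquiv_of_root' (K := E) (y := z (n + 1))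
      (x := H.pt v (z (n + 1))) (Algebra.IsAlgebraic.isAlgebraic _) (by
        rw [hp.minpoly_eq hπ hH (hp.pt_unit v)]
        exact minpoly.aeval _ _)
    refine ⟨τ.restrictNormal (H.tower π), ?_⟩
    have h1 := galLift_apply (τ.restrictNormal (H.tower π)) ⟨z (n + 1), hz.mem_tower _⟩
    refine h1.trans (Eq.trans ?_ hτ)
    exact τ.restrictNormal_commutes (H.tower π) ⟨z (n + 1), hz.mem_tower _⟩
  have hanti (n : ℕ) : T (n + 1) ⊆ T n := fun σ hσ => by
    change galLift σ _ = _ at hσ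
    change galLift σ _ = _
    rw [← hz.pt_succ (n + 1), map_pt _ (hz.norm_lt _), hσ, H.pt_comm (hz.norm_lt _)]
  obtain ⟨σ, hσ⟩ := IsCompact.nonempty_iInter_of_sequence_nonempty_isCompact_isClosed T hanti hne
    (hclosed 0).isCompact hclosed
  refine ⟨σ, fun n => ?_⟩
  cases n with
  | zero => rw [hz.zero, map_zero, H.pt_zero_right]
  | succ n => exact Set.mem_iInter.1 hσ n

/-- The isomorphism `v ↦ σ_v` from the units of `O_E` to the Galois group of `E_∞`. -/
theorem exists_reciprocity [CharZero E] (hπ : Irreducible π)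
    (hH : H.red π = PowerSeries.X ^ resCard E) :
    ∃ rec : (OO E)ˣ ≃ₜ* (H.tower π ≃ₐ[E] H.tower π), ∀ v, Corresponds z v (rec v) := by
  have := isGalois_tower (H := H) (π := π)
  choose χ hχ using exists_corresponds_unit hz hπ hH
  choose s hs using exists_corresponds_gal hz hπ hH
  let e : (H.tower π ≃ₐ[E] H.tower π) ≃* (OO E)ˣ :=
    { toFun := χ
      invFun := s
      left_inv := fun σ => (hs (χ σ)).gal_eq hz hπ hH (hχ σ)
      right_inv := fun v => (hχ (s v)).unit_eq hz hπ (hs v)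
      map_mul' := fun σ τ => (hχ _).unit_eq hz hπ ((hχ σ).mul hz (hχ τ)) }
  have hval : Continuous fun σ => (e σ : OO E) := by
    rw [continuous_iff_continuousAt]
    intro σ
    rw [ContinuousAt, Metric.tendsto_nhds]
    intro ε hε
    obtain ⟨n, hn⟩ := exists_pow_lt_of_lt_one hε (norm_pi_lt hπ)
    have hx := hz.mem_tower (n + 1)
    filter_upwards [(isClopen_setOf_apply_eq (K := E) (⟨_, hx⟩ : H.tower π)
      (σ ⟨_, hx⟩)).isOpen.mem_nhds rfl] with τ hτ
    have h1 : H.pt (e τ) (z (n + 1)) = H.pt (e σ) (z (n + 1)) := by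
      refine (hχ τ (n + 1)).symm.trans (Eq.trans ?_ (hχ σ (n + 1)))
      refine (galLift_apply τ ⟨_, hx⟩).trans (Eq.trans ?_ (galLift_apply σ ⟨_, hx⟩).symm)
      exact congrArg Subtype.val hτ
    rw [(hz.isPrimitive n).pt_eq_pt_iff hπ, ← Ideal.mem_span_singleton, ← Ideal.span_singleton_pow,
      ← hπ.maximalIdeal_eq, mem_maximalIdeal_pow_iff hπ] at h1
    rw [Subtype.dist_eq, dist_eq_norm]
    refine lt_of_le_of_lt (h1.trans ?_) hn
    exact pow_le_pow_of_le_one (norm_nonneg _) (norm_pi_lt hπ).le n.le_succ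
  have he : Continuous e := by
    rw [Units.continuous_iff]
    refine ⟨hval, ?_⟩
    have : (fun σ => ((e σ)⁻¹ : (OO E)ˣ).val) = fun σ => (e σ⁻¹ : OO E) := by
      ext σ
      rw [map_inv]
    rw [this]
    exact hval.comp continuous_inv
  have he' : Continuous e.symm :=
    Continuous.continuous_symm_of_equiv_compact_to_t2 (f := e.toEquiv) he
  exact ⟨{ e.symm with
    continuous_toFun := he'
    continuous_invFun := he }, hs⟩

theorem Corresponds.apply (hπ : Irreducible π) (hH : H.red π = PowerSeries.X ^ resCard E)
    (h : Corresponds z v σ) {n : ℕ} {x : H.tower π}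
    (hx : (x : AlgebraicClosure E) ∈ H.torsion (π ^ n)) : H.EvalsTo v x (σ x) := by
  rw [H.evalsTo_iff (H.mem_torsion_iff.1 hx).1, ← galLift_apply]
  obtain ⟨a, ha⟩ := hz.exists_pt_eq hπ hH hx
  rw [← ha, map_pt _ (hz.norm_lt n), h n, H.pt_comm (hz.norm_lt n)]

end FormalModule

end Galois

/-! ### Inverse limit topologies and adic completions -/

section InverseLimit

section Continuity

variable {X Y : Type*} {U V : ℕ → Type*}

theorem continuous_of_factors {u : ∀ n, X → U n} {w : ∀ n, Y → V n} {f : X → Y}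
    (h : ∀ n, ∃ m, ∀ x x', u m x = u m x' → w n (f x) = w n (f x')) :
    Continuous[⨅ n, .induced (u n) ⊥, ⨅ n, .induced (w n) ⊥] f := by
  refine continuous_iInf_rng.2 fun n => continuous_induced_rng.2 ?_
  obtain ⟨m, hm⟩ := h n
  refine continuous_iInf_dom (i := m) ?_
  rw [continuous_def]
  intro s _
  refine (@isOpen_induced_iff _ _ ⊥ _ _).2 ⟨u m '' (w n ∘ f ⁻¹' s), trivial, ?_⟩
  ext x
  refine ⟨?_, fun hx => ⟨x, hx, rfl⟩⟩
  rintro ⟨x', hx', h'⟩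
  rw [Set.mem_preimage, Function.comp_apply, ← hm x' x h']
  exact hx'

theorem continuous_bot_of_factors {u : ∀ n, X → U n} {f : X → Y} (m : ℕ)
    (h : ∀ x x', u m x = u m x' → f x = f x') :
    Continuous[⨅ n, .induced (u n) ⊥, ⊥] f := by
  have := continuous_of_factors (u := u) (w := fun _ : ℕ => (id : Y → Y)) (f := f) fun _ => ⟨m, h⟩
  rwa [iInf_const, @induced_id _ ⊥] at this

/-- A continuous additive map from an inverse limit to a discrete group factors through a finite
level. -/
theorem exists_level_of_continuous [AddGroup X] [AddGroup Y] [∀ n, AddGroup (U n)]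
    {u : ∀ n, X →+ U n} (hu : ∀ n x, u (n + 1) x = 0 → u n x = 0) {f : X →+ Y}
    (hf : Continuous[⨅ n, .induced (u n) ⊥, ⊥] f) : ∃ n, ∀ x, u n x = 0 → f x = 0 := by
  have hopen : IsOpen[⨅ n, .induced (u n) ⊥] (f ⁻¹' {0}) :=
    continuous_def.1 hf {0} trivial
  have hmem : f ⁻¹' {0} ∈ @nhds X (⨅ n, .induced (u n) ⊥) 0 :=
    @IsOpen.mem_nhds X (⨅ n, .induced (u n) ⊥) 0 _ hopen (map_zero f)
  have hanti {m n : ℕ} (hmn : m ≤ n) (x : X) (hx : u n x = 0) : u m x = 0 := by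
    induction n, hmn using Nat.le_induction with
    | base => exact hx
    | succ n _ ih => exact ih (hu n x hx)
  have hn (n : ℕ) : @nhds X (.induced (u n) ⊥) 0 = Filter.principal {x | u n x = 0} := by
    let _ : TopologicalSpace (U n) := ⊥
    have : DiscreteTopology (U n) := ⟨rfl⟩
    rw [nhds_induced, nhds_discrete, map_zero, Filter.comap_pure]
    rfl
  rw [nhds_iInf, funext hn, Filter.mem_iInf_of_directed] at hmem
  · obtain ⟨n, hn⟩ := hmem
    exact ⟨n, fun x hx => hn hx⟩
  · refine directed_of_isDirected_le fun m n hmn => ?_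
    exact Filter.principal_mono.2 fun x hx => hanti hmn x hx

end Continuity

section Completion

theorem exists_monotone_seq {P : ℕ → ℕ → Prop} (h : ∀ m, ∃ n, P m n)
    (hP : ∀ m n n', n ≤ n' → P m n → P m n') :
    ∃ N : ℕ → ℕ, Monotone N ∧ (∀ m, m ≤ N m) ∧ ∀ m, P m (N m) := by
  choose g hg using h
  refine ⟨fun m => m + ∑ i ∈ Finset.range (m + 1), g i, ?_, fun m => Nat.le_add_right _ _,
    fun m => hP m _ _ ?_ (hg m)⟩
  · refine monotone_nat_of_le_succ fun m => ?_
    rw [Finset.sum_range_succ _ (m + 1)]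
    omega
  · have := Finset.single_le_sum (f := g) (s := Finset.range (m + 1)) (fun _ _ => Nat.zero_le _)
      (Finset.self_mem_range_succ m)
    exact this.trans (Nat.le_add_left _ _)

variable {k A S B : Type*} [CommRing k] [CommRing A] [Algebra k A] {I : Ideal A} [CommRing S]
  [Algebra k S] [CommRing B]

theorem evalA_eq_mk_of_le {f : AdicCompletion I A} {m n : ℕ} (hmn : m ≤ n) {a : A}
    (h : AdicCompletion.evalₐ I n f = Ideal.Quotient.mk (I ^ n) a) :
    AdicCompletion.evalₐ I m f = Ideal.Quotient.mk (I ^ m) a := by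
  obtain ⟨x, rfl⟩ := AdicCompletion.mk_surjective I A f
  rw [AdicCompletion.evalₐ_mk] at h ⊢
  rw [Ideal.Quotient.eq] at h ⊢
  have h1 := AdicCompletion.Ideal.mk_eq_mk (I := I) hmn x
  rw [Ideal.Quotient.eq] at h1
  have := add_mem (Ideal.pow_le_pow_right hmn h) (neg_mem h1)
  simpa using this

/-- Let `S` be the inverse limit of the images of the maps `cₙ : S → B`, and let `φ : A → S` have
dense image. If the topology of `S` induces the `I`-adic topology on `A`, then `S` is the `I`-adic
completion of `A`. -/
theorem exists_adicCompletion_equiv [tS : TopologicalSpace S]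
    [tA : TopologicalSpace (AdicCompletion I A)] (c : ℕ → S →+* B) (φ : A →ₐ[k] S)
    (htop : tS = ⨅ n, .induced (c n) ⊥)
    (htop' : tA = ⨅ n, .induced (AdicCompletion.evalₐ I n) ⊥)
    (hc : ∀ n s, c (n + 1) s = 0 → c n s = 0)
    (hinj : ∀ s, (∀ n, c n s = 0) → s = 0)
    (hlim : ∀ a : ℕ → A, (∀ n, c n (φ (a (n + 1))) = c n (φ (a n))) →
      ∃ s, ∀ n, c n s = c n (φ (a n)))
    (hdense : ∀ n s, ∃ a, c n (φ a) = c n s)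
    (h1 : ∀ m, ∃ n, ∀ a, c n (φ a) = 0 → a ∈ I ^ m)
    (h2 : ∀ n, ∃ m, ∀ a ∈ I ^ m, c n (φ a) = 0) :
    ∃ e : AdicCompletion I A ≃A[k] S, ∀ a, e (AdicCompletion.of I A a) = φ a := by
  have hanti {m n : ℕ} (hmn : m ≤ n) (s : S) (hs : c n s = 0) : c m s = 0 := by
    induction n, hmn using Nat.le_induction with
    | base => exact hs
    | succ n _ ih => exact ih (hc n s hs)
  have hanti' {m n : ℕ} (hmn : m ≤ n) {s t : S} (hs : c n s = c n t) : c m s = c m t := by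
    rw [← sub_eq_zero, ← map_sub] at hs ⊢
    exact hanti hmn _ hs
  obtain ⟨N, hN, hN', hN1⟩ := exists_monotone_seq h1
    (fun m n n' hn h a ha => h a (hanti hn _ ha))
  obtain ⟨M, hM, hM', hM2⟩ := exists_monotone_seq h2
    (fun n m m' hm h a ha => h a (Ideal.pow_le_pow_right hm ha))
  have hMeq {n : ℕ} {a b : A}
      (h : Ideal.Quotient.mk (I ^ M n) a = Ideal.Quotient.mk (I ^ M n) b) :
      c n (φ a) = c n (φ b) := by
    rw [← sub_eq_zero, ← map_sub, ← map_sub]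
    exact hM2 n _ (Ideal.Quotient.eq.1 h)
  let R (f : AdicCompletion I A) (s : S) : Prop := ∀ n, ∃ a,
    AdicCompletion.evalₐ I (M n) f = Ideal.Quotient.mk _ a ∧ c n s = c n (φ a)
  have hex (f : AdicCompletion I A) : ∃ s, R f s := by
    have h (n : ℕ) : ∃ a, AdicCompletion.evalₐ I (M n) f = Ideal.Quotient.mk _ a :=
      (Ideal.Quotient.mk_surjective _).imp fun _ h => h.symm
    choose a ha using h
    obtain ⟨s, hs⟩ := hlim a fun n =>
      hMeq ((evalA_eq_mk_of_le (hM n.le_succ) (ha (n + 1))).symm.trans (ha n))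
    exact ⟨s, fun n => ⟨a n, ha n, hs n⟩⟩
  have huniq {f : AdicCompletion I A} {s t : S} (hs : R f s) (ht : R f t) : s = t := by
    rw [← sub_eq_zero]
    refine hinj _ fun n => ?_
    obtain ⟨a, ha, ha'⟩ := hs n
    obtain ⟨b, hb, hb'⟩ := ht n
    rw [map_sub, ha', hb', hMeq (ha.symm.trans hb), sub_self]
  have hof (a : A) : R (AdicCompletion.of I A a) (φ a) := fun n =>
    ⟨a, AdicCompletion.evalₐ_of I _ a, rfl⟩
  choose g hg using hex
  let G : AdicCompletion I A →ₐ[k] S :=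
    { toFun := g
      map_one' := huniq (hg 1) (by simpa using! hof 1)
      map_zero' := huniq (hg 0) (by simpa using hof 0)
      map_add' := fun x y => huniq (hg _) fun n => by
        obtain ⟨a, ha, ha'⟩ := hg x n
        obtain ⟨b, hb, hb'⟩ := hg y n
        exact ⟨a + b, by rw [map_add, ha, hb, map_add], by rw [map_add, ha', hb', map_add, map_add]⟩
      map_mul' := fun x y => huniq (hg _) fun n => by
        obtain ⟨a, ha, ha'⟩ := hg x n
        obtain ⟨b, hb, hb'⟩ := hg y n
        exact ⟨a * b, by rw [map_mul, ha, hb, map_mul], by rw [map_mul, ha', hb', map_mul, map_mul]⟩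
      commutes' := fun x => huniq (hg _) (by simpa using! hof (algebraMap k A x)) }
  have hGinj : Function.Injective G := by
    rw [injective_iff_map_eq_zero]
    intro f hf
    refine AdicCompletion.ext_evalₐ fun m => ?_
    obtain ⟨a, ha, ha'⟩ := hg f (N m)
    have h0 : g f = 0 := hf
    rw [h0, map_zero] at ha'
    rw [map_zero, evalA_eq_mk_of_le ((hN' m).trans (hM' _)) ha]
    exact Ideal.Quotient.eq_zero_iff_mem.2 (hN1 m a ha'.symm)
  have hsurj' (s : S) : ∃ f : AdicCompletion I A, G f = s ∧
      ∀ m a, c (N m) s = c (N m) (φ a) → AdicCompletion.evalₐ I m f = Ideal.Quotient.mk _ a := by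
    have h (m : ℕ) := hdense (N m) s
    choose a ha using h
    have hN1' {m : ℕ} {a b : A} (h : c (N m) (φ a) = c (N m) (φ b)) :
        Ideal.Quotient.mk (I ^ m) a = Ideal.Quotient.mk (I ^ m) b := by
      rw [Ideal.Quotient.eq]
      refine hN1 m _ ?_
      rw [map_sub, map_sub, h, sub_self]
    let x : AdicCompletion.AdicCauchySequence I A := AdicCompletion.AdicCauchySequence.mk I A a
      fun m => by
        rw [SModEq.sub_mem, smul_eq_mul, Ideal.mul_top, ← Ideal.Quotient.eq]
        exact hN1' ((ha m).trans (hanti' (hN m.le_succ) (ha (m + 1))).symm)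
    have hx (m : ℕ) : AdicCompletion.evalₐ I m (AdicCompletion.mk I A x) =
        Ideal.Quotient.mk _ (a m) := AdicCompletion.evalₐ_mk I m x
    refine ⟨AdicCompletion.mk I A x, huniq (hg _) fun n => ⟨a (M n), hx _, ?_⟩, fun m b hb => ?_⟩
    · exact hanti' ((hM' n).trans (hN' _)) (ha (M n)).symm
    · rw [hx]
      exact hN1' ((ha m).trans hb)
  have hGsurj : Function.Surjective G := fun s => (hsurj' s).imp fun _ h => h.1
  let e : AdicCompletion I A ≃ₐ[k] S := AlgEquiv.ofBijective G ⟨hGinj, hGsurj⟩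
  have he : Continuous[tA, tS] e := by
    rw [htop, htop']
    refine continuous_of_factors (u := fun n => AdicCompletion.evalₐ I n) (w := fun n => c n)
      fun n => ⟨M n, fun x x' hxx' => ?_⟩
    obtain ⟨a, ha, ha'⟩ := hg x n
    obtain ⟨b, hb, hb'⟩ := hg x' n
    change c n (g x) = c n (g x')
    rw [ha', hb', hMeq (ha.symm.trans (hxx'.trans hb))]
  have he' : Continuous[tS, tA] e.symm := by
    rw [htop, htop']
    refine continuous_of_factors (u := fun n => c n) (w := fun n => AdicCompletion.evalₐ I n)
      fun m => ⟨N m, fun s t hst => ?_⟩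
    obtain ⟨a, ha⟩ := hdense (N m) s
    obtain ⟨f, rfl, hf'⟩ := hsurj' s
    obtain ⟨f', rfl, hf''⟩ := hsurj' t
    have e1 (f) : e.symm (G f) = f := e.symm_apply_apply f
    rw [e1, e1, hf' m a ha.symm, hf'' m a (hst.symm.trans ha.symm)]
  exact ⟨{ e with
    continuous_toFun := he
    continuous_invFun := he' }, fun a => huniq (hg _) (hof a)⟩

end Completion

end InverseLimit

/-! ### The ring `k[T^{1/q^∞}]` -/

section PerfectPoly

variable {k : Type*} [CommRing k] {q : ℕ} {S : Type*} [CommRing S] [Algebra k S]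

theorem Exponents.exists_eq (e : Exponents q) : ∃ n m : ℕ, (e : ℚ≥0) * q ^ n = m := e.2

section Lift

variable {r : ℕ → S} (hr : ∀ n, r (n + 1) ^ q = r n)

include hr in
theorem rootSystem_pow (n j : ℕ) : r (n + j) ^ q ^ j = r n := by
  induction j with
  | zero => simp
  | succ j ih => rw [pow_succ', pow_mul, ← add_assoc, hr, ih]

/-- The power `r₀ ^ e` for a system `r` of `q`-power roots of `r₀` and an exponent `e = m / q ^ n`,
i.e. `rₙ ^ m`. -/
def rootPow (r : ℕ → S) (e : Exponents q) : S :=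
  r (Exponents.exists_eq e).choose ^ (Exponents.exists_eq e).choose_spec.choose

include hr in
theorem rootPow_eq (hq : q ≠ 0) {e : Exponents q} {n m : ℕ} (h : (e : ℚ≥0) * q ^ n = m) :
    rootPow r e = r n ^ m := by
  have hq' : (q : ℚ≥0) ≠ 0 := by exact_mod_cast hq
  have key {n n' m m' : ℕ} (hn : n ≤ n') (h : (e : ℚ≥0) * q ^ n = m)
      (h' : (e : ℚ≥0) * q ^ n' = m') : r n ^ m = r n' ^ m' := by
    obtain ⟨j, rfl⟩ := Nat.exists_eq_add_of_le hn
    have hm : m' = q ^ j * m := by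
      have : (m' : ℚ≥0) = q ^ j * m := by rw [← h', ← h]; ring
      exact_mod_cast this
    rw [hm, pow_mul, rootSystem_pow hr]
  have h' := (Exponents.exists_eq e).choose_spec.choose_spec
  rcases le_total n (Exponents.exists_eq e).choose with hn | hn
  · exact (key hn h h').symm
  · exact key hn h' h

/-- The monomial homomorphism `T ^ e ↦ r₀ ^ e`. -/
def rootPowHom (hq : q ≠ 0) : Multiplicative (Exponents q) →* S where
  toFun e := rootPow r e.toAdd
  map_one' := by
    rw [rootPow_eq hr hq (n := 0) (m := 0) (by simp)]
    simp
  map_mul' x y := by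
    obtain ⟨n, m, h⟩ := Exponents.exists_eq x.toAdd
    obtain ⟨n', m', h'⟩ := Exponents.exists_eq y.toAdd
    rw [rootPow_eq hr hq (e := x.toAdd) (n := n + n') (m := m * q ^ n'),
      rootPow_eq hr hq (e := y.toAdd) (n := n + n') (m := m' * q ^ n),
      rootPow_eq hr hq (n := n + n') (m := m * q ^ n' + m' * q ^ n), pow_add]
    · push_cast
      rw [← h, ← h']
      simp only [toAdd_mul, AddSubmonoid.coe_add]
      ring
    · push_cast
      rw [← h']
      ring
    · push_cast
      rw [← h]
      ring

variable (k) in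
/-- The homomorphism `k[T^{1/q^∞}] → S` sending `T^{1/q^n}` to `rₙ`. -/
def rootLift (hq : q ≠ 0) : PerfectPoly k q →ₐ[k] S :=
  AddMonoidAlgebra.lift k S (Exponents q) (rootPowHom hr hq)

variable (k) in
/-- The element `T^{1/q^n}` of `k[T^{1/q^∞}]`. -/
def polyRoot (hq : q ≠ 0) (n : ℕ) : PerfectPoly k q :=
  AddMonoidAlgebra.single (Exponents.root q hq n) 1

theorem coe_root (hq : q ≠ 0) (n : ℕ) : (Exponents.root q hq n : ℚ≥0) = ((q : ℚ≥0) ^ n)⁻¹ := rfl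

theorem rootLift_polyRoot (hq : q ≠ 0) (n : ℕ) : rootLift k hr hq (polyRoot k hq n) = r n := by
  have hq' : (q : ℚ≥0) ≠ 0 := by exact_mod_cast hq
  rw [rootLift, polyRoot, AddMonoidAlgebra.lift_single, one_smul]
  change rootPow r (Exponents.root q hq n) = r n
  rw [rootPow_eq hr hq (n := n) (m := 1) (by rw [coe_root]; simp [hq']), pow_one]

section Hom

variable {S : Type*} [CommRing S] {r : ℕ → S}

/-- The variant of `rootLift` for a homomorphism `k → S`. -/
def rootLiftHom (g : k →+* S) (hr : ∀ n, r (n + 1) ^ q = r n) (hq : q ≠ 0) :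
    PerfectPoly k q →+* S :=
  letI := g.toAlgebra
  (rootLift k hr hq).toRingHom

theorem rootLiftHom_polyRoot (g : k →+* S) (hr : ∀ n, r (n + 1) ^ q = r n) (hq : q ≠ 0) (n : ℕ) :
    rootLiftHom g hr hq (polyRoot k hq n) = r n :=
  letI := g.toAlgebra
  rootLift_polyRoot hr hq n

theorem rootLiftHom_algebraMap (g : k →+* S) (hr : ∀ n, r (n + 1) ^ q = r n) (hq : q ≠ 0) (c : k) :
    rootLiftHom g hr hq (algebraMap _ _ c) = g c :=
  letI := g.toAlgebra
  (rootLift k hr hq).commutes c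

end Hom

end Lift

theorem single_eq_polyRoot_pow (hq : q ≠ 0) {e : Exponents q} {n m : ℕ}
    (h : (e : ℚ≥0) * q ^ n = m) :
    (AddMonoidAlgebra.single e 1 : PerfectPoly k q) = polyRoot k hq n ^ m := by
  have hq' : (q : ℚ≥0) ≠ 0 := by exact_mod_cast hq
  rw [polyRoot, AddMonoidAlgebra.single_pow, one_pow]
  congr 1
  refine Subtype.ext ?_
  rw [AddSubmonoidClass.coe_nsmul, coe_root, nsmul_eq_mul, ← h]
  field_simp

theorem polyRoot_succ_pow (hq : q ≠ 0) (n : ℕ) : polyRoot k hq (n + 1) ^ q = polyRoot k hq n := by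
  have hq' : (q : ℚ≥0) ≠ 0 := by exact_mod_cast hq
  refine (single_eq_polyRoot_pow hq ?_).symm
  rw [coe_root, pow_succ]
  field_simp

theorem polyRoot_add_pow (hq : q ≠ 0) (n j : ℕ) :
    polyRoot k hq (n + j) ^ q ^ j = polyRoot k hq n :=
  rootSystem_pow (polyRoot_succ_pow hq) n j

theorem idealT_eq (hq : q ≠ 0) : idealT k q = Ideal.span {polyRoot k hq 0} := by
  rw [idealT, polyRoot]
  congr 4
  simp

/-- Every element of `k[T^{1/q^∞}]` is a polynomial in `T^{1/q^n}` for some `n`. -/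
theorem exists_aeval_polyRoot (hq : q ≠ 0) (a : PerfectPoly k q) :
    ∃ (n : ℕ) (P : Polynomial k), a = Polynomial.aeval (polyRoot k hq n) P := by
  have lift {n : ℕ} (P : Polynomial k) (j : ℕ) :
      Polynomial.aeval (polyRoot k hq n) P =
        Polynomial.aeval (polyRoot k hq (n + j)) (Polynomial.expand k (q ^ j) P) := by
    rw [Polynomial.expand_aeval, polyRoot_add_pow]
  induction a using AddMonoidAlgebra.induction_linear with
  | zero => exact ⟨0, 0, by simp⟩
  | add a b ha hb =>
    obtain ⟨n, P, rfl⟩ := ha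
    obtain ⟨n', P', rfl⟩ := hb
    refine ⟨n + n', Polynomial.expand k (q ^ n') P + Polynomial.expand k (q ^ n) P', ?_⟩
    rw [map_add, ← lift, lift P' n, add_comm n' n]
  | single e c =>
    obtain ⟨n, m, h⟩ := Exponents.exists_eq e
    refine ⟨n, Polynomial.C c * Polynomial.X ^ m, ?_⟩
    rw [map_mul, map_pow, Polynomial.aeval_X, Polynomial.aeval_C, ← single_eq_polyRoot_pow hq h,
      ← Algebra.smul_def, AddMonoidAlgebra.smul_single, smul_eq_mul, mul_one]

theorem perfectPoly_hom_ext {S : Type*} [CommRing S] (hq : q ≠ 0) {f g : PerfectPoly k q →+* S}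
    (hC : ∀ c, f (algebraMap k _ c) = g (algebraMap k _ c))
    (hX : ∀ n, f (polyRoot k hq n) = g (polyRoot k hq n)) : f = g := by
  refine RingHom.ext fun a => ?_
  obtain ⟨n, P, rfl⟩ := exists_aeval_polyRoot hq a
  rw [Polynomial.aeval_def, Polynomial.hom_eval₂, Polynomial.hom_eval₂, hX]
  congr 1
  ext c
  exact hC c

section Perfect

variable {k : Type*} [Field k] {p : ℕ} [Fact p.Prime] [CharP k p] [PerfectRing k p]

instance charP_perfectPoly : CharP (PerfectPoly k q) p :=
  charP_of_injective_algebraMap (algebraMap k (PerfectPoly k q)).injective p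

theorem Exponents.exists_nsmul_eq {f : ℕ} (hf : f ≠ 0) (hq : q = p ^ f) (e : Exponents q) :
    ∃ d : Exponents q, p • d = e := by
  obtain ⟨n, m, h⟩ := Exponents.exists_eq e
  have hp : (p : ℚ≥0) ≠ 0 := by exact_mod_cast (Fact.out : p.Prime).ne_zero
  obtain ⟨f, rfl⟩ := Nat.exists_eq_succ_of_ne_zero hf
  refine ⟨⟨e / p, n + 1, m * p ^ f, ?_⟩, Subtype.ext ?_⟩
  · have hq' : (q : ℚ≥0) = p ^ f * p := by
      rw [hq, Nat.succ_eq_add_one, pow_succ]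
      push_cast
      rfl
    push_cast
    rw [← h, pow_succ, hq']
    field_simp
  · rw [AddSubmonoidClass.coe_nsmul, nsmul_eq_mul]
    field_simp

theorem perfectRing_perfectPoly {f : ℕ} (hf : f ≠ 0) (hq : q = p ^ f) :
    PerfectRing (PerfectPoly k q) p := by
  refine PerfectRing.ofSurjective _ p fun a => ?_
  induction a using AddMonoidAlgebra.induction_linear with
  | zero => exact ⟨0, map_zero _⟩
  | add a b ha hb =>
    obtain ⟨a, rfl⟩ := ha
    obtain ⟨b, rfl⟩ := hb
    exact ⟨a + b, map_add _ _ _⟩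
  | single e c =>
    obtain ⟨d, rfl⟩ := Exponents.exists_nsmul_eq hf hq e
    obtain ⟨b, rfl⟩ := surjective_frobenius k p c
    exact ⟨AddMonoidAlgebra.single d b, by
      rw [frobenius_def, AddMonoidAlgebra.single_pow, frobenius_def]⟩

end Perfect

end PerfectPoly

section Completion

variable (k : Type u) [CommRing k] (q : ℕ)

/-- The homomorphism from `k[T^{1/q^∞}]` to its `T`-adic completion. -/
def polyToSeries : PerfectPoly k q →ₐ[k] PerfectSeries k q :=
  IsScalarTower.toAlgHom k (PerfectPoly k q) (PerfectSeries k q)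

theorem polyToSeries_apply (a : PerfectPoly k q) :
    polyToSeries k q a = AdicCompletion.of (idealT k q) (PerfectPoly k q) a := rfl

theorem rootT_eq (hq : q ≠ 0) (n : ℕ) :
    rootT k q hq n = polyToSeries k q (polyRoot k hq n) := rfl

end Completion

/-! ### The ring of integers of `Ê_∞` modulo the uniformizer -/

section ModPi

variable {E : Type u} [NontriviallyNormedField E] [IsUltrametricDist E] [ProperSpace E]
variable (F : IntermediateField E (AlgebraicClosure E)) (π : OO E)

/-- The ring of integers of the completion of `F` modulo `π`. -/
def ModPi : Type u := OO (Hat F) ⧸ Ideal.span {toOOHat F π}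

instance : CommRing (ModPi F π) :=
  inferInstanceAs (CommRing (OO (Hat F) ⧸ Ideal.span {toOOHat F π}))

/-- The reduction modulo `π`. -/
def mkPi : OO (Hat F) →+* ModPi F π := Ideal.Quotient.mk (Ideal.span {toOOHat F π})

/-- The embedding of the integers of `F` into those of its completion. -/
def toCompl : OO F →+* OO (Hat F) :=
  (UniformSpace.Completion.coeRingHom.comp (OO F).subtype).codRestrict (OO (Hat F)) fun x =>
    mem_OO_iff.2 ((UniformSpace.Completion.norm_coe (x : F)).trans_le (mem_OO_iff.1 x.2))

/-- The map from the integers of `F` to those of its completion, modulo `π`. -/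
def modPi : OO F →+* ModPi F π := (mkPi F π).comp (toCompl F)

/-- The embedding of the integers of `E` into those of `F`. -/
def toOO : OO E →+* OO F :=
  ((algebraMap E F).comp (OO E).subtype).codRestrict (OO F) fun x =>
    mem_OO_iff.2 (norm_intMap_le x)

variable {F π}

theorem norm_toCompl (x : OO F) : ‖(toCompl F x : Hat F)‖ = ‖((x : F) : AlgebraicClosure E)‖ :=
  UniformSpace.Completion.norm_coe (x : F)

theorem mkPi_surjective : Function.Surjective (mkPi F π) := Ideal.Quotient.mk_surjective

theorem mkPi_eq_zero_iff_dvd {x : OO (Hat F)} : mkPi F π x = 0 ↔ toOOHat F π ∣ x :=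
  Ideal.Quotient.eq_zero_iff_mem.trans Ideal.mem_span_singleton

theorem mkPi_eq_zero_iff {x : OO (Hat F)} :
    mkPi F π x = 0 ↔ ‖(x : Hat F)‖ ≤ ‖(π : E)‖ := by
  have h : ‖((toOOHat F π : OO (Hat F)) : Hat F)‖ = ‖(π : E)‖ := norm_toHat F π
  rw [mkPi_eq_zero_iff_dvd]
  refine ⟨?_, fun hx => dvd_OO (hx.trans h.ge)⟩
  rintro ⟨y, rfl⟩
  rw [Subring.coe_mul, norm_mul, h]
  exact mul_le_of_le_one_right (norm_nonneg _) (mem_OO_iff.1 y.2)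

theorem modPi_eq_zero_iff {x : OO F} :
    modPi F π x = 0 ↔ ‖((x : F) : AlgebraicClosure E)‖ ≤ ‖(π : E)‖ := by
  rw [← norm_toCompl]
  exact mkPi_eq_zero_iff

theorem modPi_eq_iff {x y : OO F} : modPi F π x = modPi F π y ↔
    ‖((x : F) : AlgebraicClosure E) - ((y : F) : AlgebraicClosure E)‖ ≤ ‖(π : E)‖ := by
  rw [← sub_eq_zero, ← map_sub, modPi_eq_zero_iff]
  rfl

theorem modPi_surjective (hπ : Irreducible π) : Function.Surjective (modPi F π) := by
  intro b
  obtain ⟨y, rfl⟩ := mkPi_surjective b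
  obtain ⟨x, hx⟩ := UniformSpace.Completion.denseRange_coe.exists_dist_lt (y : Hat F)
    (norm_pi_pos hπ)
  rw [dist_eq_norm] at hx
  have hx1 : ‖x‖ ≤ 1 := by
    rw [← UniformSpace.Completion.norm_coe x]
    have h : (x : Hat F) = y + -(y - x) := by ring
    rw [h]
    refine (IsUltrametricDist.norm_add_le_max _ _).trans (max_le (mem_OO_iff.1 y.2) ?_)
    rw [norm_neg]
    exact hx.le.trans (norm_pi_lt hπ).le
  refine ⟨⟨x, mem_OO_iff.2 hx1⟩, ?_⟩
  rw [modPi, RingHom.comp_apply, ← sub_eq_zero, ← map_sub, mkPi_eq_zero_iff, ← norm_neg,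
    ← Subring.coe_neg, neg_sub]
  exact hx.le

variable (F) in
/-- The residue field of `E` acts on the integers of the completion of `F` modulo `π`. -/
def resModPi (hπ : Irreducible π) : Res E →+* ModPi F π :=
  Ideal.Quotient.lift (IsLocalRing.maximalIdeal (OO E)) ((modPi F π).comp (toOO F)) fun a ha => by
    rw [RingHom.comp_apply, modPi_eq_zero_iff]
    exact (norm_intMap a).trans_le (norm_le_pi_of_mem hπ ha)

theorem galOO_toCompl (σ : F ≃ₐ[E] F) {x y : OO F} (h : σ x = y) :
    galOO F σ (toCompl F x) = toCompl F y := by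
  refine Subtype.ext ?_
  change galHat F σ ((x : F) : Hat F) = ((y : F) : Hat F)
  rw [galHat, UniformSpace.Completion.mapRingHom_coe, ← h]
  rfl

theorem galOO_toOOHat (σ : F ≃ₐ[E] F) (a : OO E) : galOO F σ (toOOHat F a) = toOOHat F a :=
  galOO_toCompl σ (x := toOO F a) (y := toOO F a) (σ.commutes _)

/-- The action of an automorphism of `F` modulo `π`. -/
def galModPi (σ : F ≃ₐ[E] F) : ModPi F π →+* ModPi F π :=
  Ideal.quotientMap _ (galOO F σ) (by
    rw [Ideal.span_le, Set.singleton_subset_iff, SetLike.mem_coe, Ideal.mem_comap, galOO_toOOHat]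
    exact Ideal.mem_span_singleton_self _)

theorem galModPi_mkPi (σ : F ≃ₐ[E] F) (x : OO (Hat F)) :
    galModPi σ (mkPi F π x) = mkPi F π (galOO F σ x) := rfl

theorem galModPi_modPi (σ : F ≃ₐ[E] F) {x y : OO F} (h : σ x = y) :
    galModPi σ (modPi F π x) = modPi F π y := by
  rw [modPi, RingHom.comp_apply, galModPi_mkPi, RingHom.comp_apply, galOO_toCompl σ h]

end ModPi

section TowerModPi

variable {E : Type u} [NontriviallyNormedField E] [IsUltrametricDist E] [ProperSpace E]
  {H : FormalModule (OO E)} {π : OO E} {z : ℕ → AlgebraicClosure E}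

namespace FormalModule

open IntermediateField

theorem IsPrimitive.natDegree_minpoly {x : AlgebraicClosure E} {n : ℕ} (hπ : Irreducible π)
    (hH : H.red π = PowerSeries.X ^ resCard E) (hx : H.IsPrimitive π n x) :
    (minpoly E x).natDegree = deg E n := by
  obtain ⟨P, hP, hd, hP', h0, h⟩ := H.exists_eisenstein hπ hH n
  rw [minpoly_eq_of_norm_pow_eq hπ hP ((h x hx.lt_one).2 hx) (hd ▸ hx.norm_pow_deg hπ hH),
    hP.natDegree_map, hd]

/-- The ring of integers of `E(x)` is `O_E[x]`, for a point `x` of exact order `π ^ (n + 1)`. -/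
theorem IsPrimitive.exists_eval₂_eq {x y : AlgebraicClosure E} {n : ℕ} (hπ : Irreducible π)
    (hH : H.red π = PowerSeries.X ^ resCard E) (hx : H.IsPrimitive π n x)
    (hy : y ∈ E⟮x⟯) (hy1 : ‖y‖ ≤ 1) : ∃ P : Polynomial (OO E), P.eval₂ intMap x = y := by
  rw [← mem_toSubalgebra,
    adjoin_simple_toSubalgebra_of_isAlgebraic (Algebra.IsAlgebraic.isAlgebraic x),
    Algebra.adjoin_singleton_eq_range_aeval] at hy
  obtain ⟨Q, rfl⟩ := hy
  have hint : IsIntegral E x := Algebra.IsIntegral.isIntegral x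
  set R := Q %ₘ minpoly E x with hR
  have hRQ : Polynomial.aeval x Q = Polynomial.aeval x R :=
    (Polynomial.aeval_modByMonic_eq_self_of_root (minpoly.aeval E x)).symm
  have hdeg : R.natDegree < deg E n := by
    rw [← hx.natDegree_minpoly hπ hH]
    refine Polynomial.natDegree_modByMonic_lt _ (minpoly.monic hint) ?_
    exact fun h => (minpoly.natDegree_pos hint).ne' (by rw [h, Polynomial.natDegree_one])
  have hsum : Polynomial.aeval x Q = ∑ i ∈ Finset.range (deg E n),
      algebraMap E (AlgebraicClosure E) (R.coeff i) * x ^ i := by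
    rw [hRQ, Polynomial.aeval_eq_sum_range' hdeg]
    simp only [Algebra.smul_def]
  have hpow := hx.norm_pow_deg hπ hH
  have hx0 : 0 < ‖x‖ := by
    refine norm_pos_iff.2 ?_
    rintro rfl
    rw [norm_zero, zero_pow (deg_pos n).ne'] at hpow
    exact (norm_pi_pos hπ).ne hpow
  have hcoef (i : ℕ) (hi : i < deg E n) : ‖R.coeff i‖ ≤ 1 := by
    rcases eq_or_ne (R.coeff i) 0 with h0 | h0
    · rw [h0, norm_zero]
      exact zero_le_one
    have h1 := norm_term_le_norm_sum hπ hpow R.coeff hi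
    rw [← hsum, norm_mul, norm_pow, norm_algebraMap_closure] at h1
    replace h1 : _ ≤ (1 : ℝ) := h1.trans hy1
    obtain ⟨k, hk⟩ := exists_norm_eq_zpow hπ h0
    rw [hk] at h1 ⊢
    rw [← hpow, ← zpow_natCast, ← zpow_natCast, ← zpow_mul, ← zpow_add₀ hx0.ne',
      zpow_le_one_iff_right_of_lt_one₀ hx0 hx.lt_one] at h1
    refine (zpow_le_one_iff_right_of_lt_one₀ (norm_pi_pos hπ) (norm_pi_lt hπ)).2 ?_
    by_contra! hk0
    have hd : (i : ℤ) < deg E n := by exact_mod_cast hi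
    nlinarith
  refine ⟨∑ i : Fin (deg E n), Polynomial.C ⟨R.coeff i, mem_OO_iff.2 (hcoef i i.2)⟩ *
    Polynomial.X ^ (i : ℕ), ?_⟩
  change _ = Polynomial.aeval x Q
  rw [hsum, Polynomial.eval₂_finsetSum, ← Fin.sum_univ_eq_sum_range
    (fun i => algebraMap E (AlgebraicClosure E) (R.coeff i) * x ^ i)]
  simp [intMap_apply]

variable (hπ : Irreducible π) (hH : H.red π = PowerSeries.X ^ resCard E)
  (hz : H.IsTateGenerator π z)

/-- The point `zₙ`, as an integer of `E_∞`. -/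
def IsTateGenerator.int (n : ℕ) : OO (H.tower π) :=
  ⟨⟨z n, hz.mem_tower n⟩, mem_OO_iff.2 (hz.norm_lt n).le⟩

include hπ hH in
theorem IsTateGenerator.modPi_pow (n : ℕ) :
    modPi (H.tower π) π (hz.int (n + 1)) ^ resCard E = modPi (H.tower π) π (hz.int n) := by
  rw [← map_pow, modPi_eq_iff, norm_sub_rev]
  change ‖z n - z (n + 1) ^ resCard E‖ ≤ _
  rw [← hz.pt_succ n]
  exact norm_pt_pi_sub_le H hπ hH (hz.norm_lt _)

/-- The homomorphism from `𝔽_q[T^{1/q^∞}]` to the integers of `Ê_∞` modulo `π` which sends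
`T^{1/q^n}` to `zₙ`. -/
def IsTateGenerator.reduction :
    PerfectPoly (Res E) (resCard E) →+* ModPi (H.tower π) π :=
  rootLiftHom (r := fun n => modPi (H.tower π) π (hz.int n)) (resModPi (H.tower π) hπ)
    (hz.modPi_pow hπ hH) (resCard_ne_zero E)

namespace IsTateGenerator

theorem reduction_polyRoot (n : ℕ) :
    hz.reduction hπ hH (polyRoot (Res E) (resCard_ne_zero E) n) =
      modPi (H.tower π) π (hz.int n) :=
  rootLiftHom_polyRoot (r := fun n => modPi (H.tower π) π (hz.int n))
    (resModPi (H.tower π) hπ) (hz.modPi_pow hπ hH) (resCard_ne_zero E) n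

theorem reduction_algebraMap (c : Res E) :
    hz.reduction hπ hH (algebraMap _ _ c) = resModPi (H.tower π) hπ c :=
  rootLiftHom_algebraMap (r := fun n => modPi (H.tower π) π (hz.int n))
    (resModPi (H.tower π) hπ) (hz.modPi_pow hπ hH) (resCard_ne_zero E) c

theorem reduction_aeval (n : ℕ) (P : Polynomial (OO E)) :
    hz.reduction hπ hH (Polynomial.aeval (polyRoot (Res E) (resCard_ne_zero E) n)
      (P.map (IsLocalRing.residue (OO E)))) =
      modPi (H.tower π) π (P.eval₂ (toOO (H.tower π)) (hz.int n)) := by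
  rw [Polynomial.aeval_def, Polynomial.eval₂_map, Polynomial.hom_eval₂, Polynomial.hom_eval₂,
    reduction_polyRoot]
  congr 1
  ext a
  exact hz.reduction_algebraMap hπ hH _

theorem coe_eval₂_int (n : ℕ) (P : Polynomial (OO E)) :
    (((P.eval₂ (toOO (H.tower π)) (hz.int n) : OO (H.tower π)) : H.tower π) :
      AlgebraicClosure E) = P.eval₂ intMap (z n) :=
  Polynomial.hom_eval₂ P (toOO (H.tower π))
    ((H.tower π).val.toRingHom.comp (OO (H.tower π)).subtype) (hz.int n)

theorem reduction_surjective : Function.Surjective (hz.reduction hπ hH) := by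
  intro b
  obtain ⟨x, rfl⟩ := modPi_surjective hπ b
  obtain ⟨n, hn⟩ := (hz.mem_tower_iff hπ hH).1 (x : H.tower π).2
  obtain ⟨P, hP⟩ := (hz.isPrimitive n).exists_eval₂_eq hπ hH hn (mem_OO_iff.1 x.2)
  refine ⟨_, (hz.reduction_aeval hπ hH (n + 1) P).trans (congrArg _ ?_)⟩
  refine Subtype.ext (Subtype.ext ?_)
  rw [coe_eval₂_int, hP]

/-- The kernel of the reduction is generated by `T^{(q - 1)/q}`; it suffices that it is contained
in the ideal generated by `T^{1/q}`. -/
theorem mem_of_reduction_eq_zero {a : PerfectPoly (Res E) (resCard E)}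
    (ha : hz.reduction hπ hH a = 0) :
    a ∈ Ideal.span {polyRoot (Res E) (resCard_ne_zero E) 1} := by
  obtain ⟨n, P, rfl⟩ := exists_aeval_polyRoot (resCard_ne_zero E) a
  rw [← polyRoot_succ_pow (resCard_ne_zero E) n, ← Polynomial.expand_aeval] at ha ⊢
  set Q := Polynomial.expand (Res E) (resCard E) P
  rcases eq_or_ne Q 0 with hQ | hQ
  · rw [hQ, map_zero]
    exact zero_mem _
  obtain ⟨V, hV, hV'⟩ := Polynomial.exists_eq_pow_rootMultiplicity_mul_and_not_dvd Q hQ 0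
  rw [Polynomial.C_0, sub_zero] at hV hV'
  set i := Polynomial.rootMultiplicity 0 Q
  have hi : resCard E ^ n ≤ i := by
    by_contra! hi
    obtain ⟨U, rfl⟩ := Polynomial.map_surjective (IsLocalRing.residue (OO E))
      IsLocalRing.residue_surjective V
    have hU0 : ‖(U.coeff 0 : E)‖ = 1 := by
      rw [← isUnit_OO_iff]
      rw [Polynomial.X_dvd_iff, Polynomial.coeff_map] at hV'
      exact (IsLocalRing.residue_ne_zero_iff_isUnit _).1 hV'
    have hp := hz.isPrimitive n
    have hU : ‖U.eval₂ intMap (z (n + 1))‖ = 1 := by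
      rw [← U.X_mul_divX_add, Polynomial.eval₂_add, Polynomial.eval₂_mul, Polynomial.eval₂_X,
        Polynomial.eval₂_C]
      have h1 : ‖z (n + 1) * U.divX.eval₂ intMap (z (n + 1))‖ < ‖intMap (U.coeff 0)‖ := by
        rw [norm_intMap, hU0, norm_mul]
        refine (mul_le_of_le_one_right (norm_nonneg _) ?_).trans_lt hp.lt_one
        rw [← evalPt_coe]
        exact norm_evalPt_le hp.lt_one _
      rw [IsUltrametricDist.norm_add_eq_max_of_norm_ne_norm h1.ne, max_eq_right h1.le,
        norm_intMap, hU0]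
    have hX : Q = (Polynomial.X ^ i * U).map (IsLocalRing.residue (OO E)) := by
      rw [hV, Polynomial.map_mul, Polynomial.map_pow, Polynomial.map_X]
    rw [hX, reduction_aeval, modPi_eq_zero_iff, coe_eval₂_int, Polynomial.eval₂_mul,
      Polynomial.eval₂_X_pow, norm_mul, hU, mul_one, norm_pow, ← hp.norm_pow_deg hπ hH] at ha
    have hx0 : 0 < ‖z (n + 1)‖ := by
      refine norm_pos_iff.2 fun h => hp.pt_ne ?_
      rw [h, H.pt_zero_right]
    have h2 := (pow_le_pow_iff_right_of_lt_one₀ hx0 hp.lt_one).1 ha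
    have h3 : resCard E ^ n ≤ deg E n := by
      have : 2 * resCard E ^ n ≤ resCard E ^ (n + 1) := by
        rw [pow_succ']
        exact Nat.mul_le_mul_right _ one_lt_resCard
      rw [deg]
      omega
    omega
  rw [Ideal.mem_span_singleton, hV, map_mul, map_pow, Polynomial.aeval_X,
    ← polyRoot_add_pow (resCard_ne_zero E) 1 n, add_comm 1 n]
  exact (pow_dvd_pow _ hi).mul_right _

end IsTateGenerator

end FormalModule

end TowerModPi

/-! ### Perfections of nilpotent thickenings -/

section Perfection

variable {p : ℕ} [Fact p.Prime] {R B : Type*} [CommRing R] [CharP R p] [CommRing B]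

theorem coeff_add_pow (s : Perfection R p) (m j : ℕ) :
    Perfection.coeff R p (m + j) s ^ p ^ j = Perfection.coeff R p m s := by
  induction j with
  | zero => simp
  | succ j ih => rw [pow_succ', pow_mul, ← add_assoc, Perfection.coeff_pow_p', ih]

theorem coeff_pow_self (s : Perfection R p) (j : ℕ) :
    Perfection.coeff R p j (s ^ p ^ j) = Perfection.coeff R p 0 s := by
  rw [map_pow, ← coeff_add_pow s 0 j, zero_add]

/-- The reduction to `B` of the coefficient of index `f * (n + N)` of an element of the perfection
of `R`. If `R → B` is surjective and its kernel is killed by the `f * N`-th power of Frobenius, then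
that power factors as `ρ ∘ proj` below, and these reductions determine the element. -/
def level (f N : ℕ) (proj : R →+* B) (n : ℕ) : Perfection R p →+* B :=
  proj.comp (Perfection.coeff R p (f * (n + N)))

variable {f N : ℕ} {proj : R →+* B} {ρ : B →+* R}

theorem level_succ_pow (n : ℕ) (s : Perfection R p) :
    level f N proj (n + 1) s ^ p ^ f = level f N proj n s := by
  rw [level, RingHom.comp_apply, ← map_pow, show f * (n + 1 + N) = f * (n + N) + f by ring,
    coeff_add_pow]
  rfl

variable (h1 : ∀ y, ρ (proj y) = y ^ p ^ (f * N)) (h2 : ∀ b, proj (ρ b) = b ^ p ^ (f * N))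

include h1 in
theorem coeff_eq_level (n : ℕ) (s : Perfection R p) :
    Perfection.coeff R p (f * n) s = ρ (level f N proj n s) := by
  rw [level, RingHom.comp_apply, h1, mul_add, coeff_add_pow]

include h1 in
theorem coeff_eq_level_pow (hf : f ≠ 0) (n : ℕ) (s : Perfection R p) :
    Perfection.coeff R p n s = ρ (level f N proj n s) ^ p ^ (f * n - n) := by
  have hn : n ≤ f * n := Nat.le_mul_of_pos_left n (Nat.pos_of_ne_zero hf)
  rw [← coeff_eq_level h1]
  conv_lhs => rw [← coeff_add_pow s n (f * n - n), Nat.add_sub_of_le hn]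

include h2 in
theorem exists_level_eq (hf : f ≠ 0) {b : ℕ → B} (hb : ∀ n, b (n + 1) ^ p ^ f = b n) :
    ∃ s : Perfection R p, ∀ n, level f N proj n s = b n := by
  have hn (n : ℕ) : n ≤ f * n := Nat.le_mul_of_pos_left n (Nat.pos_of_ne_zero hf)
  have hs (n : ℕ) : (ρ (b (n + 1)) ^ p ^ (f * (n + 1) - (n + 1))) ^ p =
      ρ (b n) ^ p ^ (f * n - n) := by
    rw [← hb n, map_pow, ← pow_mul, ← pow_mul, ← pow_succ, ← pow_add]
    congr 2
    have h3 := hn n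
    have h4 := hn (n + 1)
    rw [mul_add, mul_one] at h4 ⊢
    omega
  have hbN (n j : ℕ) : b (n + j) ^ p ^ (f * j) = b n := by
    induction j with
    | zero => simp
    | succ j ih =>
      rw [Nat.mul_succ, pow_add, pow_mul', ← add_assoc, hb, ih]
  refine ⟨⟨fun n => ρ (b n) ^ p ^ (f * n - n), hs⟩, fun n => ?_⟩
  set s : Perfection R p := ⟨fun n => ρ (b n) ^ p ^ (f * n - n), hs⟩
  have h3 : Perfection.coeff R p (f * (n + N)) s = ρ (b (n + N)) := by
    change ρ (b (f * (n + N))) ^ p ^ (f * (f * (n + N)) - f * (n + N)) = ρ (b (n + N))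
    rw [← hbN (n + N) (f * (n + N) - (n + N)), Nat.add_sub_of_le (hn _), map_pow, Nat.mul_sub]
  rw [level, RingHom.comp_apply, h3, h2, hbN]

variable {A : Type*} [CommRing A] [CharP A p] [PerfectRing A p] {ψ : A →+* B}

theorem coeff_zero_lift (g : A →+* R) (a : A) :
    Perfection.coeff R p 0 (Perfection.lift p A R g a) = g a := rfl

include h2 in
/-- The reduction of level `n` of the lift of `ψ` is `ψ` composed with the inverse of the `n`-th
power of Frobenius. -/
theorem level_lift_pow (n : ℕ) (a : A) :
    level f N proj n (Perfection.lift p A R (ρ.comp ψ) (a ^ p ^ (f * n))) = ψ a := by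
  obtain ⟨b, rfl⟩ := (iterateFrobeniusEquiv A p (f * N)).surjective a
  rw [iterateFrobeniusEquiv_def, ← pow_mul, ← pow_add, show f * N + f * n = f * (n + N) by ring,
    level, RingHom.comp_apply, map_pow (Perfection.lift p A R (ρ.comp ψ)), coeff_pow_self,
    coeff_zero_lift, RingHom.comp_apply, h2, map_pow]

variable {k : Type*} [CommRing k] [CharP k p] [PerfectRing k p] [Algebra k A]
  [Algebra k (Perfection R p)]

include h1 h2 in
/-- Let `ψ : A → B` be a surjection from a perfect ring whose kernel contains the `q`-th power of an
element `t` generating an ideal that contains the kernel. Then the perfection of a nilpotent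
thickening of `B` is the `t`-adic completion of `A`. -/
theorem exists_adicCompletion_equiv_perfection [tS : TopologicalSpace (Perfection R p)]
    {I : Ideal A} [tA : TopologicalSpace (AdicCompletion I A)]
    (htop : tS = ⨅ n, .induced (Perfection.coeff R p n) ⊥)
    (htop' : tA = ⨅ n, .induced (AdicCompletion.evalₐ I n) ⊥)
    (halg : algebraMap k (Perfection R p) =
      Perfection.lift p k R (ρ.comp (ψ.comp (algebraMap k A))))
    (hf : f ≠ 0) (hψ : Function.Surjective ψ) {t : A} (hI : I = Ideal.span {t ^ p ^ f})
    (ht : ψ (t ^ p ^ f) = 0) (hker : ∀ a, ψ a = 0 → a ∈ Ideal.span {t}) :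
    ∃ e : AdicCompletion I A ≃A[k] Perfection R p,
      ∀ n a, level f N proj n (e (AdicCompletion.of I A (a ^ p ^ (f * n)))) = ψ a := by
  let φ : A →ₐ[k] Perfection R p :=
    { Perfection.lift p A R (ρ.comp ψ) with
      commutes' := RingHom.congr_fun (f := (Perfection.lift p A R (ρ.comp ψ)).comp (algebraMap k A))
        (by rw [halg]; exact Perfection.hom_ext _ fun c => rfl) }
  have hφ (n : ℕ) (a : A) : level f N proj n (φ (a ^ p ^ (f * n))) = ψ a := level_lift_pow h2 n a
  suffices h : ∃ e : AdicCompletion I A ≃A[k] Perfection R p, ∀ a, e (AdicCompletion.of I A a) = φ a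
    from h.imp fun e he n a => by rw [he, hφ]
  have hroot (n : ℕ) (a : A) : ∃ b, a = b ^ p ^ (f * n) :=
    ((iterateFrobeniusEquiv A p (f * n)).surjective a).imp fun _ h => h.symm
  have hq : 1 < p ^ f := Nat.one_lt_pow hf (Fact.out : p.Prime).one_lt
  refine exists_adicCompletion_equiv (level f N proj) φ ?_ htop' ?_ ?_ ?_ ?_ ?_ ?_
  · rw [htop]
    apply le_antisymm
    · refine continuous_id_iff_le.1 (continuous_of_factors fun n => ⟨f * (n + N), fun x y h => ?_⟩)
      exact congrArg proj h
    · refine continuous_id_iff_le.1 (continuous_of_factors fun n => ⟨n, fun x y h => ?_⟩)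
      simp only [id_eq, coeff_eq_level_pow h1 hf, h]
  · intro n s hs
    rw [← level_succ_pow, hs, zero_pow (by omega)]
  · intro s hs
    refine Perfection.ext fun n => ?_
    rw [coeff_eq_level_pow h1 hf, hs, map_zero, zero_pow, map_zero]
    exact pow_ne_zero _ (Fact.out : p.Prime).ne_zero
  · intro a ha
    exact exists_level_eq h2 hf fun n => (level_succ_pow n _).trans (ha n)
  · intro n s
    obtain ⟨a, ha⟩ := hψ (level f N proj n s)
    exact ⟨a ^ p ^ (f * n), by rw [hφ, ha]⟩
  · intro m
    refine ⟨m + 1, fun a ha => ?_⟩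
    obtain ⟨b, rfl⟩ := hroot (m + 1) a
    rw [hφ] at ha
    obtain ⟨d, rfl⟩ := Ideal.mem_span_singleton.1 (hker b ha)
    rw [hI, Ideal.span_singleton_pow, Ideal.mem_span_singleton, mul_pow, ← pow_mul]
    refine (pow_dvd_pow t ?_).mul_right _
    rw [pow_mul, pow_succ, mul_comm]
    exact Nat.mul_le_mul_right _ (Nat.lt_pow_self hq).le
  · intro n
    refine ⟨p ^ (f * n), fun a ha => ?_⟩
    rw [hI, Ideal.span_singleton_pow, Ideal.mem_span_singleton] at ha
    obtain ⟨d, rfl⟩ := ha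
    obtain ⟨d, rfl⟩ := hroot n d
    rw [← mul_pow, hφ, map_mul, ht, zero_mul]

end Perfection

/-! ### The tilt and the reduction modulo the uniformizer -/

section Tilt

variable {E : Type u} [NontriviallyNormedField E] [IsUltrametricDist E] [ProperSpace E]
  (F : IntermediateField E (AlgebraicClosure E)) (p : ℕ) [Fact p.Prime] [NormedAlgebra ℚ_[p] E]
  {π : OO E}

theorem resDeg_ne_zero : resDeg p E ≠ 0 := by
  intro h
  have h1 := resCard_eq p E
  rw [h, pow_zero] at h1
  exact (one_lt_resCard (E := E)).ne' h1

theorem toOOHat_dvd_p (hπ : Irreducible π) : toOOHat F π ∣ (p : OO (Hat F)) := by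
  have h : π ∣ (p : OO E) := by
    rw [← Ideal.mem_span_singleton, ← hπ.maximalIdeal_eq]
    exact not_isUnit_p p E
  simpa using map_dvd (toOOHat F) h

/-- The projection from the integers modulo `p` to the integers modulo the uniformizer. -/
def modPToModPi (hπ : Irreducible π) : ModP (OO (Hat F)) p →+* ModPi F π :=
  Ideal.Quotient.lift (Ideal.span {(p : OO (Hat F))}) (mkPi F π) fun _ hx =>
    mkPi_eq_zero_iff_dvd.2 ((toOOHat_dvd_p F p hπ).trans (Ideal.mem_span_singleton.1 hx))

/-- The map from the integers modulo the uniformizer to the integers modulo `p` which raises lifts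
to the power `q ^ N`, with `N` as in the definition of the Teichmüller map. -/
def teichPi (hπ : Irreducible π) : ModPi F π →+* ModP (OO (Hat F)) p :=
  Ideal.Quotient.lift (Ideal.span {toOOHat F π})
    ((iterateFrobenius (ModP (OO (Hat F)) p) p (resDeg p E * teichExp p E)).comp
      (Ideal.Quotient.mk _)) fun x hx => by
    have hm : π ∈ IsLocalRing.maximalIdeal (OO E) := hπ.not_isUnit
    have h := map_dvd (toOOHat F) ((exists_pow_mem (E := E) p).choose_spec π hm)
    rw [map_natCast, map_pow] at h
    rw [RingHom.comp_apply, iterateFrobenius_def, ← map_pow, Ideal.Quotient.eq_zero_iff_mem,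
      Ideal.mem_span_singleton]
    exact h.trans (pow_dvd_pow_of_dvd (Ideal.mem_span_singleton.1 hx) _)

variable (hπ : Irreducible π)

theorem teichPi_mkPi (x : OO (Hat F)) : teichPi F p hπ (mkPi F π x) =
    (Ideal.Quotient.mk _ x : ModP (OO (Hat F)) p) ^ p ^ (resDeg p E * teichExp p E) := rfl

theorem modPToModPi_mk (x : OO (Hat F)) :
    modPToModPi F p hπ (Ideal.Quotient.mk _ x) = mkPi F π x := rfl

theorem teichPi_modPToModPi (y : ModP (OO (Hat F)) p) :
    teichPi F p hπ (modPToModPi F p hπ y) = y ^ p ^ (resDeg p E * teichExp p E) := by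
  obtain ⟨x, rfl⟩ := Ideal.Quotient.mk_surjective y
  rfl

theorem modPToModPi_teichPi (b : ModPi F π) :
    modPToModPi F p hπ (teichPi F p hπ b) = b ^ p ^ (resDeg p E * teichExp p E) := by
  obtain ⟨x, rfl⟩ := mkPi_surjective b
  rw [teichPi_mkPi, map_pow, modPToModPi_mk]

theorem teichMod_eq : teichMod F p = (teichPi F p hπ).comp (resModPi F hπ) := by
  refine RingHom.ext fun c => ?_
  obtain ⟨a, rfl⟩ := IsLocalRing.residue_surjective c
  rfl

/-- The maps from the ring of integers of the tilt to the integers modulo the uniformizer; the map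
of level `n + 1`, raised to the `q`-th power, is the map of level `n`. -/
def tiltLevel (n : ℕ) : OTilt F p →+* ModPi F π :=
  (modPToModPi F p hπ).comp (PreTilt.coeff (resDeg p E * (n + teichExp p E)))

theorem tiltLevel_apply (n : ℕ) (s : OTilt F p) : tiltLevel F p hπ n s =
    modPToModPi F p hπ (PreTilt.coeff (resDeg p E * (n + teichExp p E)) s) := rfl

theorem preTilt_coeff_add_pow (m j : ℕ) (s : OTilt F p) :
    PreTilt.coeff (m + j) s ^ p ^ j = PreTilt.coeff m s := by
  induction j with
  | zero => rw [pow_zero, pow_one, add_zero]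
  | succ j ih => rw [pow_succ', pow_mul, ← add_assoc, PreTilt.coeff_pow_p, ih]

theorem tiltLevel_succ_pow (n : ℕ) (s : OTilt F p) :
    tiltLevel F p hπ (n + 1) s ^ resCard E = tiltLevel F p hπ n s := by
  rw [resCard_eq p E, tiltLevel_apply, ← map_pow, tiltLevel_apply,
    show resDeg p E * (n + 1 + teichExp p E) = resDeg p E * (n + teichExp p E) + resDeg p E by ring,
    preTilt_coeff_add_pow]

/-- The action of an automorphism of `F` modulo `p`. -/
def galModP (σ : F ≃ₐ[E] F) : ModP (OO (Hat F)) p →+* ModP (OO (Hat F)) p :=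
  Ideal.quotientMap (Ideal.span {(p : OO (Hat F))}) (galOO F σ) (by
    rw [Ideal.span_le, Set.singleton_subset_iff]
    simp [Ideal.mem_span_singleton_self (p : OO (Hat F))])

theorem coeff_galTilt (σ : F ≃ₐ[E] F) (n : ℕ) (s : OTilt F p) :
    PreTilt.coeff n (galTilt F p σ s) = galModP F p σ (PreTilt.coeff n s) := rfl

theorem modPToModPi_galModP (σ : F ≃ₐ[E] F) (y : ModP (OO (Hat F)) p) :
    modPToModPi F p hπ (galModP F p σ y) = galModPi σ (modPToModPi F p hπ y) := by
  obtain ⟨x, rfl⟩ := Ideal.Quotient.mk_surjective y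
  exact (galModPi_mkPi σ x).symm

theorem tiltLevel_galTilt (σ : F ≃ₐ[E] F) (n : ℕ) (s : OTilt F p) :
    tiltLevel F p hπ n (galTilt F p σ s) = galModPi σ (tiltLevel F p hπ n s) := by
  rw [tiltLevel_apply, coeff_galTilt, modPToModPi_galModP, ← tiltLevel_apply]

/-- Continuous homomorphisms from the ring of integers of the tilt to discrete rings factor through
some `tiltLevel`. -/
theorem exists_tiltLevel_of_continuous {R : Type*} [Ring R] {f : OTilt F p →+* R}
    (hf : Continuous[_, ⊥] f) : ∃ n, ∀ s, tiltLevel F p hπ n s = 0 → f s = 0 := by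
  obtain ⟨n, hn⟩ := exists_level_of_continuous
    (u := fun n => (PreTilt.coeff (O := OO (Hat F)) (p := p) n).toAddMonoidHom)
    (f := f.toAddMonoidHom) (fun n x hx => by
      have h := PreTilt.coeff_pow_p x n
      have hx' : PreTilt.coeff (n + 1) x = 0 := hx
      rw [hx', zero_pow (Fact.out : p.Prime).ne_zero] at h
      exact h.symm) hf
  refine ⟨n, fun s hs => hn s ?_⟩
  refine (coeff_eq_level_pow (teichPi_modPToModPi F p hπ) (resDeg_ne_zero p) n s).trans ?_
  have hs' : level (resDeg p E) (teichExp p E) (modPToModPi F p hπ) n s = 0 := hs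
  rw [hs', map_zero, zero_pow (pow_ne_zero _ (Fact.out : p.Prime).ne_zero)]

end Tilt

section TiltTower

variable {E : Type u} [NontriviallyNormedField E] [IsUltrametricDist E] [ProperSpace E]
  {H : FormalModule (OO E)} {π : OO E} {z : ℕ → AlgebraicClosure E} (p : ℕ) [Fact p.Prime]
  [NormedAlgebra ℚ_[p] E]

namespace FormalModule.IsTateGenerator

variable (hπ : Irreducible π) (hH : H.red π = PowerSeries.X ^ resCard E)
  (hz : H.IsTateGenerator π z)

/-- The tilt of `E_∞` is the completion of `𝔽_q[T^{1/q^∞}]`; the isomorphism sends `T^{1/q^n}` to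
the system of the reductions of `zₙ, zₙ₊₁, …`. -/
theorem exists_tilt_equiv :
    ∃ Φ : PerfectSeries (Res E) (resCard E) ≃A[Res E] OTilt (H.tower π) p,
      ∀ n a, tiltLevel (H.tower π) p hπ n
        (Φ (polyToSeries (Res E) (resCard E) (a ^ resCard E ^ n))) = hz.reduction hπ hH a := by
  have : CharP (Res E) p := charP_res p E
  have hq := resCard_eq p E
  have : PerfectRing (PerfectPoly (Res E) (resCard E)) p :=
    perfectRing_perfectPoly (resDeg_ne_zero p) hq
  have hred : (hz.reduction hπ hH).comp (algebraMap (Res E) _) = resModPi (H.tower π) hπ :=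
    RingHom.ext (hz.reduction_algebraMap hπ hH)
  let _ : Algebra (Res E) (Perfection (ModP (OO (Hat (H.tower π))) p) p) :=
    inferInstanceAs (Algebra (Res E) (OTilt (H.tower π) p))
  have hT : polyRoot (Res E) (resCard_ne_zero E) 1 ^ p ^ resDeg p E =
      polyRoot (Res E) (resCard_ne_zero E) 0 := by rw [← hq, polyRoot_succ_pow]
  have halg : algebraMap (Res E) (Perfection (ModP (OO (Hat (H.tower π))) p) p) =
      Perfection.lift p (Res E) _ ((teichPi (H.tower π) p hπ).comp
        ((hz.reduction hπ hH).comp (algebraMap (Res E) _))) := by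
    rw [hred, ← teichMod_eq]
    rfl
  have h0 : hz.reduction hπ hH (polyRoot (Res E) (resCard_ne_zero E) 0) = 0 := by
    rw [reduction_polyRoot, modPi_eq_zero_iff]
    change ‖z 0‖ ≤ _
    rw [hz.zero, norm_zero]
    exact norm_nonneg _
  obtain ⟨e, he⟩ := exists_adicCompletion_equiv_perfection (k := Res E)
    (tS := preTiltTopology p (OO (Hat (H.tower π))))
    (teichPi_modPToModPi (H.tower π) p hπ) (modPToModPi_teichPi (H.tower π) p hπ)
    (I := idealT (Res E) (resCard E)) rfl rfl halg (resDeg_ne_zero p)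
    (hz.reduction_surjective hπ hH) (hT ▸ idealT_eq _) (hT ▸ h0)
    (fun a ha => hz.mem_of_reduction_eq_zero hπ hH ha)
  refine ⟨e, fun n a => ?_⟩
  have h := he n a
  rw [pow_mul p, ← hq] at h
  exact h

end FormalModule.IsTateGenerator

end TiltTower

/-! ### The Galois action and Frobenius on the tilt -/

/-- Polynomials over a finite field commute with its Frobenius. -/
theorem aeval_pow_card_pow {k S : Type*} [Field k] [Finite k] [CommRing S] [Algebra k S]
    (P : Polynomial k) (x : S) (j : ℕ) :
    Polynomial.aeval x P ^ Nat.card k ^ j = Polynomial.aeval (x ^ Nat.card k ^ j) P := by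
  have := Fintype.ofFinite k
  induction j with
  | zero => simp
  | succ j ih =>
    rw [pow_succ, pow_mul, ih, ← map_pow, Nat.card_eq_fintype_card, ← FiniteField.expand_card,
      Polynomial.expand_aeval, ← pow_mul]

section Frobenius

variable {E : Type u} [NontriviallyNormedField E] [IsUltrametricDist E] [ProperSpace E]
  (F : IntermediateField E (AlgebraicClosure E)) (p : ℕ) [Fact p.Prime] [NormedAlgebra ℚ_[p] E]
  {π : OO E} (hπ : Irreducible π)

theorem frobTilt_pow_apply (m : ℕ) (s : OTilt F p) :
    (frobTilt F p ^ m) s = s ^ resCard E ^ m := by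
  induction m with
  | zero => simp
  | succ m ih => rw [pow_succ', RingAut.mul_apply, ih, frobTilt_apply, ← pow_mul, ← pow_succ]

theorem frobTilt_zpow_pow {m : ℤ} {i j : ℕ} (h : (i : ℤ) = j + m) (s : OTilt F p) :
    (frobTilt F p ^ m) (s ^ resCard E ^ j) = s ^ resCard E ^ i := by
  rw [← frobTilt_pow_apply, ← frobTilt_pow_apply, ← RingAut.mul_apply, ← zpow_natCast,
    ← zpow_natCast, ← zpow_add, h, add_comm]

theorem tiltLevel_add_pow (n j : ℕ) (s : OTilt F p) :
    tiltLevel F p hπ (n + j) s ^ resCard E ^ j = tiltLevel F p hπ n s := by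
  induction j with
  | zero => simp
  | succ j ih => rw [pow_succ', pow_mul, ← add_assoc, tiltLevel_succ_pow, ih]

theorem tiltLevel_eq_zero_of_le {m n : ℕ} (h : m ≤ n) {s : OTilt F p}
    (hs : tiltLevel F p hπ n s = 0) : tiltLevel F p hπ m s = 0 := by
  obtain ⟨j, rfl⟩ := Nat.exists_eq_add_of_le h
  rw [← tiltLevel_add_pow F p hπ m j, hs, zero_pow (pow_ne_zero _ (resCard_ne_zero E))]

theorem tiltLevel_frobTilt_zpow (m : ℤ) (n : ℕ) {s : OTilt F p}
    (hs : tiltLevel F p hπ (n + m.natAbs) s = 0) :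
    tiltLevel F p hπ n ((frobTilt F p ^ m) s) = 0 := by
  obtain ⟨i, hi⟩ : ∃ i : ℕ, (i : ℤ) = m.natAbs + m := ⟨(m.natAbs + m).toNat, by omega⟩
  rw [← tiltLevel_add_pow F p hπ n m.natAbs, ← map_pow, ← map_pow, frobTilt_zpow_pow F p hi,
    map_pow, hs, zero_pow (pow_ne_zero _ (resCard_ne_zero E))]

theorem frobTilt_zpow_algebraMap (m : ℤ) (c : Res E) :
    (frobTilt F p ^ m) (algebraMap (Res E) (OTilt F p) c) = algebraMap (Res E) (OTilt F p) c := by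
  have h : frobTilt F p ∈
      MulAction.stabilizer (RingAut (OTilt F p)) (algebraMap (Res E) (OTilt F p) c) := by
    have := Fintype.ofFinite (Res E)
    change frobTilt F p _ = _
    rw [frobTilt_apply, ← map_pow, resCard, Nat.card_eq_fintype_card, FiniteField.pow_card]
  exact zpow_mem h m

theorem galTilt_algebraMap (σ : F ≃ₐ[E] F) (c : Res E) :
    galTilt F p σ (algebraMap (Res E) (OTilt F p) c) = algebraMap (Res E) (OTilt F p) c := by
  have := charP_res p E
  have h : (galTilt F p σ).comp (algebraMap (Res E) (OTilt F p)) =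
      algebraMap (Res E) (OTilt F p) := by
    refine Perfection.hom_ext p fun c => ?_
    obtain ⟨a, rfl⟩ := IsLocalRing.residue_surjective c
    change galModP F p σ (Ideal.Quotient.mk _ (toOOHat F a) ^ p ^ _) = _
    rw [map_pow]
    change (Ideal.Quotient.mk _ (galOO F σ (toOOHat F a)) : ModP (OO (Hat F)) p) ^ p ^ _ = _
    rw [galOO_toOOHat]
    rfl
  exact RingHom.congr_fun h c

end Frobenius

section Galois

variable {E : Type u} [NontriviallyNormedField E] [IsUltrametricDist E] [ProperSpace E]
  {H : FormalModule (OO E)} {π : OO E} {z : ℕ → AlgebraicClosure E} (p : ℕ) [Fact p.Prime]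
  [NormedAlgebra ℚ_[p] E]

namespace FormalModule.IsTateGenerator

variable (hπ : Irreducible π) (hH : H.red π = PowerSeries.X ^ resCard E)
  (hz : H.IsTateGenerator π z)

/-- If `σ` acts on the torsion points as `[v]`, then it sends the reduction of `zₙ` to a truncation
of `[v](T)`, evaluated at the reduction of `zₙ`. -/
theorem exists_galModPi_reduction {v : (OO E)ˣ} {σ : H.tower π ≃ₐ[E] H.tower π}
    (h : Corresponds z v σ) (n : ℕ) : ∃ D₀, ∀ D ≥ D₀,
      galModPi σ (hz.reduction hπ hH (polyRoot (Res E) (resCard_ne_zero E) n)) =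
        hz.reduction hπ hH (Polynomial.aeval (polyRoot (Res E) (resCard_ne_zero E) n)
          ((H.red v).trunc D)) := by
  obtain ⟨D₀, hD₀⟩ := exists_pow_lt_of_lt_one (norm_pi_pos hπ) (hz.norm_lt n)
  refine ⟨D₀, fun D hD => ?_⟩
  have h1 : (H.red v).trunc D = ((H.act v).trunc D).map (IsLocalRing.residue (OO E)) := by
    rw [red, PowerSeries.trunc_map]
  rw [h1, reduction_aeval, reduction_polyRoot,
    galModPi_modPi σ (y := ⟨σ (hz.int n : H.tower π), mem_OO_iff.2 ((norm_gal _ σ _).trans_le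
      (mem_OO_iff.1 (hz.int n).2))⟩) rfl, modPi_eq_iff, coe_eval₂_int]
  have h2 : ((σ (hz.int n : H.tower π) : H.tower π) : AlgebraicClosure E) = H.pt v (z n) :=
    (galLift_apply σ _).symm.trans (h n)
  change ‖((σ (hz.int n : H.tower π) : H.tower π) : AlgebraicClosure E) - _‖ ≤ _
  rw [h2]
  refine (norm_evalPt_sub_trunc_le (hz.norm_lt n) _ D).trans ?_
  exact (pow_le_pow_of_le_one (norm_nonneg _) (hz.norm_lt n).le hD).trans hD₀.le

variable {p} in
/-- If `σ` acts on the torsion points as `[v]`, then its action on the tilt sends `T^{1/q^n}` to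
`[v](T^{1/q^n})`. -/
theorem exists_tiltLevel_galTilt {φ : PerfectPoly (Res E) (resCard E) →+* OTilt (H.tower π) p}
    (hφ : ∀ n a, tiltLevel (H.tower π) p hπ n (φ (a ^ resCard E ^ n)) = hz.reduction hπ hH a)
    {v : (OO E)ˣ} {σ : H.tower π ≃ₐ[E] H.tower π} (h : Corresponds z v σ) (j n : ℕ) :
    ∃ D₀, ∀ D ≥ D₀,
      tiltLevel (H.tower π) p hπ j
        (galTilt (H.tower π) p σ (φ (polyRoot (Res E) (resCard_ne_zero E) n))) =
      tiltLevel (H.tower π) p hπ j (φ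
        (Polynomial.aeval (polyRoot (Res E) (resCard_ne_zero E) n) ((H.red v).trunc D))) := by
  obtain ⟨D₀, hD₀⟩ := hz.exists_galModPi_reduction hπ hH h (n + j)
  refine ⟨D₀, fun D hD => ?_⟩
  rw [tiltLevel_galTilt, ← polyRoot_add_pow (resCard_ne_zero E) n j, hφ, hD₀ D hD, ← hφ j]
  exact congrArg (fun a => tiltLevel _ p hπ j (φ a)) (aeval_pow_card_pow _ _ j)

end FormalModule.IsTateGenerator

end Galois

/-! ### Points of the universal cover -/

section PowerSeriesPoints

variable {k R : Type u} [CommRing k] [CommRing R] [Algebra k R]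

/-- A homomorphism from `k⟦T⟧` with `T` nilpotent in the image is evaluation of truncations. -/
theorem powerSeries_hom_apply {y : PowerSeries k →ₐ[k] R} {D : ℕ}
    (hD : y PowerSeries.X ^ D = 0) (f : PowerSeries k) :
    y f = Polynomial.aeval (y PowerSeries.X) (f.trunc D) := by
  have h (P : Polynomial k) : y (P : PowerSeries k) = Polynomial.aeval (y PowerSeries.X) P := by
    have h1 : y.comp (Polynomial.coeToPowerSeries.algHom k) =
        Polynomial.aeval (y PowerSeries.X) := by
      refine Polynomial.algHom_ext ?_
      simp
    have h2 := AlgHom.congr_fun h1 P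
    simpa using h2
  conv_lhs => rw [f.eq_X_pow_mul_shift_add_trunc D]
  rw [map_add, map_mul, map_pow, hD, zero_mul, zero_add, h]

theorem exists_X_pow_eq_zero (y : PowerSeries k →ₐ[k] R) (hy : Continuous[_, ⊥] y) :
    ∃ D, y PowerSeries.X ^ D = 0 := by
  let _ : TopologicalSpace k := ⊥
  let _ : TopologicalSpace R := ⊥
  have : DiscreteTopology R := ⟨rfl⟩
  have h := PowerSeries.WithPiTopology.isTopologicallyNilpotent_of_constantCoeff_zero
    (R := k) (f := PowerSeries.X) PowerSeries.constantCoeff_X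
  have h1 := (hy.tendsto 0).comp h
  rw [map_zero, nhds_discrete, Filter.tendsto_pure] at h1
  obtain ⟨D, hD⟩ := h1.exists
  exact ⟨D, by rw [← map_pow]; exact hD⟩

theorem powerSeries_hom_ext {y y' : PowerSeries k →ₐ[k] R} (hy : Continuous[_, ⊥] y)
    (h : y PowerSeries.X = y' PowerSeries.X) : y = y' := by
  obtain ⟨D, hD⟩ := exists_X_pow_eq_zero y hy
  refine AlgHom.ext fun f => ?_
  rw [powerSeries_hom_apply hD, powerSeries_hom_apply (y := y') (D := D) (by rw [← h, hD]), h]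

theorem exists_powerSeries_hom {r : R} (hr : IsNilpotent r) :
    ∃ y : PowerSeries k →ₐ[k] R, Continuous[_, ⊥] y ∧ y PowerSeries.X = r := by
  let _ : UniformSpace k := ⊥
  let _ : UniformSpace R := ⊥
  have : DiscreteUniformity k := ⟨rfl⟩
  have : DiscreteUniformity R := ⟨rfl⟩
  have : DiscreteTopology k := ⟨rfl⟩
  have : ContinuousSMul k R := ⟨continuous_of_discreteTopology⟩
  have h : PowerSeries.HasEval r := by
    obtain ⟨D, hD⟩ := hr
    refine tendsto_atTop_of_eventually_const (i₀ := D) fun i hi => ?_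
    exact pow_eq_zero_of_le hi hD
  exact ⟨PowerSeries.aeval h, PowerSeries.continuous_aeval h, by
    rw [← Polynomial.coe_X, PowerSeries.aeval_coe, Polynomial.aeval_X]⟩

end PowerSeriesPoints

section PerfectSeriesPoints

variable {k R : Type u} [CommRing k] [CommRing R] [Algebra k R] {q : ℕ} (hq : q ≠ 0)

theorem exists_eval_of_continuous {S : Type*} [CommRing S] {h : PerfectSeries k q →+* S}
    (hc : Continuous[_, ⊥] h) :
    ∃ n, ∀ x, AdicCompletion.evalₐ (idealT k q) n x = 0 → h x = 0 := by
  refine exists_level_of_continuous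
    (u := fun n => (AdicCompletion.evalₐ (idealT k q) n).toRingHom.toAddMonoidHom)
    (f := h.toAddMonoidHom) (fun n x hx => ?_) hc
  have hx' : AdicCompletion.evalₐ (idealT k q) (n + 1) x = Ideal.Quotient.mk _ 0 := by
    rw [map_zero]; exact hx
  exact (evalA_eq_mk_of_le n.le_succ hx').trans (map_zero _)

theorem rootT_succ_pow (n : ℕ) : rootT k q hq (n + 1) ^ q = rootT k q hq n := by
  rw [rootT_eq, rootT_eq, ← map_pow, polyRoot_succ_pow]

/-- A point of the formal spectrum of `k⟦T^{1/q^∞}⟧` is determined by the images of the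
`T^{1/q^n}`. -/
theorem perfectSeries_hom_ext {h h' : PerfectSeries k q →ₐ[k] R} (hc : Continuous[_, ⊥] h)
    (hc' : Continuous[_, ⊥] h') (heq : ∀ n, h (rootT k q hq n) = h' (rootT k q hq n)) : h = h' := by
  obtain ⟨n, hn⟩ := exists_eval_of_continuous (h := h.toRingHom) hc
  obtain ⟨n', hn'⟩ := exists_eval_of_continuous (h := h'.toRingHom) hc'
  have h1 : (h.comp (polyToSeries k q)).toRingHom = (h'.comp (polyToSeries k q)).toRingHom :=
    perfectPoly_hom_ext hq (fun c => ((h.comp (polyToSeries k q)).commutes c).trans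
      ((h'.comp (polyToSeries k q)).commutes c).symm) fun n => heq n
  refine AlgHom.ext fun x => ?_
  obtain ⟨a, ha⟩ := Ideal.Quotient.mk_surjective
    (AdicCompletion.evalₐ (idealT k q) (max n n') x)
  have h2 : AdicCompletion.evalₐ (idealT k q) (max n n') (x - polyToSeries k q a) =
      Ideal.Quotient.mk _ 0 := by
    rw [map_sub, ← ha, polyToSeries_apply, AdicCompletion.evalₐ_of, sub_self, map_zero]
  have h3 := hn _ ((evalA_eq_mk_of_le (le_max_left _ _) h2).trans (map_zero _))
  have h4 := hn' _ ((evalA_eq_mk_of_le (le_max_right _ _) h2).trans (map_zero _))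
  rw [map_sub, sub_eq_zero] at h3 h4
  exact h3.trans ((RingHom.congr_fun h1 a).trans h4.symm)

theorem isNilpotent_apply_rootT {h : PerfectSeries k q →ₐ[k] R} (hc : Continuous[_, ⊥] h) (n : ℕ) :
    IsNilpotent (h (rootT k q hq n)) := by
  obtain ⟨m, hm⟩ := exists_eval_of_continuous (h := h.toRingHom) hc
  refine ⟨q ^ n * m, ?_⟩
  rw [rootT_eq, pow_mul, ← map_pow, ← map_pow, ← map_pow, ← map_pow]
  refine hm _ ?_
  have h0 := polyRoot_add_pow (k := k) hq 0 n
  rw [zero_add] at h0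
  rw [polyToSeries_apply, AdicCompletion.evalₐ_of, Ideal.Quotient.eq_zero_iff_mem, h0, idealT_eq hq]
  exact Ideal.pow_mem_pow (Ideal.mem_span_singleton_self _) m

/-- A system of nilpotent `q`-power roots is the image of the system of the `T^{1/q^n}`. -/
theorem exists_perfectSeries_hom {r : ℕ → R} (hr : ∀ n, r (n + 1) ^ q = r n)
    (h0 : IsNilpotent (r 0)) :
    ∃ h : PerfectSeries k q →ₐ[k] R, Continuous[_, ⊥] h ∧ ∀ n, h (rootT k q hq n) = r n := by
  obtain ⟨D, hD⟩ := h0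
  have hI (a) (ha : a ∈ idealT k q ^ D) : rootLift k hr hq a = 0 := by
    rw [idealT_eq hq, Ideal.span_singleton_pow, Ideal.mem_span_singleton] at ha
    obtain ⟨b, rfl⟩ := ha
    rw [map_mul, map_pow, rootLift_polyRoot, hD, zero_mul]
  let g : (PerfectPoly k q ⧸ idealT k q ^ D) →ₐ[k] R :=
    Ideal.Quotient.liftₐ (idealT k q ^ D) (rootLift k hr hq) hI
  refine ⟨g.comp ((AdicCompletion.evalₐ (idealT k q) D).restrictScalars k),
    continuous_bot_of_factors D fun x x' h => congrArg g h, fun n => ?_⟩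
  refine (congrArg g (AdicCompletion.evalₐ_of (idealT k q) D _)).trans ?_
  exact rootLift_polyRoot hr hq n

end PerfectSeriesPoints

section Cover

variable {O : Type u} [CommRing O] [IsLocalRing O] (H : FormalModule O) {π : O}

local notation "κ" => IsLocalRing.ResidueField O

namespace FormalModule

theorem hom_endo (a : O) {R : CommAlgCat.{u} κ} (y : (special O).obj R) :
    Spf.hom ((H.endo a).app R y) PowerSeries.X = Spf.hom y (H.red a) := by
  refine congrArg (Spf.hom y) ?_
  exact (congrFun (PowerSeries.coe_substAlgHom (R := κ) (H.hasSubst_red a)) _).trans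
    (PowerSeries.subst_X (H.hasSubst_red a))

theorem special_ext {R : CommAlgCat.{u} κ} {y y' : (special O).obj R}
    (h : Spf.hom y PowerSeries.X = Spf.hom y' PowerSeries.X) : y = y' :=
  Spf.hom_injective (powerSeries_hom_ext (Subtype.property y) h)

theorem cover_ext {R : CommAlgCat.{u} κ} {x x' : (H.cover π).obj R}
    (h : ∀ n, Spf.hom (H.coord x n) PowerSeries.X = Spf.hom (H.coord x' n) PowerSeries.X) :
    x = x' :=
  Subtype.ext (funext fun n => special_ext (h n))

theorem spf_perfectSeries_ext {q : ℕ} (hq : q ≠ 0) {R : CommAlgCat.{u} κ}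
    {y y' : (Spf κ (PerfectSeries κ q)).obj R}
    (h : ∀ n, Spf.hom y (rootT κ q hq n) = Spf.hom y' (rootT κ q hq n)) : y = y' :=
  Spf.hom_injective (perfectSeries_hom_ext hq (Subtype.property y) (Subtype.property y') h)

variable {q : ℕ} (hq : q ≠ 0) (hH : H.red π = PowerSeries.X ^ q)

include hH in
theorem hom_coord_succ_pow {R : CommAlgCat.{u} κ} (x : (H.cover π).obj R) (n : ℕ) :
    Spf.hom (H.coord x (n + 1)) PowerSeries.X ^ q = Spf.hom (H.coord x n) PowerSeries.X := by
  rw [← H.coord_succ x n, hom_endo, hH, map_pow]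

include hH in
/-- The universal cover is the formal spectrum of `κ⟦T^{1/q^∞}⟧`. -/
theorem exists_cover_iso : ∃ α : H.cover π ≅ Spf κ (PerfectSeries κ q),
    ∀ (R : CommAlgCat.{u} κ) (x : (H.cover π).obj R) (n : ℕ),
      Spf.hom (α.hom.app R x) (rootT κ q hq n) = Spf.hom (H.coord x n) PowerSeries.X := by
  have h1 (R : CommAlgCat.{u} κ) (x : (H.cover π).obj R) :
      ∃ y : (Spf κ (PerfectSeries κ q)).obj R, ∀ n,
        Spf.hom y (rootT κ q hq n) = Spf.hom (H.coord x n) PowerSeries.X := by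
    obtain ⟨h, hc, h'⟩ := exists_perfectSeries_hom (k := κ) (R := R) hq
      (r := fun n => Spf.hom (H.coord x n) PowerSeries.X) (H.hom_coord_succ_pow hH x)
      (exists_X_pow_eq_zero _ (Subtype.property (H.coord x 0)))
    exact ⟨(⟨h, hc⟩ : SpfPoints κ _ R), h'⟩
  have h2 (R : CommAlgCat.{u} κ) (y : (Spf κ (PerfectSeries κ q)).obj R) :
      ∃ x : (H.cover π).obj R, ∀ n,
        Spf.hom (H.coord x n) PowerSeries.X = Spf.hom y (rootT κ q hq n) := by
    choose x hc hx using fun n => exists_powerSeries_hom (k := κ)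
      (isNilpotent_apply_rootT hq (h := Spf.hom y) (Subtype.property y) n)
    refine ⟨(⟨fun n => (⟨x n, hc n⟩ : SpfPoints κ _ R), fun n => special_ext ?_⟩ :
      H.CoverPoints π R), hx⟩
    refine (H.hom_endo π _).trans ?_
    change x (n + 1) (H.red π) = x n PowerSeries.X
    rw [hH, map_pow, hx, hx, ← map_pow, rootT_succ_pow]
  choose f hf using h1
  choose g hg using h2
  refine ⟨{ hom := { app := fun R => TypeCat.ofHom (f R), naturality := ?_ }
            inv := { app := fun R => TypeCat.ofHom (g R), naturality := ?_ }
            hom_inv_id := ?_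
            inv_hom_id := ?_ }, hf⟩
  · intro R S φ
    ext x
    exact spf_perfectSeries_ext hq fun n => (hf S _ n).trans (congrArg φ.hom (hf R x n)).symm
  · intro R S φ
    ext y
    exact H.cover_ext fun n => (hg S _ n).trans (congrArg φ.hom (hg R y n)).symm
  · ext R x
    exact H.cover_ext fun n => (hg R _ n).trans (hf R x n)
  · ext R y
    exact spf_perfectSeries_ext hq fun n => (hf R _ n).trans (hg R y n)

end FormalModule

end Cover

/-! ### Equivariance -/

section Equivariance

variable {E : Type u} [NontriviallyNormedField E] [IsUltrametricDist E] [ProperSpace E]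
  {H : FormalModule (OO E)} {π : OO E} {z : ℕ → AlgebraicClosure E}

namespace FormalModule

/-- The coordinates of `(π⁻ᵐ πⁱ v) x`, for a point `x` of the universal cover. -/
theorem exists_hom_coverShift (hH : H.red π = PowerSeries.X ^ resCard E) (v : OO E) (i m n : ℕ)
    {R : CommAlgCat.{u} (Res E)} (x : (H.cover π).obj R) : ∃ D₀, ∀ D ≥ D₀,
      Spf.hom (H.coord ((H.coverShift π (v * π ^ i) m).app R x) n) PowerSeries.X =
        Polynomial.aeval (Spf.hom (H.coord x (n + m)) PowerSeries.X ^ resCard E ^ i)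
          ((H.red v).trunc D) := by
  set y := Spf.hom (H.coord x (n + m)) with hy
  obtain ⟨D₀, hD₀⟩ := exists_X_pow_eq_zero y (Subtype.property (H.coord x (n + m)))
  refine ⟨D₀, fun D hD => ?_⟩
  have h1 : y.comp (PowerSeries.substAlgHom (H.hasSubst_red (π ^ i))) PowerSeries.X =
      y PowerSeries.X ^ resCard E ^ i := by
    rw [← map_pow, ← H.red_pow hH]
    exact (hom_endo H (π ^ i) (H.coord x (n + m)))
  refine (hom_endo H (v * π ^ i) (H.coord x (n + m))).trans ?_
  rw [← h1, ← powerSeries_hom_apply, red_mul, ← hy]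
  · exact congrArg y (congrFun (PowerSeries.coe_substAlgHom (H.hasSubst_red (π ^ i))) _).symm
  · rw [h1, ← pow_mul, mul_comm, pow_mul, pow_eq_zero_of_le hD hD₀, zero_pow]
    exact pow_ne_zero _ (resCard_ne_zero E)

theorem exists_coverAct_eq (hπ : Irreducible π) {a : E} {m : ℤ} {u : (OO E)ˣ}
    (ha : a = (π : E) ^ m * ((u : OO E) : E)) : ∃ i j : ℕ, (i : ℤ) = j + m ∧
      H.coverAct hπ a = H.coverShift π (u * π ^ i) j := by
  classical
  set j := Nat.find (exists_pow_mul_mem hπ a) with hj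
  have hmem : (π : E) ^ j * a ∈ OO E := Nat.find_spec (exists_pow_mul_mem hπ a)
  have hπ0 : (π : E) ≠ 0 := norm_pos_iff.1 (norm_pi_pos hπ)
  have ha' : (π : E) ^ j * a = (u : OO E) * (π : E) ^ ((j : ℤ) + m) := by
    rw [ha, zpow_add₀ hπ0, zpow_natCast]
    ring
  -- as `πʲ a` is an integer, `j + m` is not negative
  obtain ⟨i, hi⟩ : ∃ i : ℕ, (i : ℤ) = j + m := by
    refine ⟨((j : ℤ) + m).toNat, Int.toNat_of_nonneg ?_⟩
    have h := mem_OO_iff.1 hmem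
    rwa [ha', norm_mul, isUnit_OO_iff.1 u.isUnit, one_mul, norm_zpow,
      zpow_le_one_iff_right_of_lt_one₀ (norm_pi_pos hπ) (norm_pi_lt hπ)] at h
  refine ⟨i, j, hi, ?_⟩
  have h : (⟨(π : E) ^ j * a, hmem⟩ : OO E) = u * π ^ i := Subtype.ext (by
    push_cast
    rw [ha', ← hi, zpow_natCast])
  rw [← h]
  rfl

variable {p : ℕ} [Fact p.Prime] [NormedAlgebra ℚ_[p] E]

/-- Two homomorphisms from the tilt to a discrete ring are compared on the dense subring
`𝔽_q[T^{1/q^∞}]`, that is, on the elements `T^{1/q^n}`. -/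
theorem IsTateGenerator.hom_eq_hom_frobTilt_galTilt (hπ : Irreducible π)
    (hH : H.red π = PowerSeries.X ^ resCard E) (hz : H.IsTateGenerator π z)
    {φ : PerfectPoly (Res E) (resCard E) →ₐ[Res E] OTilt (H.tower π) p}
    (hφ : ∀ n a, tiltLevel (H.tower π) p hπ n (φ (a ^ resCard E ^ n)) = hz.reduction hπ hH a)
    {v : (OO E)ˣ} {σ : H.tower π ≃ₐ[E] H.tower π} (hσ : Corresponds z v σ)
    {m : ℤ} {i j : ℕ} (hi : (i : ℤ) = j + m) {R : Type*} [CommRing R] [Algebra (Res E) R]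
    {g g' : OTilt (H.tower π) p →ₐ[Res E] R} (hg : Continuous[_, ⊥] g) (hg' : Continuous[_, ⊥] g')
    (h : ∀ n, ∃ D₀, ∀ D ≥ D₀, g' (φ (polyRoot (Res E) (resCard_ne_zero E) n)) =
      Polynomial.aeval (g (φ (polyRoot (Res E) (resCard_ne_zero E) (n + j))) ^ resCard E ^ i)
        ((H.red v).trunc D)) (b : OTilt (H.tower π) p) :
    g' b = g ((frobTilt (H.tower π) p ^ m) (galTilt (H.tower π) p σ b)) := by
  obtain ⟨N, hN⟩ := exists_tiltLevel_of_continuous (H.tower π) p hπ (f := g.toRingHom) hg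
  obtain ⟨N', hN'⟩ := exists_tiltLevel_of_continuous (H.tower π) p hπ (f := g'.toRingHom) hg'
  let γ : OTilt (H.tower π) p →+* R :=
    g.toRingHom.comp ((frobTilt (H.tower π) p ^ m : RingAut _) : OTilt (H.tower π) p →+* _)
  have hγ (s) (hs : tiltLevel (H.tower π) p hπ (N + m.natAbs) s = 0) : γ s = 0 :=
    hN _ (tiltLevel_frobTilt_zpow (H.tower π) p hπ m N hs)
  -- modulo the kernels of level `M`, every element comes from `𝔽_q[T^{1/q^∞}]`
  let M := max (N + m.natAbs) N'
  have hγ' (s) (hs : tiltLevel (H.tower π) p hπ M s = 0) :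
      γ (galTilt (H.tower π) p σ s) = 0 := by
    refine hγ _ ?_
    rw [tiltLevel_galTilt, tiltLevel_eq_zero_of_le (H.tower π) p hπ (le_max_left _ _) hs, map_zero]
  obtain ⟨a, ha⟩ := hz.reduction_surjective hπ hH (tiltLevel (H.tower π) p hπ M b)
  have hb : tiltLevel (H.tower π) p hπ M (b - φ (a ^ resCard E ^ M)) = 0 := by
    rw [map_sub, hφ, ha, sub_self]
  have h1 := hN' _ (tiltLevel_eq_zero_of_le (H.tower π) p hπ (le_max_right _ _) hb)
  have h2 := hγ' _ hb
  rw [map_sub, sub_eq_zero] at h1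
  rw [map_sub, map_sub, sub_eq_zero] at h2
  refine h1.trans (Eq.trans ?_ h2.symm)
  have h3 : g'.toRingHom.comp φ.toRingHom =
      (γ.comp (galTilt (H.tower π) p σ)).comp φ.toRingHom := by
    refine perfectPoly_hom_ext (resCard_ne_zero E) (fun c => ?_) fun n => ?_
    · change g' (φ (algebraMap _ _ c)) = g ((frobTilt (H.tower π) p ^ m)
        (galTilt (H.tower π) p σ (φ (algebraMap _ _ c))))
      rw [φ.commutes, galTilt_algebraMap, frobTilt_zpow_algebraMap, g.commutes, g'.commutes]
    · obtain ⟨D₁, hD₁⟩ := h n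
      obtain ⟨D₂, hD₂⟩ := hz.exists_tiltLevel_galTilt hπ hH (φ := φ.toRingHom) hφ hσ
        (N + m.natAbs) n
      replace hD₂ := hD₂ (max D₁ D₂) (le_max_right _ _)
      rw [← sub_eq_zero, ← map_sub] at hD₂
      have h4 := hγ _ hD₂
      rw [map_sub, sub_eq_zero] at h4
      refine (hD₁ (max D₁ D₂) (le_max_left _ _)).trans (Eq.trans ?_ h4.symm)
      change _ = g ((frobTilt (H.tower π) p ^ m) (φ _))
      have h5 (x : PerfectPoly (Res E) (resCard E)) (P : Polynomial (Res E)) (l : ℕ) :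
          Polynomial.aeval (x ^ resCard E ^ l) P = Polynomial.aeval x P ^ resCard E ^ l :=
        (aeval_pow_card_pow P x l).symm
      -- on `q ^ j`-th powers `Frob ^ m` is given by powers even for negative `m`, whence the
      -- passage to `T^{1/q^(n + j)}`
      rw [← polyRoot_add_pow (resCard_ne_zero E) n j, h5, map_pow φ, frobTilt_zpow_pow _ p hi,
        ← map_pow, ← map_pow, ← map_pow, ← h5, Polynomial.aeval_algHom_apply,
        Polynomial.aeval_algHom_apply]
  exact RingHom.congr_fun h3 _

end FormalModule

end Equivariance

end LubinTate

end

theorem mainTheorem4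
    (p : ℕ) [Fact p.Prime]
    -- a finite extension `E` of `ℚ_p` with the absolute value extending that of `ℚ_p`
    -- (such an `E` is automatically nonarchimedean and locally compact)
    (E : Type u) [NontriviallyNormedField E] [IsUltrametricDist E] [ProperSpace E]
    [NormedAlgebra ℚ_[p] E] [FiniteDimensional ℚ_[p] E]
    -- a uniformizer `π` and a Lubin–Tate formal module: `[π](T) ≡ T ^ q` modulo `π`
    (π : OO E) (hπ : Irreducible π) (H : FormalModule (OO E))
    (hH : H.red π = PowerSeries.X ^ resCard E) :
    -- the isomorphism `O_E^× ≃ Gal(E_∞/E)`: a unit `u` acts on the torsion points by `[u]`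
    ∃ rec : (OO E)ˣ ≃ₜ* (H.tower π ≃ₐ[E] H.tower π),
      (∀ (u : (OO E)ˣ) (n : ℕ) (x : H.tower π), (x : AlgebraicClosure E) ∈ H.torsion (π ^ n) →
        H.EvalsTo u x (rec u x)) ∧
      ∃ (α : H.cover π ≅ Spf (Res E) (PerfectSeries (Res E) (resCard E)))
        (Φ : PerfectSeries (Res E) (resCard E) ≃A[Res E] OTilt (H.tower π) p),
        -- `α` identifies `T ^ (1 / q ^ n)` with the coordinate of the `n`-th copy of `H₀`
        (∀ (R : CommAlgCat.{u} (Res E)) (x : (H.cover π).obj R) (n : ℕ),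
          Spf.hom (α.hom.app R x) (rootT (Res E) (resCard E) (resCard_ne_zero E) n) =
            Spf.hom (H.coord x n) PowerSeries.X) ∧
        -- the isomorphism from the universal cover to `Spf` of the tilt is `E^×`-equivariant
        (∀ (a : E) (m : ℤ) (u : (OO E)ˣ), a = (π : E) ^ m * ((u : OO E) : E) →
          ∀ (R : CommAlgCat.{u} (Res E)) (x : (H.cover π).obj R) (b : OTilt (H.tower π) p),
            Spf.hom ((α ≪≫ Spf.mapIso Φ).hom.app R ((H.coverAct hπ a).app R x)) b =
              Spf.hom ((α ≪≫ Spf.mapIso Φ).hom.app R x)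
                ((frobTilt (H.tower π) p ^ m) (galTilt (H.tower π) p (rec u) b))) := by
  have : CharZero E := charZero_of_injective_algebraMap (algebraMap ℚ_[p] E).injective
  obtain ⟨z, hz⟩ := FormalModule.exists_tateGenerator (H := H) hπ hH
  obtain ⟨rec, hrec⟩ := FormalModule.exists_reciprocity hz hπ hH
  obtain ⟨α, hα⟩ := H.exists_cover_iso (resCard_ne_zero E) hH
  obtain ⟨Φ, hΦ⟩ := hz.exists_tilt_equiv p hπ hH
  refine ⟨rec, fun u n x hx => (hrec u).apply hz hπ hH hx, α, Φ, hα, ?_⟩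
  intro a m u ha R x b
  obtain ⟨i, j, hi, hact⟩ := FormalModule.exists_coverAct_eq (H := H) hπ ha
  have hroot (x : (H.cover π).obj R) (n : ℕ) :
      Spf.hom ((α ≪≫ Spf.mapIso Φ).hom.app R x)
        (Φ (rootT (Res E) (resCard E) (resCard_ne_zero E) n)) =
      Spf.hom (H.coord x n) PowerSeries.X :=
    (congrArg (Spf.hom (α.hom.app R x)) (Φ.symm_apply_apply _)).trans (hα R x n)
  -- both sides are compared at the elements `T ^ (1 / q ^ n)`, whose images are coordinates of `x`
  rw [hact]
  refine hz.hom_eq_hom_frobTilt_galTilt hπ hH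
    (φ := (Φ : _ →A[Res E] _).toAlgHom.comp (polyToSeries (Res E) (resCard E))) hΦ (hrec u) hi
    (Subtype.property ((α ≪≫ Spf.mapIso Φ).hom.app R x))
    (Subtype.property ((α ≪≫ Spf.mapIso Φ).hom.app R _)) (fun n => ?_) b
  obtain ⟨D₀, hD₀⟩ := H.exists_hom_coverShift hH u i j n x
  refine ⟨D₀, fun D hD => (hroot _ n).trans ((hD₀ D hD).trans ?_)⟩
  rw [← hroot x (n + j)]
  rfl
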